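/- \textbf{Conventions.} A nondegenerate hypersurface $x:M^m\to\mathbb R^{m+1}$ ($m\ge 1$, smooth, with a chosen side) has in positively oriented local coordinates $h_{ij}=\det(\partial_1x,\dots,\partial_mx,\partial_i\partial_jx)$, affine metric $g=|\det(h_{ij})|^{-1/(m+2)}h$ (possibly indefinite), affine normal $\xi=\frac1m\Delta_g x$, induced affine connection $\nabla$ and shape operator $B$ given by $D_XY=x_*(\nabla_XY)+g(X,Y)\xi$ and $D_X\xi=-x_*(BX)$, and Fubini–Pick form $A=-\frac12\nabla g$, also viewed as a $TM$-valued symmetric bilinear form through $g(A(X,Y),Z)=A(X,Y,Z)$. It is a \emph{hyperbolic affine hypersphere with affine mean curvature $L$ and affine center the origin} if $B=L\cdot\mathrm{id}$ for a constant $L<0$ and all affine normal lines pass through the origin. \textbf{Data.} Let $r,s\ge 0$ be integers with $K:=r+s\ge 2$. For $1\le\alpha\le s$ let $x_\alpha:M_\alpha\to\mathbb R^{n_\alpha+1}$ be a hyperbolic affine hypersphere of dimension $n_\alpha>0$ with affine mean curvature $L^{(\alpha)}$, affine center the origin, affine metric $g^{(\alpha)}$ and Fubini–Pick form $A^{(\alpha)}$,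 and let $c_1,\dots,c_K>0$. Assign dimension $0$ to the factors $1,\dots,r$ (points) and dimension $n_\alpha$ to the factor $\tilde\alpha:=r+\alpha$; let $f_a$ be the sum of (dimension $+1$) over the first $a$ factors ($f_0=0$), write $d_a$ for the dimension of the factor $a$, and put $$e_a=\exp\Big(-\frac{t^{a-1}}{d_a+1}+\sum_{\lambda=a}^{K-1}\frac{t^\lambda}{f_\lambda}\Big)\quad(\text{no first term for }a=1).$$ Let $n=\sum_\alpha n_\alpha+K-1$ (so $f_K=n+1$), $M_0=\mathbb R^{K-1}$, $M^n=M_0\times M_1\times\cdots\times M_s$, $$C=\Big(\frac1{n+1}\prod_{a=1}^rc_a^2\prod_{\alpha=1}^s\frac{c_{r+\alpha}^{2(n_\alpha+1)}}{(n_\alpha+1)^{n_\alpha+1}(-L^{(\alpha)})^{n_\alpha+2}}\Big)^{\frac1{n+2}},$$ and let $x:M^n\to\mathbb R^{n+1}$, $$x(t,p_1,\dots,p_s)=(c_1e_1,\dots,c_re_r,c_{r+1}e_{r+1}x_1(p_1),\dots,c_Ke_Kx_s(p_s)),$$ be the Calabi composition of $r$ points and $s$ hyperbolic affine hyperspheres,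 on the side to which the position vector points. Let $g$ and $A$ be its affine metric and Fubini–Pick form, $g_\alpha:=(n_\alpha+1)(-L^{(\alpha)})\,C\,g^{(\alpha)}$ on $M_\alpha$, and for $\alpha,\beta,\gamma\in\{0,\dots,s\}$ let $A^\gamma_{\alpha\beta}:TM_\alpha\times TM_\beta\to TM_\gamma$ be the $TM_\gamma$-component of the restriction of $A$ to $TM_\alpha\times TM_\beta$. For $1\le\alpha\le s$ put $H_\alpha=\frac1{n_\alpha}\operatorname{tr}_{g_\alpha}A^0_{\alpha\alpha}$. \textbf{Claim.} $x$ is a hyperbolic affine hypersphere with affine center the origin and affine mean curvature $L_1=-\frac1{(n+1)C}$; if all $g^{(\alpha)}$ are positive definite, so is $g$. Moreover, with $q=r+s-1$: (1) $(M^n,g)=\mathbb R^q\times(M_1,g_1)\times\cdots\times(M_s,g_s)$, where the Euclidean factor $\mathbb R^q$ is $M_0$ with the flat metric induced by $g$; and $q+s\ge2$, so that $(M^n,g)$ is reducible, unless $r=2$, $s=0$. (2) $q>0$. (3) $q\ge s-1$, with equality if and only if $r=0$. (4) $A^\gamma_{\alpha\beta}\equiv0$ unless $(\alpha,\beta,\gamma)$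 is $(0,0,0)$ or one of $(\delta,\delta,0)$, $(\delta,0,\delta)$, $(0,\delta,\delta)$, $(\delta,\delta,\delta)$ with $1\le\delta\le s$. (5) For every $p=(p_0,\dots,p_s)\in M^n$, every $1\le\alpha\le s$ and all $X,Y,Z,W\in T_{p_\alpha}M_\alpha$, $$A^0_{\alpha\alpha}(R^{M_\alpha}(X,Y)Z,W)+A^0_{\alpha\alpha}(Z,R^{M_\alpha}(X,Y)W)=0,$$ where $R^{M_\alpha}$ is the curvature tensor of $g_\alpha$; and the holonomy algebra $\mathfrak h_\alpha$ of $(M_\alpha,g_\alpha)$ at $p_\alpha$ annihilates $A^0_{\alpha\alpha}$, that is $A^0_{\alpha\alpha}(TZ,W)+A^0_{\alpha\alpha}(Z,TW)=0$ for all $T\in\mathfrak h_\alpha$. (6) For $1\le\alpha\le s$ (the first term below being absent if $\tilde\alpha=1$), $$H_\alpha=-\frac{f_{\tilde\alpha-1}}{f_{\tilde\alpha}C}\frac{\partial}{\partial t^{\tilde\alpha-1}}+\frac1C\sum_{\beta=\alpha}^{s-1}\frac{n_{\beta+1}+1}{f_{\tilde\beta+1}}\frac{\partial}{\partial t^{\tilde\beta}},$$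 $$g(H_\alpha,H_\alpha)=\frac1C\Big(\frac1{n_\alpha+1}-\frac1{f_K}\Big)=\frac{n-n_\alpha}{n_\alpha+1}(-L_1),\qquad g(H_\alpha,H_\beta)=L_1\ \ (\alpha\ne\beta).$$ (7) $A^\alpha_{\alpha\alpha}$ equals the $TM_\alpha$-valued symmetric bilinear form defined by $A^{(\alpha)}$ and $g^{(\alpha)}$. -/

import Mathlib

open scoped Manifold ContDiff

noncomputable section

namespace Calabi

/-! ### Metrics in a coordinate domain

`E` is the model vector space of a manifold with a fixed basis `e`. A metric (of any signature) in
a coordinate domain of `E` is a map `G : E → E → E → ℝ`, where `G u v w` is the value at the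
point `u` on the tangent vectors `v`, `w`. -/

section Metric

variable {κ E V : Type*} [Fintype κ] [DecidableEq κ]
  [NormedAddCommGroup E] [NormedSpace ℝ E] [NormedAddCommGroup V] [NormedSpace ℝ V]

/-- The matrix `(g_ij)`. -/
def gram (e : Module.Basis κ ℝ E) (G : E → E → E → ℝ) (u : E) : Matrix κ κ ℝ :=
  Matrix.of fun i j => G u (e i) (e j)

/-- Raising an index: the vector `∑ g^{ij} φ(e_j) e_i`. -/
def sharp (e : Module.Basis κ ℝ E) (G : E → E → E → ℝ) (u : E) (φ : E → ℝ) : E :=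
  ∑ i, ∑ j, ((gram e G u)⁻¹ i j * φ (e j)) • e i

/-- The Christoffel symbols of the Levi-Civita connection, as the vector-valued map `Γ_u(v, w)`. -/
def christoffel (e : Module.Basis κ ℝ E) (G : E → E → E → ℝ) (u v w : E) : E :=
  sharp e G u fun z => (1 / 2 : ℝ) *
    (fderiv ℝ (fun y => G y w z) u v + fderiv ℝ (fun y => G y v z) u w
      - fderiv ℝ (fun y => G y v w) u z)

/-- The curvature tensor `R(v, w) z` of the Levi-Civita connection. -/
def curvature (e : Module.Basis κ ℝ E) (G : E → E → E → ℝ) (u v w z : E) : E :=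
  fderiv ℝ (fun y => christoffel e G y w z) u v - fderiv ℝ (fun y => christoffel e G y v z) u w
    + christoffel e G u v (christoffel e G u w z) - christoffel e G u w (christoffel e G u v z)

/-- The second derivative `∂_v ∂_w X`. -/
def second (X : E → V) (u v w : E) : V := fderiv ℝ (fun y => fderiv ℝ X y w) u v

/-- The Laplacian `∑ g^{ij} (∂_i ∂_j X - ∂_{Γ(e_i, e_j)} X)`. -/
def laplacian (e : Module.Basis κ ℝ E) (G : E → E → E → ℝ) (X : E → V) (u : E) : V :=
  ∑ i, ∑ j, (gram e G u)⁻¹ i j •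
    (second X u (e i) (e j) - fderiv ℝ X u (christoffel e G u (e i) (e j)))

end Metric

/-! ### Equiaffine invariants of a parametrized hypersurface

`X : E → V` is a local parametrization and `η : E → V` a transversal field along it, which is used
only through the side of the hypersurface to which it points: it fixes the sign of the affine
metric, as an orientation does. -/

/-- A basis of the parameter space and a unimodular basis of the ambient space, indexed by the
same set with one more element. -/
structure Frame (κ E V : Type*) [NormedAddCommGroup E] [NormedSpace ℝ E]
    [NormedAddCommGroup V] [NormedSpace ℝ V] where
  source : Module.Basis κ ℝ E
  target : Module.Basis (Option κ) ℝ V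

section Local

variable {κ E V : Type*} [Fintype κ] [DecidableEq κ]
  [NormedAddCommGroup E] [NormedSpace ℝ E] [NormedAddCommGroup V] [NormedSpace ℝ V]

/-- `det (∂_1 X, …, ∂_n X, y)`. -/
def coordDet (F : Frame κ E V) (X : E → V) (u : E) (y : V) : ℝ :=
  F.target.det fun o => o.elim y fun i => fderiv ℝ X u (F.source i)

/-- `h(v, w) = det (∂_1 X, …, ∂_n X, ∂_v ∂_w X)`. -/
def hForm (F : Frame κ E V) (X : E → V) (u v w : E) : ℝ := coordDet F X u (second X u v w)

/-- `H = |det (h_ij)|`. -/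
def hDisc (F : Frame κ E V) (X : E → V) (u : E) : ℝ := |(gram F.source (hForm F X) u).det|

/-- The affine (Berwald-Blaschke) metric `g = ± H^{-1/(n+2)} h`, the sign being `+` when
`∂_1 X, …, ∂_n X, η` is positively oriented. -/
def affMetric (F : Frame κ E V) (X η : E → V) (u v w : E) : ℝ :=
  Real.sign (coordDet F X u (η u)) * hDisc F X u ^ (-(1 / ((Fintype.card κ : ℝ) + 2)))
    * hForm F X u v w

/-- The affine normal `ξ = (1/n) Δ_g X`. -/
def affNormal (F : Frame κ E V) (X η : E → V) (u : E) : V :=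
  (1 / (Fintype.card κ : ℝ)) • laplacian F.source (affMetric F X η) X u

/-- The decomposition `y = dX(t) + c ξ` of an ambient vector, as the map `y ↦ (t, c)`. -/
def decomp (F : Frame κ E V) (X η : E → V) (u : E) : V →L[ℝ] E × ℝ :=
  ((fderiv ℝ X u).coprod (ContinuousLinearMap.toSpanSingleton ℝ (affNormal F X η u))).inverse

/-- The induced affine connection: `∇_v w` for the constant field `w`, i.e. the tangential part of
`∂_v ∂_w X` with respect to the affine normal. -/
def affConnection (F : Frame κ E V) (X η : E → V) (u v w : E) : E :=
  (decomp F X η u (second X u v w)).1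

/-- The affine shape operator `B`: `-dX(B v)` is the tangential part of `∂_v ξ`. -/
def shape (F : Frame κ E V) (X η : E → V) (u v : E) : E :=
  -(decomp F X η u (fderiv ℝ (affNormal F X η) u v)).1

/-- The Fubini-Pick form `A(v, w, z) = -(1/2) (∇_z g)(v, w)`. -/
def cubic (F : Frame κ E V) (X η : E → V) (u v w z : E) : ℝ :=
  -(1 / 2) * (fderiv ℝ (fun y => affMetric F X η y v w) u z
    - affMetric F X η u (affConnection F X η u z v) w
    - affMetric F X η u v (affConnection F X η u z w))

/-- The Fubini-Pick form as a vector-valued bilinear form: `g(A(v, w), z) = A(v, w, z)`. -/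
def cubicVec (F : Frame κ E V) (X η : E → V) (u v w : E) : E :=
  sharp F.source (affMetric F X η) u (cubic F X η u v w)

end Local

/-! ### Hypersurfaces defined on manifolds

The tangent space at `p` is identified with `E` by the preferred chart at `p`, as Mathlib does, and
the value of a tensor at `p` is computed in that chart. -/

section Manifold

variable {κ E V H M : Type*} [Fintype κ] [DecidableEq κ]
  [NormedAddCommGroup E] [NormedSpace ℝ E] [NormedAddCommGroup V] [NormedSpace ℝ V]
  [TopologicalSpace H] [TopologicalSpace M] [ChartedSpace H M]

/-- A map on `M` read in the preferred chart at `p`. -/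
def inChart (I : ModelWithCorners ℝ E H) (x : M → V) (p : M) : E → V :=
  fun u => x ((extChartAt I p).symm u)

/-- The affine metric near `p`, in the preferred chart at `p`. -/
def metricNear (F : Frame κ E V) (I : ModelWithCorners ℝ E H) (x η : M → V) (p : M) :
    E → E → E → ℝ :=
  affMetric F (inChart I x p) (inChart I η p)

/-- The affine metric at `p`. -/
def metricAt (F : Frame κ E V) (I : ModelWithCorners ℝ E H) (x η : M → V) (p : M)
    (v w : E) : ℝ :=
  metricNear F I x η p (extChartAt I p p) v w

/-- The affine normal at `p`. -/
def normalAt (F : Frame κ E V) (I : ModelWithCorners ℝ E H) (x η : M → V) (p : M) : V :=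
  affNormal F (inChart I x p) (inChart I η p) (extChartAt I p p)

/-- The affine shape operator at `p`. -/
def shapeAt (F : Frame κ E V) (I : ModelWithCorners ℝ E H) (x η : M → V) (p : M)
    (v : E) : E :=
  shape F (inChart I x p) (inChart I η p) (extChartAt I p p) v

/-- The vector-valued Fubini-Pick form at `p`. -/
def cubicAt (F : Frame κ E V) (I : ModelWithCorners ℝ E H) (x η : M → V) (p : M)
    (v w : E) : E :=
  cubicVec F (inChart I x p) (inChart I η p) (extChartAt I p p) v w

/-- `x : M → V` is a hyperbolic affine hypersphere with affine mean curvature `L` whose affine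
center is the origin: a smooth nondegenerate hypersurface, on the side `η` of which `B = L · id`
with a negative constant `L`, and all of whose affine normal lines pass through the origin. -/
structure IsHyperbolicAffineSphere (F : Frame κ E V) (I : ModelWithCorners ℝ E H)
    (x η : M → V) (L : ℝ) : Prop where
  smooth : ContMDiff I 𝓘(ℝ, V) ∞ x
  nondegenerate : ∀ p, hDisc F (inChart I x p) (extChartAt I p p) ≠ 0
  side_continuous : Continuous η
  side_transversal : ∀ p, coordDet F (inChart I x p) (extChartAt I p p) (η p) ≠ 0
  neg : L < 0
  shape_eq : ∀ p (v : E), shapeAt F I x η p v = L • v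
  center : ∀ p, ∃ t : ℝ, x p + t • normalAt F I x η p = 0

/-! ### Holonomy

A metric on `M` is given by its coefficients `G p` near each point `p` in the preferred chart
at `p`. -/

/-- The curvature tensor at `p`. -/
def curvatureAt (e : Module.Basis κ ℝ E) (I : ModelWithCorners ℝ E H) (G : M → E → E → E → ℝ)
    (p : M) (v w z : E) : E :=
  curvature e (G p) (extChartAt I p p) v w z

/-- The vector field `v` along the curve `γ`, with `v t` in the tangent space `E` at `γ t`, is
parallel: at each time `t₀` its covariant derivative, computed in the preferred chart at `γ t₀`,
vanishes. -/
def IsParallelAlong (e : Module.Basis κ ℝ E) (I : ModelWithCorners ℝ E H) [IsManifold I 1 M]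
    (G : M → E → E → E → ℝ) (γ : ℝ → M) (v : ℝ → E) : Prop :=
  ∀ t₀ : ℝ, HasDerivAt (fun t => tangentCoordChange I (γ t) (γ t₀) (γ t) (v t))
    (-christoffel e (G (γ t₀)) (extChartAt I (γ t₀) (γ t₀))
      (deriv (fun t => extChartAt I (γ t₀) (γ t)) t₀) (v t₀)) t₀

/-- `IsTransport e I G p q T`: the linear map `T : T_p M → T_q M` is the parallel transport along
some piecewise `C¹` curve from `p` to `q`. -/
inductive IsTransport (e : Module.Basis κ ℝ E) (I : ModelWithCorners ℝ E H) [IsManifold I 1 M]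
    (G : M → E → E → E → ℝ) (p : M) : M → (E →L[ℝ] E) → Prop
  | refl : IsTransport e I G p p (ContinuousLinearMap.id ℝ E)
  | step (γ : ℝ → M) (S T : E →L[ℝ] E) (hT : IsTransport e I G p (γ 0) T)
      (hγ : ContMDiff 𝓘(ℝ, ℝ) I 1 γ)
      (hS : ∀ a : E, ∃ v : ℝ → E,
        IsParallelAlong e I G γ v ∧ v 0 = a ∧ v 1 = S a) :
      IsTransport e I G p (γ 1) (S.comp T)

/-- The holonomy algebra at `p`: the Lie algebra of the holonomy group, the group of the parallel
transports along the piecewise `C¹` loops at `p`. -/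
def holonomyAlgebra (e : Module.Basis κ ℝ E) (I : ModelWithCorners ℝ E H) [IsManifold I 1 M]
    (G : M → E → E → E → ℝ) (p : M) : Set (E →L[ℝ] E) :=
  {T | ∀ t : ℝ, IsTransport e I G p p (NormedSpace.exp (t • T))}

end Manifold

/-! ### The Calabi composition of `r` points and `s` hyperspheres -/

/-- The standard bases for hypersurfaces of dimension `m` in `ℝ^(m+1)`. -/
def stdFrame (m : ℕ) : Frame (Fin m) (EuclideanSpace ℝ (Fin m)) (Fin (m + 1) → ℝ) where
  source := (EuclideanSpace.basisFun (Fin m) ℝ).toBasis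
  target := (Pi.basisFun ℝ (Fin (m + 1))).reindex finSuccEquivLast

variable (r : ℕ) {s : ℕ} (n : Fin s → ℕ)

/-- The tangent spaces of `ℝ^(r+s-1) × M_1 × ⋯ × M_s`. -/
abbrev CompTangent : Type := (Fin (r + s - 1) → ℝ) × (∀ α, EuclideanSpace ℝ (Fin (n α)))

/-- The model of the product manifold `ℝ^(r+s-1) × M_1 × ⋯ × M_s`. -/
abbrev compModel : ModelWithCorners ℝ (CompTangent r n)
    (ModelProd (Fin (r + s - 1) → ℝ) (ModelPi fun α => EuclideanSpace ℝ (Fin (n α)))) :=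
  (𝓘(ℝ, Fin (r + s - 1) → ℝ)).prod (ModelWithCorners.pi fun α => 𝓡 (n α))

/-- The coordinates of the ambient space `ℝ^r × ∏ ℝ^(n_α+1)` of dimension `n + 1`. -/
abbrev CompIndex : Type := Fin r ⊕ (Σ α, Fin (n α + 1))

/-- The coordinates of the product manifold. -/
abbrev CompCoord : Type := Fin (r + s - 1) ⊕ (Σ α, Fin (n α))

/-- An ordering of the ambient coordinates (its choice changes determinants by a sign only, and the
affine metric not at all). -/
def compEquiv (hK : 2 ≤ r + s) : CompIndex r n ≃ Option (CompCoord r n) :=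
  Fintype.equivOfCardEq (by
    simp [Finset.sum_add_distrib]
    omega)

/-- The standard bases of the parameter space and the ambient space of the composition. -/
def compFrame (hK : 2 ≤ r + s) :
    Frame (CompCoord r n) (CompTangent r n) (CompIndex r n → ℝ) where
  source := (Pi.basisFun ℝ (Fin (r + s - 1))).prod
    (Pi.basis fun α => (EuclideanSpace.basisFun (Fin (n α)) ℝ).toBasis)
  target := (Pi.basisFun ℝ (CompIndex r n)).reindex (compEquiv r n hK)

/-- The dimensions of all `r + s` factors, the points first. -/
def dims : Fin (r + s) → ℕ := Fin.append (fun _ : Fin r => 0) n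

/-- `f_k = ∑_{b ≤ k} (n_b + 1)`, the sum over the first `k` of the factors. -/
def f (k : ℕ) : ℕ := ∑ b : Fin (r + s), if (b : ℕ) < k then dims r n b + 1 else 0

/-- `e_a = exp (-t_{a-1}/(n_a+1) + t_a/f_a + ⋯ + t_{K-1}/f_{K-1})`. Here factors and coordinates are
counted from `0`, so that `t l` is `t_{l+1}` and the factor `a` is the one numbered `a + 1`. -/
def expFactor (t : Fin (r + s - 1) → ℝ) (a : Fin (r + s)) : ℝ :=
  Real.exp (∑ l : Fin (r + s - 1),
    if (l : ℕ) + 1 = a then -(t l / ((dims r n a : ℝ) + 1))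
    else if (a : ℕ) ≤ l then t l / (f r n (l + 1) : ℝ) else 0)

/-- The dimension `n = ∑ n_α + r + s - 1` of the composition. -/
def compDim : ℕ := ∑ α, n α + (r + s - 1)

/-- The constant `C`. -/
def compC (L : Fin s → ℝ) (c : Fin (r + s) → ℝ) : ℝ :=
  (1 / ((compDim r n : ℝ) + 1) * (∏ a : Fin r, c (Fin.castAdd s a) ^ 2) *
    ∏ α : Fin s, c (Fin.natAdd r α) ^ (2 * (n α + 1)) /
      (((n α : ℝ) + 1) ^ (n α + 1) * (-L α) ^ (n α + 2))) ^ (1 / ((compDim r n : ℝ) + 2))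

/-- The factors of the product manifold: `none` stands for `M_0 = ℝ^(r+s-1)`, `some α` for `M_α`;
`Block r n o` is the tangent space of the factor `o`. -/
@[reducible] def Block : Option (Fin s) → Type
  | none => Fin (r + s - 1) → ℝ
  | some α => EuclideanSpace ℝ (Fin (n α))

instance (o : Option (Fin s)) : AddCommGroup (Block r n o) :=
  match o with
  | none => inferInstanceAs (AddCommGroup (Fin (r + s - 1) → ℝ))
  | some α => inferInstanceAs (AddCommGroup (EuclideanSpace ℝ (Fin (n α))))

/-- The inclusion of the tangent space of a factor. -/
def incl : (o : Option (Fin s)) → Block r n o → CompTangent r n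
  | none => fun v => (v, 0)
  | some α => fun v => (0, Pi.single α v)

/-- The projection to the tangent space of a factor. -/
def proj : (o : Option (Fin s)) → CompTangent r n → Block r n o
  | none => fun v => v.1
  | some α => fun v => v.2 α

/-- The coordinate vector field `∂/∂t^k` on `ℝ^(r+s-1)`, where `t^1, …, t^(r+s-1)` are the
coordinates (zero when there is no coordinate `t^k`). -/
def dt (s : ℕ) (k : ℕ) : Fin (r + s - 1) → ℝ := fun l => if (l : ℕ) + 1 = k then 1 else 0

section Composition

variable {r n} {M : Fin s → Type*} [∀ α, TopologicalSpace (M α)]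
  [∀ α, ChartedSpace (EuclideanSpace ℝ (Fin (n α))) (M α)]

/-- The Calabi composition
`x(t, p_1, …, p_s) = (c_1 e_1, …, c_r e_r, c_{r+1} e_{r+1} x_1(p_1), …, c_K e_K x_s(p_s))`. -/
def composition (x : ∀ α, M α → Fin (n α + 1) → ℝ) (c : Fin (r + s) → ℝ) :
    (Fin (r + s - 1) → ℝ) × (∀ α, M α) → CompIndex r n → ℝ :=
  fun p => Sum.elim
    (fun a => c (Fin.castAdd s a) * expFactor r n p.1 (Fin.castAdd s a))
    (fun i => c (Fin.natAdd r i.1) * expFactor r n p.1 (Fin.natAdd r i.1) * x i.1 (p.2 i.1) i.2)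

/-- The affine metric of the composition, with the sign for which the position vector is on the
positive side. -/
def compMetric (hK : 2 ≤ r + s) (x : ∀ α, M α → Fin (n α + 1) → ℝ) (c : Fin (r + s) → ℝ)
    (p : (Fin (r + s - 1) → ℝ) × (∀ α, M α)) (v w : CompTangent r n) : ℝ :=
  metricAt (compFrame r n hK) (compModel r n) (composition x c) (composition x c) p v w

/-- The Fubini-Pick form of the composition, as a vector-valued form. -/
def compCubic (hK : 2 ≤ r + s) (x : ∀ α, M α → Fin (n α + 1) → ℝ) (c : Fin (r + s) → ℝ)
    (p : (Fin (r + s - 1) → ℝ) × (∀ α, M α)) (v w : CompTangent r n) : CompTangent r n :=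
  cubicAt (compFrame r n hK) (compModel r n) (composition x c) (composition x c) p v w

/-- `A^k_{ij} : TM_i × TM_j → TM_k`, the `TM_k`-component of the restriction of `A` to
`TM_i × TM_j`. -/
def cubicBlock (hK : 2 ≤ r + s) (x : ∀ α, M α → Fin (n α + 1) → ℝ) (c : Fin (r + s) → ℝ)
    (i j k : Option (Fin s)) (p : (Fin (r + s - 1) → ℝ) × (∀ α, M α))
    (v : Block r n i) (w : Block r n j) : Block r n k :=
  proj r n k (compCubic hK x c p (incl r n i v) (incl r n j w))

/-- The metric `g_α = (n_α + 1)(-L_α) C g^(α)` on `M_α`, a multiple of the affine metric `g^(α)` of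
`x_α`, near the point `p` in the preferred chart at `p`. -/
def factorMetricNear (x η : ∀ α, M α → Fin (n α + 1) → ℝ) (L : Fin s → ℝ)
    (c : Fin (r + s) → ℝ) (α : Fin s) (p : M α)
    (u v w : EuclideanSpace ℝ (Fin (n α))) : ℝ :=
  ((n α : ℝ) + 1) * (-L α) * compC r n L c
    * metricNear (stdFrame (n α)) (𝓡 (n α)) (x α) (η α) p u v w

/-- The metric `g_α` at the point `p` of `M_α`. -/
def factorMetric (x η : ∀ α, M α → Fin (n α + 1) → ℝ) (L : Fin s → ℝ)
    (c : Fin (r + s) → ℝ) (α : Fin s) (p : M α) (v w : EuclideanSpace ℝ (Fin (n α))) : ℝ :=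
  factorMetricNear x η L c α p (extChartAt (𝓡 (n α)) p p) v w

/-- `H_α = (1/n_α) tr_{g_α} A^0_{αα}`. -/
def traceVec (hK : 2 ≤ r + s) (x η : ∀ α, M α → Fin (n α + 1) → ℝ) (L : Fin s → ℝ)
    (c : Fin (r + s) → ℝ) (α : Fin s) (p : (Fin (r + s - 1) → ℝ) × (∀ α, M α)) :
    Fin (r + s - 1) → ℝ :=
  (1 / (n α : ℝ)) • ∑ i, ∑ j,
    (gram (stdFrame (n α)).source (factorMetricNear x η L c α (p.2 α))
      (extChartAt (𝓡 (n α)) (p.2 α) (p.2 α)))⁻¹ i j •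
    (cubicBlock hK x c (some α) (some α) none p
      ((stdFrame (n α)).source i) ((stdFrame (n α)).source j) : Fin (r + s - 1) → ℝ)

end Composition

end Calabi

end

open scoped Topology
open Filter

set_option linter.unusedSectionVars false

noncomputable section

/-! Each factor is the exponential of a linear functional, `e_a = exp(ℓ_a(t))`. Put `w_a = d_a + 1`.
The coefficient vectors of the coordinates in `(ℓ_a)_a` are Helmert contrasts: together with `(1, …,
1)` they form an orthogonal basis of `ℝ^K` for the inner product `∑ w_a p_a q_a`. Hence every `W` in
`ℝ^K` is of the form `ℓ_a(ζ)` plus its weighted mean (`ell_zeta`).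

The second derivatives of `x` can be written with the Gauss formula of the hyperspheres, whose
affine normals are `-L_α x_α`. Each slot then carries tangential terms and a multiple `W_a` of the
same slot of `x`. The splitting of `W` moves everything but its mean into the tangent space, so `∂_v
∂_w x = dx(S(v, w)) + (Q(v, w)/(n+1)) x` (`gauss_composition`). Here `Q` is `compForm`, the
orthogonal sum of `∑ w_a ℓ_a ℓ_a` and of multiples of the `g^(α)`. So `h = (D/(n+1)) Q` with `D =
det(∂x, x)`. Factoring this determinant into the contrasts and the data of the factors gives `D² =
(n+1)² C^(n+2) |det Q|` (`sq_coordDet_composition`), and this is what fixes `C`. It follows that `g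
= C Q` and that the signed affine volume is `D/((n+1)C)`.

The affine normal is found from `NondegNear.affNormal_eq`: for a transversal field `y` normalized by
the affine volume, it is `y` minus a tangential correction determined by the transversal part of
`dy`. This rests on the symmetry of third derivatives, traced with `g`. For `y = x/((n+1)C)` there
is no correction, so the composition is a hypersphere (`NondegNear.sphereNear`). The same formula
shows that the affine normal is independent of parameters, which is what turns the definition on
manifolds into a Gauss formula in one chart (`IsHyperbolicAffineSphere.normalAt_eq`).

The induced connection is `compTensor` built on the connections of the factors. Paired with `Q`, it
is totally symmetric apart from the terms of the factors, so `-½ ∇g` has the same shape with the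
Fubini–Pick forms of the factors (`cubicVec_composition`). All blocks are read off from this. In
particular `A^0_αα = g_α ⊗ H_α`, so the invariance under curvature and holonomy is the skew-symmetry
of these operators for `g_α`. -/

namespace Calabi

/-! ### Metrics in a coordinate domain: raising indices, Levi-Civita connection, skewness of
curvature. -/

section MetricCalculus

variable {κ E : Type*} [Fintype κ] [DecidableEq κ] [NormedAddCommGroup E] [NormedSpace ℝ E]

/-- A symmetric bilinear form, as a property of an unbundled map. -/
structure SymmBilin (b : E → E → ℝ) : Prop where
  add_left : ∀ v v' w, b (v + v') w = b v w + b v' w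
  smul_left : ∀ (a : ℝ) v w, b (a • v) w = a * b v w
  symm : ∀ v w, b v w = b w v

namespace SymmBilin

variable {b : E → E → ℝ} (h : SymmBilin b)
include h

theorem add_right (v w w' : E) : b v (w + w') = b v w + b v w' := by
  rw [h.symm, h.add_left, h.symm w, h.symm w']

theorem smul_right (a : ℝ) (v w : E) : b v (a • w) = a * b v w := by
  rw [h.symm, h.smul_left, h.symm]

theorem isLinearMap_right (v : E) : IsLinearMap ℝ (b v) :=
  ⟨h.add_right v, fun a => h.smul_right a v⟩

theorem isLinearMap_left (w : E) : IsLinearMap ℝ (fun v => b v w) :=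
  ⟨fun v v' => h.add_left v v' w, fun a v => h.smul_left a v w⟩

theorem sum_left {ι : Type*} (s : Finset ι) (f : ι → E) (w : E) :
    b (∑ i ∈ s, f i) w = ∑ i ∈ s, b (f i) w :=
  map_sum ((h.isLinearMap_left w).mk' _) f s

theorem sub_left (v v' w : E) : b (v - v') w = b v w - b v' w :=
  map_sub ((h.isLinearMap_left w).mk' _) v v'

theorem sub_right (v w w' : E) : b v (w - w') = b v w - b v w' :=
  map_sub ((h.isLinearMap_right v).mk' _) w w'

theorem zero_left (w : E) : b 0 w = 0 := map_zero ((h.isLinearMap_left w).mk' _)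

theorem zero_right (v : E) : b v 0 = 0 := map_zero ((h.isLinearMap_right v).mk' _)

theorem const_mul (c : ℝ) : SymmBilin fun v w => c * b v w :=
  ⟨fun v v' w => by rw [h.add_left, mul_add], fun a v w => by rw [h.smul_left]; ring,
    fun v w => by rw [h.symm]⟩

end SymmBilin

/-- A linear functional is determined by a basis. -/
theorem isLinearMap_ext (e : Module.Basis κ ℝ E) {φ ψ : E → ℝ} (hφ : IsLinearMap ℝ φ)
    (hψ : IsLinearMap ℝ ψ) (h : ∀ i, φ (e i) = ψ (e i)) (z : E) : φ z = ψ z := by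
  have : hφ.mk' φ = hψ.mk' ψ := e.ext h
  exact congrArg (fun f : E →ₗ[ℝ] ℝ => f z) this

theorem isLinearMap_eq_sum (e : Module.Basis κ ℝ E) {φ : E → ℝ} (hφ : IsLinearMap ℝ φ) (z : E) :
    φ z = ∑ i, e.repr z i * φ (e i) := by
  have : (hφ.mk' φ) z = (hφ.mk' φ) (∑ i, e.repr z i • e i) := by rw [e.sum_repr]
  simpa only [map_sum, map_smul, IsLinearMap.mk'_apply, smul_eq_mul] using this

section Pointwise

variable (e : Module.Basis κ ℝ E) {G : E → E → E → ℝ} {u : E}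

theorem gram_isSymm (h : SymmBilin (G u)) : (gram e G u).transpose = gram e G u := by
  ext i j
  exact h.symm _ _

theorem sum_inv_gram_mul (hd : (gram e G u).det ≠ 0) (i k : κ) :
    ∑ j, (gram e G u)⁻¹ i j * G u (e j) (e k) = if i = k then 1 else 0 := by
  have := congrFun (congrFun (Matrix.nonsing_inv_mul (gram e G u) (Ne.isUnit hd)) i) k
  rw [Matrix.mul_apply] at this
  rw [Matrix.one_apply] at this
  exact this

theorem inv_gram_symm (h : SymmBilin (G u)) (i j : κ) :
    (gram e G u)⁻¹ i j = (gram e G u)⁻¹ j i := by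
  have : ((gram e G u)⁻¹).transpose = (gram e G u)⁻¹ := by
    rw [Matrix.transpose_nonsing_inv, gram_isSymm e h]
  exact congrFun (congrFun this j) i

theorem sharp_spec (h : SymmBilin (G u)) (hd : (gram e G u).det ≠ 0) {φ : E → ℝ}
    (hφ : IsLinearMap ℝ φ) (z : E) : G u (sharp e G u φ) z = φ z := by
  refine isLinearMap_ext e (h.isLinearMap_right _) hφ (fun k => ?_) z
  simp only [sharp, h.sum_left, h.smul_left]
  rw [Finset.sum_comm]
  have : ∀ j, ∑ i, (gram e G u)⁻¹ i j * φ (e j) * G u (e i) (e k)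
      = φ (e j) * if j = k then 1 else 0 := by
    intro j
    rw [← sum_inv_gram_mul e hd j k, Finset.mul_sum]
    exact Finset.sum_congr rfl fun i _ => by rw [inv_gram_symm e h i j]; ring
  simp [this]

theorem eq_zero_of_pairing (h : SymmBilin (G u)) (hd : (gram e G u).det ≠ 0) {x : E}
    (hx : ∀ z, G u x z = 0) : x = 0 := by
  have h1 : (gram e G u).mulVec (fun i => e.repr x i) = 0 := by
    ext k
    have := hx (e k)
    rw [isLinearMap_eq_sum e (h.isLinearMap_left (e k)) x] at this
    simp only [Matrix.mulVec, dotProduct, gram, Matrix.of_apply, Pi.zero_apply]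
    rw [← this]
    exact Finset.sum_congr rfl fun i _ => by rw [h.symm, mul_comm]
  have h2 := Matrix.eq_zero_of_mulVec_eq_zero hd h1
  apply e.repr.injective
  ext i
  simpa using congrFun h2 i

theorem eq_of_pairing (h : SymmBilin (G u)) (hd : (gram e G u).det ≠ 0) {x y : E}
    (hx : ∀ z, G u x z = G u y z) : x = y :=
  sub_eq_zero.1 <| eq_zero_of_pairing e h hd fun z => by rw [h.sub_left, hx, sub_self]

/-- A vector obtained by raising an index is recognized by its pairings, so the inverse Gram matrix
of the composition never has to be computed. -/
theorem eq_sharp (h : SymmBilin (G u)) (hd : (gram e G u).det ≠ 0) {φ : E → ℝ}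
    (hφ : IsLinearMap ℝ φ) {x : E} (hx : ∀ z, G u x z = φ z) : sharp e G u φ = x :=
  eq_of_pairing e h hd fun z => by rw [sharp_spec e h hd hφ, hx]

end Pointwise

/-! ### Smoothness -/

theorem contDiffAt_det {m : WithTop ℕ∞} {A : E → Matrix κ κ ℝ} {u : E}
    (hA : ∀ i j, ContDiffAt ℝ m (fun y => A y i j) u) : ContDiffAt ℝ m (fun y => (A y).det) u := by
  simp only [Matrix.det_apply']
  exact ContDiffAt.sum fun σ _ => contDiffAt_const.mul (contDiffAt_prod fun i _ => hA _ _)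

theorem contDiffAt_inv_entry {m : WithTop ℕ∞} {A : E → Matrix κ κ ℝ} {u : E}
    (hA : ∀ i j, ContDiffAt ℝ m (fun y => A y i j) u) (hd : (A u).det ≠ 0) (i j : κ) :
    ContDiffAt ℝ m (fun y => (A y)⁻¹ i j) u := by
  simp only [Matrix.inv_def, Ring.inverse_eq_inv', Matrix.smul_apply, smul_eq_mul,
    Matrix.adjugate_apply]
  refine ((contDiffAt_det hA).inv hd).mul (contDiffAt_det fun k l => ?_)
  simp only [Matrix.updateRow_apply]
  split_ifs
  · exact contDiffAt_const
  · exact hA k l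

theorem contDiffAt_fderiv_apply {V : Type*} [NormedAddCommGroup V] [NormedSpace ℝ V] {f : E → V}
    {u : E} (hf : ContDiffAt ℝ ∞ f u) (v : E) : ContDiffAt ℝ ∞ (fun y => fderiv ℝ f y v) u :=
  (hf.fderiv_right (m := ∞) (by simp)).clm_apply contDiffAt_const

/-- Near `u`, the map `G` is a smooth nondegenerate metric. -/
def IsMetricNear (e : Module.Basis κ ℝ E) (G : E → E → E → ℝ) (u : E) : Prop :=
  ∀ᶠ y in 𝓝 u, SymmBilin (G y) ∧ (gram e G y).det ≠ 0 ∧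
    ∀ v w, ContDiffAt ℝ ∞ (fun z => G z v w) y

namespace IsMetricNear

variable {e : Module.Basis κ ℝ E} {G : E → E → E → ℝ} {u : E} (h : IsMetricNear e G u)
include h

theorem symmBilin : SymmBilin (G u) := h.self_of_nhds.1

theorem det_ne : (gram e G u).det ≠ 0 := h.self_of_nhds.2.1

theorem contDiffAt (v w : E) : ContDiffAt ℝ ∞ (fun z => G z v w) u := h.self_of_nhds.2.2 v w

theorem differentiableAt (v w : E) : DifferentiableAt ℝ (fun z => G z v w) u :=
  (h.contDiffAt v w).differentiableAt (by simp)

theorem eventually : ∀ᶠ y in 𝓝 u, IsMetricNear e G y := h.eventually_nhds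

theorem const_mul {c : ℝ} (hc : c ≠ 0) : IsMetricNear e (fun y v w => c * G y v w) u := by
  filter_upwards [h] with y hy
  refine ⟨hy.1.const_mul c, ?_, fun v w => contDiffAt_const.mul (hy.2.2 v w)⟩
  have : gram e (fun y v w => c * G y v w) y = c • gram e G y := by
    ext i j
    simp [gram]
  rw [this, Matrix.det_smul]
  exact mul_ne_zero (pow_ne_zero _ hc) hy.2.1

/-- The derivative of `G (c s) (a s) (b s)`. -/
theorem hasFDerivAt_apply {S : Type*} [NormedAddCommGroup S] [NormedSpace ℝ S] {c a b : S → E}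
    {c' a' b' : S →L[ℝ] E} {s : S} (hu : c s = u) (hc : HasFDerivAt c c' s)
    (ha : HasFDerivAt a a' s) (hb : HasFDerivAt b b' s) :
    ∃ D : S →L[ℝ] ℝ, HasFDerivAt (fun t => G (c t) (a t) (b t)) D s ∧ ∀ x, D x =
      fderiv ℝ (fun y => G y (a s) (b s)) u (c' x) + G u (a' x) (b s) + G u (a s) (b' x) := by
  subst hu
  have : FiniteDimensional ℝ E := Module.Finite.of_basis e
  let ε : κ → E →L[ℝ] ℝ := fun i => LinearMap.toContinuousLinearMap (e.coord i)
  have hε : ∀ i v, e.repr v i = ε i v := fun i v => rfl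
  -- Bilinearity is available only for `y` near `u`; expansion in the basis reduces the claim to the
  -- product rule for scalar functions.
  have hexp : ∀ y, SymmBilin (G y) → ∀ v w,
      G y v w = ∑ i, ∑ j, ε i v * ε j w * G y (e i) (e j) := by
    intro y hy v w
    rw [isLinearMap_eq_sum e (hy.isLinearMap_left w) v]
    refine Finset.sum_congr rfl fun i _ => ?_
    rw [isLinearMap_eq_sum e (hy.isLinearMap_right (e i)) w, Finset.mul_sum]
    exact Finset.sum_congr rfl fun j _ => by rw [hε, hε]; ring
  have hterm : ∀ i j, HasFDerivAt (fun t => ε i (a t) * ε j (b t) * G (c t) (e i) (e j))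
      ((ε i (a s) * ε j (b s)) • ((fderiv ℝ (fun y => G y (e i) (e j)) (c s)).comp c') +
        G (c s) (e i) (e j) • (ε i (a s) • (ε j).comp b' + ε j (b s) • (ε i).comp a')) s :=
    fun i j => (((ε i).hasFDerivAt.comp s ha).mul ((ε j).hasFDerivAt.comp s hb)).mul
      ((h.differentiableAt (e i) (e j)).hasFDerivAt.comp s hc)
  refine ⟨_, (HasFDerivAt.fun_sum (u := Finset.univ) fun i _ => HasFDerivAt.fun_sum (u := Finset.univ) fun j _ =>
    hterm i j).congr_of_eventuallyEq ?_, fun x => ?_⟩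
  · filter_upwards [hc.continuousAt.eventually h] with t ht
    exact hexp _ ht.1 _ _
  · have h1 : fderiv ℝ (fun y => G y (a s) (b s)) (c s) (c' x) = ∑ i, ∑ j,
        ε i (a s) * ε j (b s) * fderiv ℝ (fun y => G y (e i) (e j)) (c s) (c' x) := by
      have h2 : HasFDerivAt (fun y => ∑ i, ∑ j, ε i (a s) * ε j (b s) * G y (e i) (e j))
          (∑ i, ∑ j, (ε i (a s) * ε j (b s)) • fderiv ℝ (fun y => G y (e i) (e j)) (c s)) (c s) :=
        HasFDerivAt.fun_sum fun i _ => HasFDerivAt.fun_sum fun j _ =>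
          (h.differentiableAt (e i) (e j)).hasFDerivAt.const_mul _
      have h3 : (fun y => G y (a s) (b s)) =ᶠ[𝓝 (c s)]
          fun y => ∑ i, ∑ j, ε i (a s) * ε j (b s) * G y (e i) (e j) := by
        filter_upwards [h] with y hy
        exact hexp _ hy.1 _ _
      rw [h3.fderiv_eq, h2.fderiv]
      simp [sum_apply]
    rw [h1, hexp _ h.symmBilin, hexp _ h.symmBilin, ← Finset.sum_add_distrib,
      ← Finset.sum_add_distrib, sum_apply]
    refine Finset.sum_congr rfl fun i _ => ?_
    rw [← Finset.sum_add_distrib, ← Finset.sum_add_distrib, sum_apply]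
    refine Finset.sum_congr rfl fun j _ => ?_
    simp
    ring

theorem isLinearMap_fderiv_right (v w : E) :
    IsLinearMap ℝ fun z => fderiv ℝ (fun y => G y w z) u v := by
  constructor
  · intro z z'
    have : (fun y => G y w (z + z')) =ᶠ[𝓝 u] fun y => G y w z + G y w z' := by
      filter_upwards [h] with y hy
      exact hy.1.add_right _ _ _
    rw [this.fderiv_eq, fderiv_fun_add (h.differentiableAt _ _) (h.differentiableAt _ _)]
    rfl
  · intro c z
    have : (fun y => G y w (c • z)) =ᶠ[𝓝 u] fun y => c * G y w z := by
      filter_upwards [h] with y hy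
      exact hy.1.smul_right _ _ _
    rw [this.fderiv_eq, fderiv_const_mul (h.differentiableAt _ _)]
    rfl

theorem fderiv_symm (v w : E) : fderiv ℝ (fun y => G y v w) u = fderiv ℝ (fun y => G y w v) u := by
  apply Filter.EventuallyEq.fderiv_eq
  filter_upwards [h] with y hy
  exact hy.1.symm _ _

/-- The Koszul formula. -/
theorem koszul (v w z : E) : G u (christoffel e G u v w) z = (1 / 2 : ℝ) *
    (fderiv ℝ (fun y => G y w z) u v + fderiv ℝ (fun y => G y v z) u w
      - fderiv ℝ (fun y => G y v w) u z) := by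
  refine sharp_spec e h.symmBilin h.det_ne (φ := fun z => (1 / 2 : ℝ) *
    (fderiv ℝ (fun y => G y w z) u v + fderiv ℝ (fun y => G y v z) u w
      - fderiv ℝ (fun y => G y v w) u z)) ⟨fun a b => ?_, fun c a => ?_⟩ z
  · simp only [(h.isLinearMap_fderiv_right v w).map_add, (h.isLinearMap_fderiv_right w v).map_add,
      map_add]
    ring
  · simp only [(h.isLinearMap_fderiv_right v w).map_smul,
      (h.isLinearMap_fderiv_right w v).map_smul, map_smul, smul_eq_mul]
    ring

/-- In the sum of the two Koszul formulas all derivatives except the one along `z` cancel in pairs.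
-/
theorem compatible (v w z : E) : fderiv ℝ (fun y => G y v w) u z
    = G u (christoffel e G u z v) w + G u v (christoffel e G u z w) := by
  rw [h.symmBilin.symm v, h.koszul, h.koszul, h.fderiv_symm w v]
  ring

theorem contDiffAt_gram (i j : κ) : ContDiffAt ℝ ∞ (fun y => gram e G y i j) u :=
  h.contDiffAt (e i) (e j)

theorem contDiffAt_christoffel (v w : E) :
    ContDiffAt ℝ ∞ (fun y => christoffel e G y v w) u := by
  refine ContDiffAt.sum fun i _ => ContDiffAt.sum fun j _ => ContDiffAt.smul ?_ contDiffAt_const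
  refine (contDiffAt_inv_entry h.contDiffAt_gram h.det_ne i j).mul (contDiffAt_const.mul ?_)
  exact ((contDiffAt_fderiv_apply (h.contDiffAt _ _) _).add
    (contDiffAt_fderiv_apply (h.contDiffAt _ _) _)).sub
    (contDiffAt_fderiv_apply (h.contDiffAt _ _) _)

/-- The second derivative of the metric coefficients through the connection. -/
theorem second_fderiv (v w y z : E) :
    fderiv ℝ (fun q => fderiv ℝ (fun q => G q y z) q w) u v
      = G u (fderiv ℝ (fun q => christoffel e G q w y) u v) z
        + G u y (fderiv ℝ (fun q => christoffel e G q w z) u v)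
        + G u (christoffel e G u v (christoffel e G u w y)) z
        + G u (christoffel e G u w y) (christoffel e G u v z)
        + G u (christoffel e G u v y) (christoffel e G u w z)
        + G u y (christoffel e G u v (christoffel e G u w z)) := by
  -- Metric compatibility holds at all points near `u`, so it may be differentiated once more.
  have h0 : (fun q => fderiv ℝ (fun q => G q y z) q w) =ᶠ[𝓝 u]
      fun q => G q (christoffel e G q w y) z + G q y (christoffel e G q w z) := by
    filter_upwards [h.eventually] with q hq
    exact hq.compatible y z w
  have hΓ : ∀ a b, HasFDerivAt (fun q => christoffel e G q a b)
      (fderiv ℝ (fun q => christoffel e G q a b) u) u := fun a b =>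
    ((h.contDiffAt_christoffel a b).differentiableAt (by simp)).hasFDerivAt
  obtain ⟨D₁, hD₁, hD₁'⟩ := h.hasFDerivAt_apply rfl (hasFDerivAt_id u) (hΓ w y)
    (hasFDerivAt_const z u)
  obtain ⟨D₂, hD₂, hD₂'⟩ := h.hasFDerivAt_apply rfl (hasFDerivAt_id u)
    (hasFDerivAt_const y u) (hΓ w z)
  have h1 : fderiv ℝ (fun q => G q (christoffel e G q w y) z + G q y (christoffel e G q w z)) u
      = D₁ + D₂ := (hD₁.add hD₂).fderiv
  rw [h0.fderiv_eq, h1, add_apply, hD₁', hD₂']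
  simp only [ContinuousLinearMap.id_apply, zero_apply, h.compatible,
    h.symmBilin.zero_left, h.symmBilin.zero_right]
  ring

/-- The curvature operators are skew-symmetric. -/
theorem curvature_skew (v w y z : E) :
    G u (curvature e G u v w y) z + G u y (curvature e G u v w z) = 0 := by
  -- Mixed second derivatives of `G q y z` commute. The products of two Christoffel terms in
  -- `second_fderiv` are symmetric in `v, w` and drop out; what remains is the two curvature terms.
  have hs : fderiv ℝ (fun q => fderiv ℝ (fun q => G q y z) q w) u v
      = fderiv ℝ (fun q => fderiv ℝ (fun q => G q y z) q v) u w := by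
    have hc := h.contDiffAt y z
    have hd : DifferentiableAt ℝ (fderiv ℝ fun q => G q y z) u :=
      (hc.fderiv_right (m := ∞) (by simp)).differentiableAt (by simp)
    have hsym : IsSymmSndFDerivAt ℝ (fun q => G q y z) u :=
      hc.isSymmSndFDerivAt (by simpa using (ENat.LEInfty.out : (2 : WithTop ℕ∞) ≤ ∞))
    have key : ∀ a b, fderiv ℝ (fun q => fderiv ℝ (fun q => G q y z) q a) u b
        = fderiv ℝ (fderiv ℝ fun q => G q y z) u b a := by
      intro a b
      rw [(hd.hasFDerivAt.clm_apply (hasFDerivAt_const a u)).fderiv]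
      simp
    rw [key, key]
    exact hsym.eq v w
  rw [h.second_fderiv, h.second_fderiv] at hs
  have hb := h.symmBilin
  simp only [curvature, hb.sub_left, hb.add_left, hb.sub_right, hb.add_right]
  linarith

end IsMetricNear

end MetricCalculus

/-! ### Derivatives of determinants. -/

section Determinants

variable {ι E V : Type*} [Fintype ι] [DecidableEq ι]
  [NormedAddCommGroup E] [NormedSpace ℝ E] [NormedAddCommGroup V] [NormedSpace ℝ V]

theorem continuous_basis_det (b : Module.Basis ι ℝ V) : Continuous fun m : ι → V => b.det m := by
  have : FiniteDimensional ℝ V := Module.Finite.of_basis b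
  simp only [Module.Basis.det_apply]
  refine Continuous.matrix_det (continuous_matrix fun i j => ?_)
  exact (LinearMap.continuous_of_finiteDimensional (b.coord i)).comp (continuous_apply j)

/-- The derivative of a determinant of vector fields. -/
theorem hasFDerivAt_basis_det (b : Module.Basis ι ℝ V) {v : ι → E → V} {v' : ι → E →L[ℝ] V}
    {u : E} (hv : ∀ i, HasFDerivAt (v i) (v' i) u) :
    ∃ D : E →L[ℝ] ℝ, HasFDerivAt (fun y => b.det fun i => v i y) D u ∧
      ∀ c, D c = ∑ i, b.det (Function.update (fun j => v j u) i (v' i c)) := by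
  let M : ContinuousMultilinearMap ℝ (fun _ : ι => V) ℝ :=
    { b.det.toMultilinearMap with cont := continuous_basis_det b }
  refine ⟨_, HasFDerivAt.multilinear_comp M hv, fun c => ?_⟩
  simp only [sum_apply, ContinuousLinearMap.comp_apply]
  rfl

theorem contDiffAt_basis_det (b : Module.Basis ι ℝ V) {m : WithTop ℕ∞} {v : ι → E → V} {u : E}
    (hv : ∀ i, ContDiffAt ℝ m (v i) u) : ContDiffAt ℝ m (fun y => b.det fun i => v i y) u := by
  have : FiniteDimensional ℝ V := Module.Finite.of_basis b
  simp only [Module.Basis.det_apply]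
  refine contDiffAt_det fun i j => ?_
  exact (LinearMap.toContinuousLinearMap (b.coord i)).contDiff.contDiffAt.comp u (hv j)

/-- Jacobi's formula. -/
theorem hasFDerivAt_matrix_det {A : E → Matrix ι ι ℝ} {A' : ι → ι → E →L[ℝ] ℝ} {u : E}
    (hA : ∀ i j, HasFDerivAt (fun y => A y i j) (A' i j) u) (hd : (A u).det ≠ 0) :
    ∃ D : E →L[ℝ] ℝ, HasFDerivAt (fun y => (A y).det) D u ∧
      ∀ c, D c = (A u).det * ∑ i, ∑ j, (A u)⁻¹ i j * A' j i c := by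
  have hcol : ∀ j, HasFDerivAt (fun y i => A y i j) (ContinuousLinearMap.pi fun i => A' i j) u :=
    fun j => hasFDerivAt_pi.2 fun i => hA i j
  obtain ⟨D, hD, hD'⟩ := hasFDerivAt_basis_det (Pi.basisFun ℝ ι) hcol
  have key : ∀ m : ι → ι → ℝ, (Pi.basisFun ℝ ι).det m = (Matrix.of fun i j => m j i).det := by
    intro m
    rw [Pi.basisFun_det, ← Matrix.det_transpose]
    rfl
  refine ⟨D, ?_, fun c => ?_⟩
  · refine hD.congr_of_eventuallyEq (Eventually.of_forall fun y => ?_)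
    simp only [key]
    rfl
  · rw [hD', Finset.mul_sum]
    refine Finset.sum_congr rfl fun i _ => ?_
    have h1 : (Pi.basisFun ℝ ι).det (Function.update (fun j i => A u i j) i fun k => A' k i c)
        = ((A u).updateCol i fun k => A' k i c).det := by
      rw [key]
      congr 1
      ext a b
      simp only [Matrix.of_apply, Matrix.updateCol_apply, Function.update_apply]
      split_ifs <;> rfl
    have h2 : (ContinuousLinearMap.pi fun k => A' k i) c = fun k => A' k i c := rfl
    -- By Cramer's rule the determinant with one column replaced is an entry of the adjugate applied
    -- to that column, and the adjugate is `det(A) A⁻¹`.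
    rw [h2, h1, ← Matrix.cramer_apply, Matrix.cramer_eq_adjugate_mulVec]
    simp only [Matrix.mulVec, dotProduct, Finset.mul_sum]
    refine Finset.sum_congr rfl fun j _ => ?_
    rw [Matrix.inv_def, Ring.inverse_eq_inv', Matrix.smul_apply, smul_eq_mul]
    field_simp

end Determinants

/-! ### Determinants along a hypersurface and the splitting by a transversal vector. -/

section LocalHypersurface

variable {κ E V : Type*} [Fintype κ] [DecidableEq κ]
  [NormedAddCommGroup E] [NormedSpace ℝ E] [NormedAddCommGroup V] [NormedSpace ℝ V]

theorem second_eq {X : E → V} {u : E} (hX : ContDiffAt ℝ ∞ X u) (v w : E) :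
    second X u v w = fderiv ℝ (fderiv ℝ X) u v w := by
  have hd : DifferentiableAt ℝ (fderiv ℝ X) u :=
    (hX.fderiv_right (m := ∞) (by simp)).differentiableAt (by simp)
  rw [second, (hd.hasFDerivAt.clm_apply (hasFDerivAt_const w u)).fderiv]
  simp

theorem second_symm {X : E → V} {u : E} (hX : ContDiffAt ℝ ∞ X u) (v w : E) :
    second X u v w = second X u w v := by
  have hsym : IsSymmSndFDerivAt ℝ X u :=
    hX.isSymmSndFDerivAt (by simpa using (ENat.LEInfty.out : (2 : WithTop ℕ∞) ≤ ∞))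
  rw [second_eq hX, second_eq hX, hsym.eq]

theorem contDiffAt_second {X : E → V} {u : E} (hX : ContDiffAt ℝ ∞ X u) (v w : E) :
    ContDiffAt ℝ ∞ (fun y => second X y v w) u :=
  contDiffAt_fderiv_apply (contDiffAt_fderiv_apply hX w) v

section CoordDet

variable (F : Frame κ E V) (X : E → V) (u : E)

/-- The columns of the determinant `coordDet`. -/
def coordCols (y : V) : Option κ → V := fun o => o.elim y fun i => fderiv ℝ X u (F.source i)

theorem coordDet_eq (y : V) : coordDet F X u y = F.target.det (coordCols F X u y) := rfl

theorem update_coordCols_none (y z : V) :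
    Function.update (coordCols F X u y) none z = coordCols F X u z := by
  ext1 o
  cases o <;> simp [coordCols]

theorem isLinearMap_coordDet : IsLinearMap ℝ (coordDet F X u) := by
  have h : ∀ z, coordDet F X u z = F.target.det.toMultilinearMap.toLinearMap
      (coordCols F X u 0) none z := by
    intro z
    rw [MultilinearMap.toLinearMap_apply, update_coordCols_none]
    rfl
  exact ⟨fun a b => by rw [h, h, h, map_add], fun a b => by rw [h, h, map_smul]⟩

/-- Each basis tangent vector repeats a column, so `coordDet` sees only the transversal component.
-/
theorem coordDet_fderiv (v : E) : coordDet F X u (fderiv ℝ X u v) = 0 := by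
  have hl : IsLinearMap ℝ fun v => coordDet F X u (fderiv ℝ X u v) :=
    ⟨fun a b => by rw [map_add, (isLinearMap_coordDet F X u).map_add],
      fun a b => by rw [map_smul, (isLinearMap_coordDet F X u).map_smul]⟩
  refine isLinearMap_ext F.source hl (ψ := fun _ => 0) ⟨by simp, by simp⟩ (fun i => ?_) v
  exact F.target.det.map_eq_zero_of_eq _ (i := none) (j := some i) rfl (by simp)

theorem coordDet_add_smul (v : E) (t : ℝ) (y : V) :
    coordDet F X u (fderiv ℝ X u v + t • y) = t * coordDet F X u y := by
  rw [(isLinearMap_coordDet F X u).map_add, coordDet_fderiv, zero_add,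
    (isLinearMap_coordDet F X u).map_smul, smul_eq_mul]

theorem det_update_tangent (w : V) (i : κ) (v : E) :
    F.target.det (Function.update (coordCols F X u w) (some i) (fderiv ℝ X u v))
      = F.source.repr v i * coordDet F X u w := by
  let f := F.target.det.toMultilinearMap.toLinearMap (coordCols F X u w) (some i)
  have hf : ∀ z, F.target.det (Function.update (coordCols F X u w) (some i) z) = f z :=
    fun z => rfl
  have h1 : IsLinearMap ℝ fun v => f (fderiv ℝ X u v) :=
    ⟨fun a b => by rw [map_add, map_add], fun a b => by rw [map_smul, map_smul]⟩
  have h2 : IsLinearMap ℝ fun v => F.source.repr v i * coordDet F X u w :=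
    ⟨fun a b => by simp [add_mul], fun a b => by simp [mul_assoc]⟩
  rw [hf]
  refine isLinearMap_ext F.source h1 h2 (fun j => ?_) v
  rw [← hf]
  by_cases hij : j = i
  · subst hij
    have : Function.update (coordCols F X u w) (some j) (fderiv ℝ X u (F.source j))
        = coordCols F X u w := Function.update_eq_self (some j) (coordCols F X u w)
    rw [this]
    simp [coordDet_eq]
  · rw [F.target.det.map_eq_zero_of_eq _ (i := some i) (j := some j)]
    · simp [hij]
    · have : some j ≠ some i := by simpa using hij
      rw [Function.update_self, Function.update_of_ne this]
      rfl
    · simpa using Ne.symm hij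

/-- The new column kills the `y` part of the last one; of the rest only the `i`-th component of `a`
survives, and exchanging two columns gives the sign. With `det_update_tangent` this evaluates the
terms of a differentiated determinant in which a coordinate column is differentiated. -/
theorem det_update_transversal (y : V) (i : κ) (a : E) (t : ℝ) :
    F.target.det (Function.update (coordCols F X u (fderiv ℝ X u a + t • y)) (some i) y)
      = -(F.source.repr a i * coordDet F X u y) := by
  let f := F.target.det.toMultilinearMap.toLinearMap
    (Function.update (coordCols F X u 0) (some i) y) none
  have hf : ∀ z, F.target.det (Function.update (coordCols F X u z) (some i) y) = f z := by
    intro z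
    rw [MultilinearMap.toLinearMap_apply, Function.update_comm (by simp),
      update_coordCols_none]
    rfl
  have hy : f y = 0 := by
    rw [← hf]
    refine F.target.det.map_eq_zero_of_eq _ (i := some i) (j := none) ?_ (by simp)
    rw [Function.update_self, Function.update_of_ne (by simp)]
    rfl
  have h1 : IsLinearMap ℝ fun v => f (fderiv ℝ X u v) :=
    ⟨fun a b => by rw [map_add, map_add], fun a b => by rw [map_smul, map_smul]⟩
  have h2 : IsLinearMap ℝ fun v => -(F.source.repr v i * coordDet F X u y) :=
    ⟨fun a b => by simp [add_mul]; ring, fun a b => by simp [mul_assoc]⟩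
  rw [hf, map_add, map_smul, hy, smul_zero, add_zero]
  refine isLinearMap_ext F.source h1 h2 (fun j => ?_) a
  rw [← hf]
  by_cases hij : j = i
  · subst hij
    have := F.target.det.map_swap (coordCols F X u y) (i := none) (j := some j) (by simp)
    rw [coordDet_eq, Module.Basis.repr_self, Finsupp.single_eq_same, one_mul, ← this]
    congr 1
    ext1 o
    rcases o with _ | k
    · simp [coordCols]
    · by_cases hk : k = j
      · subst hk
        simp [coordCols]
      · have h3 : some k ≠ some j := by simpa using hk
        rw [Function.update_of_ne h3, Function.comp_apply,
          Equiv.swap_apply_of_ne_of_ne (by simp) h3]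
        rfl
  · rw [F.target.det.map_eq_zero_of_eq _ (i := none) (j := some j)]
    · simp [hij]
    · have : some j ≠ some i := by simpa using hij
      rw [Function.update_of_ne (by simp), Function.update_of_ne this]
      rfl
    · simp

variable {F X u}

theorem transversal_injective {y : V} (hy : coordDet F X u y ≠ 0) {a : E} {t : ℝ}
    (h : fderiv ℝ X u a + t • y = 0) : a = 0 ∧ t = 0 := by
  have ht : t = 0 := by
    have := coordDet_add_smul F X u a t y
    rw [h, (isLinearMap_coordDet F X u).map_zero] at this
    exact (mul_eq_zero.1 this.symm).resolve_right hy
  refine ⟨F.source.repr.injective ?_, ht⟩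
  ext i
  have h2 : fderiv ℝ X u a = 0 := by simpa [ht] using h
  have := det_update_tangent F X u y i a
  rw [h2, AlternatingMap.map_update_zero] at this
  simpa using (mul_eq_zero.1 this.symm).resolve_right hy

theorem exists_decomposition {y : V} (hy : coordDet F X u y ≠ 0) (z : V) :
    ∃ a, z = fderiv ℝ X u a + (coordDet F X u z / coordDet F X u y) • y := by
  have hu : IsUnit (F.target.det (coordCols F X u y)) := Ne.isUnit hy
  have hz : z ∈ Submodule.span ℝ (Set.range (coordCols F X u y)) := by
    rw [(F.target.is_basis_iff_det.2 hu).2]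
    trivial
  obtain ⟨c, hc⟩ := (Submodule.mem_span_range_iff_exists_fun ℝ).1 hz
  rw [Fintype.sum_option] at hc
  have hc' : z = fderiv ℝ X u (∑ i, c (some i) • F.source i) + c none • y := by
    rw [← hc, map_sum, add_comm]
    simp [coordCols]
  refine ⟨∑ i, c (some i) • F.source i, ?_⟩
  have : coordDet F X u z / coordDet F X u y = c none := by
    rw [div_eq_iff hy]
    conv_lhs => rw [hc']
    rw [coordDet_add_smul]
  rw [this]
  exact hc'

theorem decomposition_unique {y : V} (hy : coordDet F X u y ≠ 0) {a b : E} {s t : ℝ}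
    (h : fderiv ℝ X u a + s • y = fderiv ℝ X u b + t • y) : a = b ∧ s = t := by
  have := transversal_injective hy (a := a - b) (t := s - t) (by
    rw [map_sub, sub_smul, ← sub_eq_zero.2 h]
    abel)
  exact ⟨sub_eq_zero.1 this.1, sub_eq_zero.1 this.2⟩

/-- `ContinuousLinearMap.inverse` has the default value zero on maps that are not invertible; the
bijectivity proved here is what gives `decomp` its meaning. -/
theorem inverse_coprod_apply {y : V} (hy : coordDet F X u y ≠ 0) (a : E) (t : ℝ) :
    ((fderiv ℝ X u).coprod (ContinuousLinearMap.toSpanSingleton ℝ y)).inverse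
      (fderiv ℝ X u a + t • y) = (a, t) := by
  have : FiniteDimensional ℝ E := Module.Finite.of_basis F.source
  have : FiniteDimensional ℝ V := Module.Finite.of_basis F.target
  set T := (fderiv ℝ X u).coprod (ContinuousLinearMap.toSpanSingleton ℝ y) with hT
  have hTa : ∀ p, T p = fderiv ℝ X u p.1 + p.2 • y := fun p => by simp [hT]
  have hbij : Function.Bijective (T : E × ℝ →ₗ[ℝ] V) := by
    refine ⟨fun p q hpq => ?_, fun z => ?_⟩
    · have h1 : T p = T q := hpq
      rw [hTa, hTa] at h1
      exact Prod.ext (decomposition_unique hy h1).1 (decomposition_unique hy h1).2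
    · obtain ⟨b, hb⟩ := exists_decomposition hy z
      exact ⟨(b, _), (hTa _).trans hb.symm⟩
  let e : (E × ℝ) ≃L[ℝ] V := (LinearEquiv.ofBijective _ hbij).toContinuousLinearEquiv
  have he : T = (e : E × ℝ →L[ℝ] V) := by
    ext p <;> rfl
  rw [he, ContinuousLinearMap.inverse_equiv]
  have : fderiv ℝ X u a + t • y = e (a, t) := (hTa (a, t)).symm
  rw [this]
  exact e.symm_apply_apply _

end CoordDet

/-- The derivative of `coordDet F X y (w y)`. -/
theorem fderiv_coordDet {F : Frame κ E V} {X w : E → V} {u : E} (hX : ContDiffAt ℝ ∞ X u)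
    (hw : DifferentiableAt ℝ w u) (c : E) :
    fderiv ℝ (fun y => coordDet F X y (w y)) u c = coordDet F X u (fderiv ℝ w u c) +
      ∑ i, F.target.det (Function.update (coordCols F X u (w u)) (some i)
        (second X u c (F.source i))) := by
  have hv : ∀ o : Option κ, HasFDerivAt (fun y => coordCols F X y (w y) o)
      (o.elim (fderiv ℝ w u) fun i => fderiv ℝ (fun y => fderiv ℝ X y (F.source i)) u) u := by
    rintro (_ | i)
    · exact hw.hasFDerivAt
    · exact ((contDiffAt_fderiv_apply hX _).differentiableAt (by simp)).hasFDerivAt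
  obtain ⟨D, hD, hD'⟩ := hasFDerivAt_basis_det F.target hv
  have h1 : (fun y => coordDet F X y (w y)) = fun y => F.target.det fun o => coordCols F X y (w y) o :=
    rfl
  rw [h1, hD.fderiv, hD', Fintype.sum_option]
  congr 1
  simp only [Option.elim]
  rw [update_coordCols_none, coordDet_eq]

theorem contDiffAt_coordDet {F : Frame κ E V} {X w : E → V} {u : E} (hX : ContDiffAt ℝ ∞ X u)
    (hw : ContDiffAt ℝ ∞ w u) : ContDiffAt ℝ ∞ (fun y => coordDet F X y (w y)) u := by
  refine contDiffAt_basis_det F.target fun o => ?_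
  rcases o with _ | i
  · exact hw
  · exact contDiffAt_fderiv_apply hX _

end LocalHypersurface

/-! ### The affine metric, its volume, and a formula for the affine normal. -/

section Nondegenerate

variable {κ E V : Type*} [Fintype κ] [DecidableEq κ]
  [NormedAddCommGroup E] [NormedSpace ℝ E] [NormedAddCommGroup V] [NormedSpace ℝ V]

/-- Near `u`, the map `X` is a smooth nondegenerate hypersurface, and `σ = ± 1` is the sign of the
side `η`. -/
def NondegNear (F : Frame κ E V) (X η : E → V) (σ : ℝ) (u : E) : Prop :=
  σ * σ = 1 ∧ ∀ᶠ y in 𝓝 u, ContDiffAt ℝ ∞ X y ∧ hDisc F X y ≠ 0 ∧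
    Real.sign (coordDet F X y (η y)) = σ

/-- The signed affine volume density `± H^{1/(n+2)}`. -/
def affVol (F : Frame κ E V) (X : E → V) (σ : ℝ) (y : E) : ℝ :=
  σ * hDisc F X y ^ (1 / ((Fintype.card κ : ℝ) + 2))

theorem hDisc_nonneg (F : Frame κ E V) (X : E → V) (y : E) : 0 ≤ hDisc F X y := abs_nonneg _

theorem symmBilin_hForm {F : Frame κ E V} {X : E → V} {u : E} (hX : ContDiffAt ℝ ∞ X u) :
    SymmBilin (hForm F X u) := by
  have hl := isLinearMap_coordDet F X u
  refine ⟨fun a b c => ?_, fun a b c => ?_, fun a b => ?_⟩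
  · rw [hForm, second_eq hX, map_add, add_apply, hl.map_add, ← second_eq hX, ← second_eq hX]
    rfl
  · rw [hForm, second_eq hX, map_smul, smul_apply, hl.map_smul, ← second_eq hX]
    rfl
  · rw [hForm, hForm, second_symm hX]

variable {F : Frame κ E V} {X η : E → V} {σ : ℝ} {u : E}

namespace NondegNear

variable (h : NondegNear F X η σ u)
include h

theorem eventually : ∀ᶠ y in 𝓝 u, NondegNear F X η σ y := by
  filter_upwards [h.2.eventually_nhds] with y hy
  exact ⟨h.1, hy⟩

theorem smooth : ContDiffAt ℝ ∞ X u := h.2.self_of_nhds.1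

theorem hDisc_pos : 0 < hDisc F X u := lt_of_le_of_ne (hDisc_nonneg F X u) h.2.self_of_nhds.2.1.symm

theorem side : Real.sign (coordDet F X u (η u)) = σ := h.2.self_of_nhds.2.2

theorem sigma_ne : σ ≠ 0 := fun h0 => by simpa [h0] using h.1

theorem abs_sigma : |σ| = 1 := by
  have := h.1
  rw [← abs_mul_abs_self] at this
  nlinarith [abs_nonneg σ]

theorem affVol_ne : affVol F X σ u ≠ 0 :=
  mul_ne_zero h.sigma_ne (Real.rpow_pos_of_pos h.hDisc_pos _).ne'

theorem hForm_eq (v w : E) : hForm F X u v w = affVol F X σ u * affMetric F X η u v w := by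
  have h1 : hDisc F X u ^ (1 / ((Fintype.card κ : ℝ) + 2))
      * hDisc F X u ^ (-(1 / ((Fintype.card κ : ℝ) + 2))) = 1 := by
    rw [← Real.rpow_add h.hDisc_pos, add_neg_cancel, Real.rpow_zero]
  rw [affVol, affMetric, h.side]
  calc hForm F X u v w = (σ * σ) * 1 * hForm F X u v w := by rw [h.1]; ring
    _ = _ := by
      generalize hDisc F X u ^ (1 / ((Fintype.card κ : ℝ) + 2)) = a at h1 ⊢
      generalize hDisc F X u ^ (-(1 / ((Fintype.card κ : ℝ) + 2))) = b at h1 ⊢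
      rw [← h1]
      ring

theorem affMetric_eq (v w : E) :
    affMetric F X η u v w = (affVol F X σ u)⁻¹ * hForm F X u v w := by
  rw [h.hForm_eq, inv_mul_cancel_left₀ h.affVol_ne]

theorem affVol_sq_pow :
    |affVol F X σ u| ^ (Fintype.card κ + 2) = hDisc F X u := by
  have h2 : (Fintype.card κ : ℝ) + 2 ≠ 0 := by positivity
  rw [affVol, abs_mul, h.abs_sigma, one_mul,
    abs_of_nonneg (Real.rpow_nonneg (hDisc_nonneg F X u) _), ← Real.rpow_natCast, ← Real.rpow_mul
    (hDisc_nonneg F X u)]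
  push_cast
  rw [one_div_mul_cancel h2, Real.rpow_one]

theorem gram_eq : gram F.source (affMetric F X η) u
    = (affVol F X σ u)⁻¹ • gram F.source (hForm F X) u := by
  ext i j
  simp [gram, h.affMetric_eq]

/-- With `ρ` the signed density, `g = ρ⁻¹ h` and `|ρ|^(m+2) = |det h|` for dimension `m`, so the
powers of `ρ` leave `ρ²`. Up to sign `ρ` is therefore the volume density of `g` itself. -/
theorem abs_det_gram : |(gram F.source (affMetric F X η) u).det| = affVol F X σ u ^ 2 := by
  have h1 : |(gram F.source (hForm F X) u).det| = |affVol F X σ u| ^ (Fintype.card κ + 2) :=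
    h.affVol_sq_pow.symm
  have h2 := abs_pos.2 h.affVol_ne
  rw [h.gram_eq, Matrix.det_smul, abs_mul, h1, abs_pow, abs_inv, pow_add, ← mul_assoc, ← mul_pow,
    inv_mul_cancel₀ h2.ne', one_pow, one_mul, sq_abs]

theorem symmBilin : SymmBilin (affMetric F X η u) :=
  (symmBilin_hForm h.smooth).const_mul _

theorem contDiffAt_hForm (v w : E) : ContDiffAt ℝ ∞ (fun y => hForm F X y v w) u :=
  contDiffAt_coordDet h.smooth (contDiffAt_second h.smooth v w)

theorem contDiffAt_affVol : ContDiffAt ℝ ∞ (affVol F X σ) u := by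
  have h1 : ContDiffAt ℝ ∞ (hDisc F X) u := by
    have h0 := h.2.self_of_nhds.2.1
    refine (contDiffAt_abs ?_).comp u (contDiffAt_det fun i j => h.contDiffAt_hForm _ _)
    exact fun h2 => h0 (by rw [hDisc, h2, abs_zero])
  exact contDiffAt_const.mul (h1.rpow_const_of_ne h.hDisc_pos.ne')

theorem isMetricNear : IsMetricNear F.source (affMetric F X η) u := by
  filter_upwards [h.eventually] with y hy
  refine ⟨hy.symmBilin, fun h0 => ?_, fun v w => ?_⟩
  · have := hy.abs_det_gram
    rw [h0, abs_zero] at this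
    exact hy.affVol_ne (pow_eq_zero_iff (two_ne_zero) |>.1 this.symm)
  · have h1 : ContDiffAt ℝ ∞ (fun z => (affVol F X σ z)⁻¹ * hForm F X z v w) y :=
      (hy.contDiffAt_affVol.inv hy.affVol_ne).mul (hy.contDiffAt_hForm v w)
    refine h1.congr_of_eventuallyEq ?_
    filter_upwards [hy.eventually] with z hz
    exact hz.affMetric_eq v w

theorem sum_inv_gram_mul_hForm :
    ∑ i, ∑ j, (gram F.source (affMetric F X η) u)⁻¹ i j * hForm F X u (F.source i) (F.source j)
      = Fintype.card κ * affVol F X σ u := by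
  have h1 : ∀ i, ∑ j, (gram F.source (affMetric F X η) u)⁻¹ i j *
      hForm F X u (F.source i) (F.source j) = affVol F X σ u := by
    intro i
    have h2 := sum_inv_gram_mul F.source h.isMetricNear.det_ne i i
    rw [if_pos rfl] at h2
    calc _ = affVol F X σ u * ∑ j, (gram F.source (affMetric F X η) u)⁻¹ i j *
          affMetric F X η u (F.source j) (F.source i) := by
            rw [Finset.mul_sum]
            exact Finset.sum_congr rfl fun j _ => by
              rw [h.hForm_eq, h.symmBilin.symm (F.source i)]; ring
      _ = _ := by rw [h2, mul_one]
  simp [h1]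

/-- The affine normal is normalized by the volume of the affine metric. -/
theorem coordDet_affNormal [Nonempty κ] :
    coordDet F X u (affNormal F X η u) = affVol F X σ u := by
  have hl := isLinearMap_coordDet F X u
  have hN : (Fintype.card κ : ℝ) ≠ 0 := by simp
  -- The first-order part of the Laplacian is tangential; only the trace of `h` with respect to `g`
  -- remains.
  have h1 : coordDet F X u (laplacian F.source (affMetric F X η) X u)
      = Fintype.card κ * affVol F X σ u := by
    rw [← h.sum_inv_gram_mul_hForm, laplacian]
    have hs : ∀ (f : κ → V), coordDet F X u (∑ i, f i) = ∑ i, coordDet F X u (f i) :=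
      fun f => map_sum (hl.mk' _) f _
    have hd : ∀ a b, coordDet F X u (a - b) = coordDet F X u a - coordDet F X u b :=
      fun a b => map_sub (hl.mk' _) a b
    simp only [hs, hl.map_smul, hd, coordDet_fderiv, sub_zero, smul_eq_mul]
    rfl
  rw [affNormal, hl.map_smul, h1, smul_eq_mul]
  field_simp

theorem contDiffAt_affNormal : ContDiffAt ℝ ∞ (affNormal F X η) u := by
  refine contDiffAt_const.smul ?_
  refine ContDiffAt.sum fun i _ => ContDiffAt.sum fun j _ => ContDiffAt.smul ?_ ?_
  · exact contDiffAt_inv_entry h.isMetricNear.contDiffAt_gram h.isMetricNear.det_ne i j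
  · exact (contDiffAt_second h.smooth _ _).sub
      ((h.smooth.fderiv_right (m := ∞) (by simp)).clm_apply
        (h.isMetricNear.contDiffAt_christoffel _ _))

/-- The trace of the derivative of the metric is that of twice the logarithm of the volume. -/
theorem trace_fderiv_metric (c : E) :
    ∑ i, ∑ j, (gram F.source (affMetric F X η) u)⁻¹ i j *
      fderiv ℝ (fun y => affMetric F X η y (F.source i) (F.source j)) u c
      = 2 * (fderiv ℝ (affVol F X σ) u c / affVol F X σ u) := by
  have hm := h.isMetricNear
  obtain ⟨D, hD, hD'⟩ := hasFDerivAt_matrix_det (A := gram F.source (affMetric F X η))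
    (A' := fun i j => fderiv ℝ (fun y => affMetric F X η y (F.source i) (F.source j)) u)
    (fun i j => (hm.differentiableAt _ _).hasFDerivAt) hm.det_ne
  have hρ := (h.contDiffAt_affVol.differentiableAt (by simp)).hasFDerivAt
  have h1 := hD.mul hD
  have h2 := (hρ.mul hρ).mul (hρ.mul hρ)
  -- In indefinite signature the sign of `det g` is not prescribed; squaring gives `(det g)² = ρ⁴`,
  -- to which Jacobi's formula applies.
  have h3 : (fun y => (gram F.source (affMetric F X η) y).det *
      (gram F.source (affMetric F X η) y).det) =ᶠ[𝓝 u] fun y =>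
      (affVol F X σ y * affVol F X σ y) * (affVol F X σ y * affVol F X σ y) := by
    filter_upwards [h.eventually] with y hy
    rw [← abs_mul_abs_self, hy.abs_det_gram]
    ring
  have h4 := congrArg (fun f : E →L[ℝ] ℝ => f c) (h1.unique (h2.congr_of_eventuallyEq h3))
  have h5 : (gram F.source (affMetric F X η) u).det * (gram F.source (affMetric F X η) u).det =
      (affVol F X σ u * affVol F X σ u) * (affVol F X σ u * affVol F X σ u) := h3.self_of_nhds
  simp only [add_apply, smul_apply, smul_eq_mul, hD', Pi.mul_apply] at h4
  have h6 : ∑ i, ∑ j, (gram F.source (affMetric F X η) u)⁻¹ i j *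
      fderiv ℝ (fun y => affMetric F X η y (F.source i) (F.source j)) u c
      = ∑ i, ∑ j, (gram F.source (affMetric F X η) u)⁻¹ i j *
      fderiv ℝ (fun y => affMetric F X η y (F.source j) (F.source i)) u c := by
    refine Finset.sum_congr rfl fun i _ => Finset.sum_congr rfl fun j _ => ?_
    rw [hm.fderiv_symm]
  rw [h6]
  set S := ∑ i, ∑ j, (gram F.source (affMetric F X η) u)⁻¹ i j *
      fderiv ℝ (fun y => affMetric F X η y (F.source j) (F.source i)) u c
  have hne := h.affVol_ne
  set ρ := affVol F X σ u
  set d := (gram F.source (affMetric F X η) u).det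
  have h7 : 2 * (d * d) * S = 4 * (ρ * ρ * ρ) * fderiv ℝ (affVol F X σ) u c := by
    linear_combination h4
  rw [h5] at h7
  field_simp
  have : (2 * ρ ^ 3) * (S * ρ) = (2 * ρ ^ 3) * (2 * fderiv ℝ (affVol F X σ) u c) := by
    linear_combination h7
  exact mul_left_cancel₀ (mul_ne_zero two_ne_zero (pow_ne_zero 3 hne)) this

/-- The affine normal through an arbitrary transversal field with the right normalization. -/
theorem affNormal_eq [Nonempty κ] {y : E → V} (hy : DifferentiableAt ℝ y u)
    (hyv : ∀ᶠ q in 𝓝 u, coordDet F X q (y q) = affVol F X σ q) :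
    affNormal F X η u = y u - fderiv ℝ X u (sharp F.source (affMetric F X η) u
      fun v => coordDet F X u (fderiv ℝ y u v) / affVol F X σ u) := by
  have hm := h.isMetricNear
  have hb := h.symmBilin
  have hne := h.affVol_ne
  have hy0 := hyv.self_of_nhds
  have hyne : coordDet F X u (y u) ≠ 0 := by rwa [hy0]
  -- `S` will be the tangential part of the second derivatives relative to `y`. The transversal
  -- coefficient is exactly `g`, because `det(∂X, y) = ρ`.
  choose A hA using exists_decomposition hyne
  let S : E → E → E := fun a b => A (second X u a b)
  have hS : ∀ a b, second X u a b
      = fderiv ℝ X u (S a b) + affMetric F X η u a b • y u := by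
    intro a b
    have h1 : coordDet F X u (second X u a b) / coordDet F X u (y u)
        = affMetric F X η u a b := by
      rw [hy0, h.affMetric_eq, inv_mul_eq_div]
      rfl
    rw [← h1]
    exact hA _
  have hSs : ∀ a b, S a b = S b a := fun a b => by simp only [S, second_symm h.smooth a b]
  set ρ := affVol F X σ u with hρ
  set g := affMetric F X η u with hg
  set gi := (gram F.source (affMetric F X η) u)⁻¹ with hgi
  let e := F.source
  let τ : E → ℝ := fun v => coordDet F X u (fderiv ℝ y u v) / ρ
  let tr : E → ℝ := fun c => ∑ i, e.repr (S c (e i)) i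
  let dg : E → E → E → ℝ := fun c a b => fderiv ℝ (fun q => affMetric F X η q a b) u c
  -- These terms arise when a coordinate column of `det(∂X, dX a + t y)` is differentiated:
  -- tangential parts contribute `t` times the trace of `S(c, ·)`, transversal parts contribute
  -- `-g(c, a)`.
  have hupd : ∀ (a c : E) (t : ℝ), ∑ i, F.target.det (Function.update
      (coordCols F X u (fderiv ℝ X u a + t • y u)) (some i) (second X u c (F.source i)))
      = tr c * t * ρ - g c a * ρ := by
    intro a c t
    have h1 : g c a = ∑ i, e.repr a i * g c (e i) := isLinearMap_eq_sum e (hb.isLinearMap_right c) a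
    rw [h1]
    simp only [tr, Finset.sum_mul]
    rw [← Finset.sum_sub_distrib]
    refine Finset.sum_congr rfl fun i _ => ?_
    rw [hS, AlternatingMap.map_update_add, AlternatingMap.map_update_smul, det_update_tangent,
      det_update_transversal, coordDet_add_smul, hy0, smul_eq_mul]
    ring
  have hdρ : ∀ c, fderiv ℝ (affVol F X σ) u c = (tr c + τ c) * ρ := by
    intro c
    have h1 : affVol F X σ =ᶠ[𝓝 u] fun q => coordDet F X q (y q) := by
      filter_upwards [hyv] with q hq
      exact hq.symm
    have h2 := hupd 0 c 1
    rw [map_zero, zero_add, one_smul, hb.zero_right] at h2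
    rw [h1.fderiv_eq, fderiv_coordDet h.smooth hy, h2]
    simp only [τ]
    field_simp
    ring
  -- Both sides of `ρ g(a, b) = det(∂X, ∂_a ∂_b X)` are differentiated; the traces of `S` cancel by
  -- `hdρ`.
  have hK : ∀ c a b, coordDet F X u (fderiv ℝ (fun q => second X q a b) u c)
      = ρ * (dg c a b + τ c * g a b + g c (S a b)) := by
    intro c a b
    have h1 : (fun q => hForm F X q a b) =ᶠ[𝓝 u]
        fun q => affVol F X σ q * affMetric F X η q a b := by
      filter_upwards [h.eventually] with q hq
      exact hq.hForm_eq a b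
    have h2 := (h.contDiffAt_affVol.differentiableAt (by simp)).hasFDerivAt.mul
      (hm.differentiableAt a b).hasFDerivAt
    have h3 : fderiv ℝ (fun q => hForm F X q a b) u c
        = ρ * dg c a b + g a b * fderiv ℝ (affVol F X σ) u c := by
      have h4 : fderiv ℝ (fun q => affVol F X σ q * affMetric F X η q a b) u = _ := h2.fderiv
      rw [h1.fderiv_eq, h4]
      rfl
    have h5 : fderiv ℝ (fun q => hForm F X q a b) u c = _ := fderiv_coordDet (F := F) h.smooth
      ((contDiffAt_second h.smooth a b).differentiableAt (by simp)) c
    rw [h3, hS a b, hupd, hdρ] at h5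
    linear_combination -h5
  have hT : ∀ c a b, fderiv ℝ (fun q => second X q a b) u c
      = fderiv ℝ (fun q => second X q c b) u a := fun c a b =>
    second_symm (X := fun q => fderiv ℝ X q b) (contDiffAt_fderiv_apply h.smooth b) c a
  -- Symmetry of the third derivatives becomes, through `hK`, the Codazzi equation `hcod`. In its
  -- trace with `g^{ij}` the Koszul formula and the derivative of the volume eliminate all
  -- derivatives of `g`, and only a multiple of `τ` is left.
  have hkey : ∀ z, g (∑ i, ∑ j, gi i j • (S (e i) (e j) -
      christoffel e (affMetric F X η) u (e i) (e j))) z = -(Fintype.card κ * τ z) := by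
    intro z
    have hsum1 : ∑ i, ∑ j, gi i j * g (e i) (e j) = Fintype.card κ := by
      have : ∀ i, ∑ j, gi i j * g (e i) (e j) = 1 := by
        intro i
        have h2 := sum_inv_gram_mul F.source hm.det_ne i i
        rw [if_pos rfl] at h2
        rw [← h2]
        exact Finset.sum_congr rfl fun j _ => by rw [hb.symm]
      simp [this]
    have hsum2 : ∀ φ : E → ℝ, IsLinearMap ℝ φ →
        ∑ i, ∑ j, gi i j * (φ (e j) * g (e i) z) = φ z := by
      intro φ hφ
      have h2 : g (∑ i, ∑ j, (gi i j * φ (e j)) • e i) z = φ z := sharp_spec e hb hm.det_ne hφ z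
      rw [← h2, hb.sum_left]
      refine Finset.sum_congr rfl fun i _ => ?_
      rw [hb.sum_left]
      refine Finset.sum_congr rfl fun j _ => ?_
      rw [hb.smul_left, ← mul_assoc]
    have hsum3 : ∑ i, ∑ j, gi i j * g (e j) (S (e i) z) = tr z := by
      refine Finset.sum_congr rfl fun i _ => ?_
      rw [hSs z]
      have : ∀ j, gi i j * g (e j) (S (e i) z)
          = ∑ k, e.repr (S (e i) z) k * (gi i j * g (e j) (e k)) := by
        intro j
        rw [isLinearMap_eq_sum e (hb.isLinearMap_right (e j)) (S (e i) z), Finset.mul_sum]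
        exact Finset.sum_congr rfl fun k _ => by ring
      simp only [this]
      rw [Finset.sum_comm]
      simp only [← Finset.mul_sum]
      have h2 : ∀ k, ∑ j, gi i j * g (e j) (e k) = if i = k then 1 else 0 :=
        fun k => sum_inv_gram_mul F.source hm.det_ne i k
      simp [h2]
    have hτ : IsLinearMap ℝ τ := by
      have hl := isLinearMap_coordDet F X u
      exact ⟨fun a b => by simp only [τ, map_add, hl.map_add, add_div],
        fun a b => by simp only [τ, map_smul, hl.map_smul, smul_eq_mul, mul_div_assoc]⟩
    have hP := h.trace_fderiv_metric z
    have hcod : ∀ i j, dg z (e i) (e j) + τ z * g (e i) (e j) + g z (S (e i) (e j))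
        = dg (e j) (e i) z + τ (e j) * g (e i) z + g (e j) (S (e i) z) := by
      intro i j
      have h1 : fderiv ℝ (fun q => second X q (e i) (e j)) u z
          = fderiv ℝ (fun q => second X q (e i) z) u (e j) := by
        rw [hT z, hT (e j)]
        apply congrArg (fun f : E →L[ℝ] V => f (e i))
        apply Filter.EventuallyEq.fderiv_eq
        filter_upwards [h.eventually] with q hq
        exact second_symm hq.smooth _ _
      have h2 := congrArg (coordDet F X u) h1
      rw [hK, hK] at h2
      exact mul_left_cancel₀ hne h2
    have hsum4 : ∑ i, ∑ j, gi i j * dg (e i) (e j) z = ∑ i, ∑ j, gi i j * dg (e j) (e i) z := by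
      rw [Finset.sum_comm]
      refine Finset.sum_congr rfl fun i _ => Finset.sum_congr rfl fun j _ => ?_
      rw [hgi, inv_gram_symm F.source hb]
    have hfin : ∀ i j, gi i j * g (S (e i) (e j) -
        christoffel e (affMetric F X η) u (e i) (e j)) z
        = gi i j * dg (e j) (e i) z + gi i j * (τ (e j) * g (e i) z)
          + gi i j * g (e j) (S (e i) z) - τ z * (gi i j * g (e i) (e j))
          - (1 / 2) * (gi i j * dg z (e i) (e j))
          - (1 / 2) * (gi i j * dg (e i) (e j) z) - (1 / 2) * (gi i j * dg (e j) (e i) z) := by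
      intro i j
      have hk : g (christoffel e (affMetric F X η) u (e i) (e j)) z = (1 / 2 : ℝ) *
        (dg (e i) (e j) z + dg (e j) (e i) z - dg z (e i) (e j)) := hm.koszul _ _ _
      rw [hb.sub_left, hk, hb.symm (S _ _)]
      linear_combination gi i j * hcod i j
    have hP' : ∑ i, ∑ j, gi i j * dg z (e i) (e j) = 2 * (tr z + τ z) := by
      rw [show ∑ i, ∑ j, gi i j * dg z (e i) (e j) = _ from hP, hdρ, mul_div_cancel_right₀ _ hne]
    rw [hb.sum_left]
    simp only [hb.sum_left, hb.smul_left, hfin, Finset.sum_sub_distrib, Finset.sum_add_distrib,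
      ← Finset.mul_sum]
    rw [hsum4, hsum1, hsum2 τ hτ, hsum3, hP']
    ring
  have hvec : ∑ i, ∑ j, gi i j • (S (e i) (e j) -
      christoffel e (affMetric F X η) u (e i) (e j))
      = -((Fintype.card κ : ℝ) • sharp e (affMetric F X η) u τ) := by
    have hτ : IsLinearMap ℝ τ := by
      have hl := isLinearMap_coordDet F X u
      exact ⟨fun a b => by simp only [τ, map_add, hl.map_add, add_div],
        fun a b => by simp only [τ, map_smul, hl.map_smul, smul_eq_mul, mul_div_assoc]⟩
    refine eq_of_pairing e hb hm.det_ne fun z => ?_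
    have h1 := hb.smul_left (-(Fintype.card κ : ℝ)) (sharp e (affMetric F X η) u τ) z
    have h2 : g (sharp e (affMetric F X η) u τ) z = τ z := sharp_spec e hb hm.det_ne hτ z
    rw [h2] at h1
    rw [← neg_smul, ← hg, h1, hkey]
    ring
  have hlap : laplacian F.source (affMetric F X η) X u
      = fderiv ℝ X u (-((Fintype.card κ : ℝ) • sharp e (affMetric F X η) u τ))
        + (Fintype.card κ : ℝ) • y u := by
    have hsum1 : ∑ i, ∑ j, gi i j * g (e i) (e j) = Fintype.card κ := by
      have := h.sum_inv_gram_mul_hForm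
      simp only [h.hForm_eq, mul_left_comm _ (affVol F X σ u), ← Finset.mul_sum] at this
      exact mul_left_cancel₀ hne (this.trans (mul_comm _ _))
    rw [← hvec, ← hsum1, laplacian]
    simp only [map_sum, map_smul, Finset.sum_smul, map_sub, ← Finset.sum_add_distrib]
    refine Finset.sum_congr rfl fun i _ => Finset.sum_congr rfl fun j _ => ?_
    rw [hS, mul_smul, ← smul_add]
    congr 1
    abel
  have hN : (Fintype.card κ : ℝ) ≠ 0 := by simp
  rw [affNormal, hlap, map_neg, map_smul, smul_add, smul_neg, smul_smul, smul_smul,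
    one_div_mul_cancel hN, one_smul, one_smul]
  abel

end NondegNear

end Nondegenerate

theorem real_sign_mul (a b : ℝ) : Real.sign (a * b) = Real.sign a * Real.sign b := by
  rcases lt_trichotomy a 0 with ha | ha | ha <;> rcases lt_trichotomy b 0 with hb | hb | hb <;>
    simp [Real.sign_of_neg, Real.sign_of_pos, ha, hb, mul_pos_of_neg_of_neg, mul_neg_of_neg_of_pos,
      mul_neg_of_pos_of_neg]

theorem real_sign_mul_abs (a : ℝ) : Real.sign a * |a| = a := by
  rcases lt_trichotomy a 0 with ha | ha | ha <;>
    simp [Real.sign_of_neg, Real.sign_of_pos, ha, abs_of_neg, abs_of_pos]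

theorem real_sign_mul_self (a : ℝ) : Real.sign a * a = |a| := by
  rcases lt_trichotomy a 0 with ha | ha | ha <;>
    simp [Real.sign_of_neg, Real.sign_of_pos, ha, abs_of_neg, abs_of_pos]

/-! ### Affine hyperspheres in a coordinate domain. -/

section Spheres

variable {κ E V : Type*} [Fintype κ] [DecidableEq κ]
  [NormedAddCommGroup E] [NormedSpace ℝ E] [NormedAddCommGroup V] [NormedSpace ℝ V]
  {F : Frame κ E V} {X η : E → V} {σ : ℝ} {u : E}

/-- Nondegeneracy and transversality are open conditions. -/
theorem nondegNear_of_ne (hX : ∀ᶠ y in 𝓝 u, ContDiffAt ℝ ∞ X y) (hd : hDisc F X u ≠ 0)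
    (hη : ContinuousAt η u) (hs : coordDet F X u (η u) ≠ 0) :
    NondegNear F X η (Real.sign (coordDet F X u (η u))) u := by
  have hX0 := hX.self_of_nhds
  have h1 : ContinuousAt (fun y => coordDet F X y (η y)) u := by
    refine ContinuousAt.comp (g := fun m => F.target.det m)
      (f := fun y (o : Option κ) => coordCols F X y (η y) o)
      (continuous_basis_det F.target).continuousAt (continuousAt_pi.2 fun o => ?_)
    rcases o with _ | i
    · exact hη
    · exact (contDiffAt_fderiv_apply hX0 (F.source i)).continuousAt
  have h2 : ∀ᶠ y in 𝓝 u, Real.sign (coordDet F X y (η y))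
      = Real.sign (coordDet F X u (η u)) := by
    rcases hs.lt_or_gt with h | h
    · filter_upwards [h1.eventually_lt continuousAt_const h] with y hy
      rw [Real.sign_of_neg hy, Real.sign_of_neg h]
    · filter_upwards [continuousAt_const.eventually_lt h1 h] with y hy
      rw [Real.sign_of_pos hy, Real.sign_of_pos h]
  have h3 : ContinuousAt (hDisc F X) u := by
    have : ContDiffAt ℝ ∞ (fun y => (gram F.source (hForm F X) y).det) u :=
      contDiffAt_det fun i j => contDiffAt_coordDet hX0 (contDiffAt_second hX0 _ _)
    exact continuous_abs.continuousAt.comp this.continuousAt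
  refine ⟨?_, ?_⟩
  · rcases Real.sign_apply_eq_of_ne_zero _ hs with h | h <;> rw [h] <;> norm_num
  · filter_upwards [h2, h3.eventually_ne hd, hX] with y h2 h3 h4
    exact ⟨h4, h3, h2⟩

/-- The derivative of the affine normal is tangential. -/
theorem NondegNear.coordDet_fderiv_affNormal [Nonempty κ] (h : NondegNear F X η σ u) (v : E) :
    coordDet F X u (fderiv ℝ (affNormal F X η) u v) = 0 := by
  have hl := isLinearMap_coordDet F X u
  have h1 := h.affNormal_eq (h.contDiffAt_affNormal.differentiableAt (by simp)) (by
    filter_upwards [h.eventually] with q hq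
    exact hq.coordDet_affNormal)
  set τ : E → ℝ := fun v => coordDet F X u (fderiv ℝ (affNormal F X η) u v) / affVol F X σ u
    with hτ
  have hτl : IsLinearMap ℝ τ :=
    ⟨fun a b => by simp only [τ, map_add, hl.map_add, add_div],
      fun a b => by simp only [τ, map_smul, hl.map_smul, smul_eq_mul, mul_div_assoc]⟩
  -- The formula is applied to `y = ξ`, which is itself normalized: the correction must vanish, and
  -- nondegeneracy then gives `τ = 0`.
  have h2 : fderiv ℝ X u (sharp F.source (affMetric F X η) u τ) = 0 := sub_eq_self.1 h1.symm
  have h3 : sharp F.source (affMetric F X η) u τ = 0 :=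
    (transversal_injective (y := affNormal F X η u) (t := 0)
      (by rw [h.coordDet_affNormal]; exact h.affVol_ne) (by simpa using h2)).1
  have h4 := sharp_spec F.source h.symmBilin h.isMetricNear.det_ne hτl v
  rw [h3, h.symmBilin.zero_left] at h4
  exact (div_eq_zero_iff.1 h4.symm).resolve_right h.affVol_ne

/-- Near `u`, the map `X` is an affine hypersphere with center the origin. -/
structure SphereNear (F : Frame κ E V) (X η : E → V) (L σ : ℝ) (u : E) : Prop where
  nondeg : NondegNear F X η σ u
  neg : L < 0
  normal : ∀ᶠ y in 𝓝 u, affNormal F X η y = (-L) • X y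

namespace SphereNear

variable {L : ℝ} (h : SphereNear F X η L σ u)
include h

theorem eventually : ∀ᶠ y in 𝓝 u, SphereNear F X η L σ y := by
  filter_upwards [h.nondeg.eventually, h.normal.eventually_nhds] with y h1 h2
  exact ⟨h1, h.neg, h2⟩

/-- The normalization of the affine normal passes to the position vector. The affine volume of a
hypersphere is thus a determinant, which makes the volumes in the composition computable. -/
theorem coordDet_self [Nonempty κ] : (-L) * coordDet F X u (X u) = affVol F X σ u := by
  rw [← h.nondeg.coordDet_affNormal, h.normal.self_of_nhds,
    (isLinearMap_coordDet F X u).map_smul, smul_eq_mul]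

theorem coordDet_self_ne [Nonempty κ] : coordDet F X u (X u) ≠ 0 := fun h0 => by
  have := h.coordDet_self
  rw [h0, mul_zero] at this
  exact h.nondeg.affVol_ne this.symm

theorem decomp_apply [Nonempty κ] (a : E) (t : ℝ) :
    decomp F X η u (fderiv ℝ X u a + (t * (-L)) • X u) = (a, t) := by
  rw [mul_smul, ← h.normal.self_of_nhds]
  exact inverse_coprod_apply (by rw [h.nondeg.coordDet_affNormal]; exact h.nondeg.affVol_ne) a t

/-- The position vector is a nonzero multiple of the affine normal, so splitting along either gives
the same tangential part. -/
theorem affConnection_eq [Nonempty κ] {v w a : E} {t : ℝ}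
    (hs : second X u v w = fderiv ℝ X u a + t • X u) : affConnection F X η u v w = a := by
  have hL := h.neg.ne
  have : t = (t / (-L)) * (-L) := by field_simp
  rw [affConnection, hs, this, h.decomp_apply]

/-- The Gauss formula. -/
theorem second_eq [Nonempty κ] (v w : E) : second X u v w
    = fderiv ℝ X u (affConnection F X η u v w) + (affMetric F X η u v w * (-L)) • X u := by
  obtain ⟨a, ha⟩ := exists_decomposition h.coordDet_self_ne (second X u v w)
  have h1 : coordDet F X u (second X u v w) / coordDet F X u (X u)
      = affMetric F X η u v w * (-L) := by
    have := h.nondeg.hForm_eq v w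
    rw [div_eq_iff h.coordDet_self_ne, ← hForm, this, ← h.coordDet_self]
    ring
  rw [h1] at ha
  rw [h.affConnection_eq ha]
  exact ha

theorem shape_eq [Nonempty κ] (v : E) : shape F X η u v = L • v := by
  have h1 : affNormal F X η =ᶠ[𝓝 u] (-L) • X := h.normal
  have h2 : fderiv ℝ (affNormal F X η) u v = fderiv ℝ X u ((-L) • v) + (0 * (-L)) • X u := by
    rw [h1.fderiv_eq, fderiv_const_smul (h.nondeg.smooth.differentiableAt (by simp))]
    simp
  rw [shape, h2, h.decomp_apply, neg_smul, neg_neg]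

end SphereNear

/-- A nondegenerate centroaffine hypersurface whose position vector is normalized by the affine
volume is an affine hypersphere. -/
theorem NondegNear.sphereNear [Nonempty κ] {L : ℝ} (h : NondegNear F X η σ u) (hL : L < 0)
    (hv : ∀ᶠ y in 𝓝 u, (-L) * coordDet F X y (X y) = affVol F X σ y) :
    SphereNear F X η L σ u := by
  refine ⟨h, hL, ?_⟩
  filter_upwards [h.eventually, hv.eventually_nhds] with y hy hvy
  have hd : DifferentiableAt ℝ X y := hy.smooth.differentiableAt (by simp)
  have h1 := hy.affNormal_eq (y := (-L) • X) (hd.const_smul _) (by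
    filter_upwards [hvy] with q hq
    rw [← hq, Pi.smul_apply, (isLinearMap_coordDet F X q).map_smul, smul_eq_mul])
  -- A constant multiple of the position vector has tangential derivative, so the correction in
  -- `affNormal_eq` vanishes.
  have h2 : ∀ v, coordDet F X y (fderiv ℝ ((-L) • X) y v) = 0 := by
    intro v
    rw [fderiv_const_smul hd, smul_apply, ← map_smul, coordDet_fderiv]
  simp only [h2, zero_div] at h1
  simpa [sharp] using h1

/-! ### Change of parameters -/

/-- As a function of the tangent slots the determinant is an alternating form of top degree on `E`,
hence is multiplied by `det T`. -/
theorem coordDet_comp {T : E →L[ℝ] E} {X' : E → V} {u' : E}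
    (hT : ∀ v, fderiv ℝ X' u' v = fderiv ℝ X u (T v)) (z : V) :
    coordDet F X' u' z = LinearMap.det (T : E →ₗ[ℝ] E) * coordDet F X u z := by
  have hupd : ∀ [DecidableEq κ] (m : κ → E) (i : κ) (x : E),
      (fun o : Option κ => o.elim z fun j => fderiv ℝ X u (Function.update m i x j))
        = Function.update (fun o : Option κ => o.elim z fun j => fderiv ℝ X u (m j)) (some i)
          (fderiv ℝ X u x) := by
    intro _ m i x
    ext1 o
    rcases o with _ | j
    · simp
    · by_cases hij : j = i
      · subst hij
        simp
      · simp [hij]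
  let f : E [⋀^κ]→ₗ[ℝ] ℝ :=
    { toFun := fun m => F.target.det fun o => o.elim z fun i => fderiv ℝ X u (m i)
      map_update_add' := fun m i x y => by
        rw [hupd, hupd, hupd, map_add, AlternatingMap.map_update_add]
      map_update_smul' := fun m i c x => by
        rw [hupd, hupd, map_smul, AlternatingMap.map_update_smul]
      map_eq_zero_of_eq' := fun m i j hij hne =>
        F.target.det.map_eq_zero_of_eq _ (i := some i) (j := some j) (by simp [hij])
          (by simpa using hne) }
  have hf := f.eq_smul_basis_det F.source
  have h1 : coordDet F X' u' z = f (T ∘ F.source) := by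
    simp only [coordDet, hT]
    rfl
  have h2 : coordDet F X u z = f F.source := rfl
  have h3 : F.source.det (T ∘ F.source) = LinearMap.det (T : E →ₗ[ℝ] E) := by
    have := F.source.det_comp (T : E →ₗ[ℝ] E) F.source
    rw [F.source.det_self, mul_one] at this
    exact this
  rw [h1, hf, AlternatingMap.smul_apply, h3, smul_eq_mul, ← h2, mul_comm]

/-- `X'` is, near `u'`, the reparametrization of `X` by `φ`. -/
structure Reparam (φ : E → E) (X X' η η' : E → V) (u' : E) : Prop where
  smooth : ∀ᶠ y in 𝓝 u', ContDiffAt ℝ ∞ φ y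
  det_ne : ∀ᶠ y in 𝓝 u', LinearMap.det (fderiv ℝ φ y : E →ₗ[ℝ] E) ≠ 0
  eq : ∀ᶠ y in 𝓝 u', X' y = X (φ y)
  eq_side : ∀ᶠ y in 𝓝 u', η' y = η (φ y)

namespace Reparam

variable {φ : E → E} {X' η' : E → V} {u' : E} (hr : Reparam φ X X' η η' u')
include hr

theorem eventually : ∀ᶠ y in 𝓝 u', Reparam φ X X' η η' y := by
  filter_upwards [hr.smooth.eventually_nhds, hr.det_ne.eventually_nhds, hr.eq.eventually_nhds,
    hr.eq_side.eventually_nhds] with y h1 h2 h3 h4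
  exact ⟨h1, h2, h3, h4⟩

theorem hasFDerivAt : HasFDerivAt φ (fderiv ℝ φ u') u' :=
  (hr.smooth.self_of_nhds.differentiableAt (by simp)).hasFDerivAt

theorem fderiv_eq (hX : ContDiffAt ℝ ∞ X (φ u')) (v : E) :
    fderiv ℝ X' u' v = fderiv ℝ X (φ u') (fderiv ℝ φ u' v) := by
  have h1 : X' =ᶠ[𝓝 u'] X ∘ φ := hr.eq
  rw [h1.fderiv_eq, (HasFDerivAt.comp u' (hX.differentiableAt (by simp)).hasFDerivAt
    hr.hasFDerivAt).fderiv]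
  rfl

theorem eventually_at {P : E → Prop} (hP : ∀ᶠ y in 𝓝 (φ u'), P y) : ∀ᶠ y in 𝓝 u', P (φ y) :=
  hr.hasFDerivAt.continuousAt.eventually hP

theorem coordDet_eq (hX : ContDiffAt ℝ ∞ X (φ u')) (z : V) : coordDet F X' u' z
    = LinearMap.det (fderiv ℝ φ u' : E →ₗ[ℝ] E) * coordDet F X (φ u') z :=
  coordDet_comp (hr.fderiv_eq hX) z

theorem second_eq (hX : ∀ᶠ y in 𝓝 (φ u'), ContDiffAt ℝ ∞ X y) (v w : E) :
    second X' u' v w = second X (φ u') (fderiv ℝ φ u' v) (fderiv ℝ φ u' w)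
      + fderiv ℝ X (φ u') (second φ u' v w) := by
  have hX0 := hX.self_of_nhds
  have h1 : (fun y => fderiv ℝ X' y w) =ᶠ[𝓝 u'] fun y => fderiv ℝ X (φ y) (fderiv ℝ φ y w) := by
    filter_upwards [hr.eventually, hr.eventually_at hX] with y hy hy'
    exact hy.fderiv_eq hy' w
  have h2 : HasFDerivAt (fun y => fderiv ℝ X (φ y))
      ((fderiv ℝ (fderiv ℝ X) (φ u')).comp (fderiv ℝ φ u')) u' :=
    HasFDerivAt.comp (f := φ) u' ((hX0.fderiv_right (m := ∞) (by simp)).differentiableAt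
      (by simp)).hasFDerivAt hr.hasFDerivAt
  have h3 := ((contDiffAt_fderiv_apply hr.smooth.self_of_nhds w).differentiableAt
    (by simp)).hasFDerivAt
  rw [second, h1.fderiv_eq, (h2.clm_apply h3).fderiv, Calabi.second_eq hX0]
  simp [second, add_comm]

theorem hForm_eq (hX : ∀ᶠ y in 𝓝 (φ u'), ContDiffAt ℝ ∞ X y) (v w : E) :
    hForm F X' u' v w = LinearMap.det (fderiv ℝ φ u' : E →ₗ[ℝ] E)
      * hForm F X (φ u') (fderiv ℝ φ u' v) (fderiv ℝ φ u' w) := by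
  rw [hForm, hr.coordDet_eq hX.self_of_nhds, hr.second_eq hX,
    (isLinearMap_coordDet F X _).map_add, coordDet_fderiv, add_zero, hForm]

theorem hDisc_eq (hX : ∀ᶠ y in 𝓝 (φ u'), ContDiffAt ℝ ∞ X y) :
    hDisc F X' u' = |LinearMap.det (fderiv ℝ φ u' : E →ₗ[ℝ] E)| ^ (Fintype.card κ + 2)
      * hDisc F X (φ u') := by
  set J := LinearMap.det (fderiv ℝ φ u' : E →ₗ[ℝ] E) with hJ
  set P := LinearMap.toMatrix F.source F.source (fderiv ℝ φ u' : E →ₗ[ℝ] E) with hP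
  have hPJ : P.det = J := by rw [hP, LinearMap.det_toMatrix]
  have hb := symmBilin_hForm (F := F) hX.self_of_nhds
  -- `h` changes by congruence with the Jacobian matrix and by a further factor `J` from `coordDet`;
  -- together these give the exponent `m + 2`.
  have h1 : gram F.source (hForm F X') u'
      = J • (P.transpose * gram F.source (hForm F X) (φ u') * P) := by
    ext i j
    simp only [gram, Matrix.of_apply, Matrix.smul_apply, smul_eq_mul, Matrix.mul_apply,
      Matrix.transpose_apply, Finset.sum_mul]
    rw [hr.hForm_eq hX, isLinearMap_eq_sum F.source (hb.isLinearMap_right _)]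
    congr 1
    refine Finset.sum_congr rfl fun k _ => ?_
    rw [isLinearMap_eq_sum F.source (hb.isLinearMap_left _), Finset.mul_sum]
    refine Finset.sum_congr rfl fun l _ => ?_
    simp only [hP, LinearMap.toMatrix_apply]
    rw [mul_comm]
    rfl
  rw [hDisc, h1, Matrix.det_smul, Matrix.det_mul, Matrix.det_mul, Matrix.det_transpose, hPJ, hDisc,
    abs_mul, abs_mul, abs_mul, abs_pow]
  ring

theorem rpow_hDisc (hX : ∀ᶠ y in 𝓝 (φ u'), ContDiffAt ℝ ∞ X y) (t : ℝ) :
    hDisc F X' u' ^ t = |LinearMap.det (fderiv ℝ φ u' : E →ₗ[ℝ] E)|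
      ^ (((Fintype.card κ : ℝ) + 2) * t) * hDisc F X (φ u') ^ t := by
  rw [hr.hDisc_eq hX, Real.mul_rpow (by positivity) (hDisc_nonneg _ _ _), ← Real.rpow_natCast,
    ← Real.rpow_mul (abs_nonneg _)]
  push_cast
  rfl

/-- The affine metric does not depend on the parametrization. -/
theorem affMetric_eq (hX : ∀ᶠ y in 𝓝 (φ u'), ContDiffAt ℝ ∞ X y) (v w : E) :
    affMetric F X' η' u' v w
      = affMetric F X η (φ u') (fderiv ℝ φ u' v) (fderiv ℝ φ u' w) := by
  have hJ := hr.det_ne.self_of_nhds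
  have h2 : (Fintype.card κ : ℝ) + 2 ≠ 0 := by positivity
  have h3 : ((Fintype.card κ : ℝ) + 2) * -(1 / ((Fintype.card κ : ℝ) + 2)) = -1 := by
    field_simp
  rw [affMetric, affMetric, hr.hForm_eq hX, hr.coordDet_eq hX.self_of_nhds,
    hr.eq_side.self_of_nhds, hr.rpow_hDisc hX, h3, Real.rpow_neg_one, real_sign_mul]
  set J := LinearMap.det (fderiv ℝ φ u' : E →ₗ[ℝ] E) with hJ
  -- The side contributes `sign J`, the power of the discriminant `|J|⁻¹`, and `h` contributes `J`.
  have h4 : Real.sign J * |J|⁻¹ * J = 1 := by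
    rw [mul_right_comm, real_sign_mul_self]
    exact mul_inv_cancel₀ (abs_ne_zero.2 ‹_›)
  linear_combination (Real.sign (coordDet F X (φ u') (η (φ u')))
    * hDisc F X (φ u') ^ (-(1 / ((Fintype.card κ : ℝ) + 2)))
    * hForm F X (φ u') (fderiv ℝ φ u' v) (fderiv ℝ φ u' w)) * h4

/-- The affine normal does not depend on the parametrization. -/
theorem affNormal_eq [Nonempty κ] {σ' : ℝ} (h : NondegNear F X η σ (φ u'))
    (h' : NondegNear F X' η' σ' u') : affNormal F X' η' u' = affNormal F X η (φ u') := by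
  have h2 : (Fintype.card κ : ℝ) + 2 ≠ 0 := by positivity
  have hd : HasFDerivAt (affNormal F X η ∘ φ)
      ((fderiv ℝ (affNormal F X η) (φ u')).comp (fderiv ℝ φ u')) u' :=
    HasFDerivAt.comp u' (h.contDiffAt_affNormal.differentiableAt (by simp)).hasFDerivAt
      hr.hasFDerivAt
  -- The old normal carried along `φ` is normalized for the new parameters: `coordDet` scales by
  -- `J`, the density by `sign(J) |J|`. Its derivative stays tangential, so there is no correction.
  have h1 := h'.affNormal_eq (y := affNormal F X η ∘ φ) hd.differentiableAt (by
    filter_upwards [hr.eventually, h'.eventually, hr.eventually_at h.eventually] with q hq hq' hqn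
    have hXq : ∀ᶠ y in 𝓝 (φ q), ContDiffAt ℝ ∞ X y := by
      filter_upwards [hqn.eventually] with y hy using hy.smooth
    have h3 : ((Fintype.card κ : ℝ) + 2) * (1 / ((Fintype.card κ : ℝ) + 2)) = 1 := by
      field_simp
    rw [hq.coordDet_eq hqn.smooth, Function.comp_apply, hqn.coordDet_affNormal, affVol, affVol,
      hq.rpow_hDisc hXq, h3, Real.rpow_one, ← hq'.side, ← hqn.side,
      hq.eq_side.self_of_nhds, hq.coordDet_eq hqn.smooth, real_sign_mul]
    have h5 := real_sign_mul_abs (LinearMap.det (fderiv ℝ φ q : E →ₗ[ℝ] E))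
    linear_combination (-(Real.sign (coordDet F X (φ q) (η (φ q)))
      * hDisc F X (φ q) ^ (1 / ((Fintype.card κ : ℝ) + 2)))) * h5)
  have h3 : ∀ v, coordDet F X' u' (fderiv ℝ (affNormal F X η ∘ φ) u' v) = 0 := by
    intro v
    rw [hr.coordDet_eq h.smooth, hd.fderiv, ContinuousLinearMap.comp_apply,
      h.coordDet_fderiv_affNormal, mul_zero]
  simp only [h3, zero_div] at h1
  simpa [sharp] using h1

end Reparam

end Spheres

/-! ### Change of charts, hyperspheres on manifolds, and holonomy. -/

section OnManifold

variable {κ E V H M : Type*} [Fintype κ] [DecidableEq κ]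
  [NormedAddCommGroup E] [NormedSpace ℝ E] [NormedAddCommGroup V] [NormedSpace ℝ V]
  [TopologicalSpace H] [TopologicalSpace M] [ChartedSpace H M]
  {F : Frame κ E V} {I : ModelWithCorners ℝ E H} [I.Boundaryless] [IsManifold I ∞ M]

theorem contDiffAt_inChart {x : M → V} (hx : ContMDiff I 𝓘(ℝ, V) ∞ x) (p : M) {u : E}
    (hu : u ∈ (extChartAt I p).target) : ContDiffAt ℝ ∞ (inChart I x p) u := by
  have h1 : ContMDiffOn 𝓘(ℝ, E) 𝓘(ℝ, V) ∞ (inChart I x p) (extChartAt I p).target :=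
    hx.comp_contMDiffOn (contMDiffOn_extChartAt_symm p)
  exact (contMDiffOn_iff_contDiffOn.1 h1).contDiffAt
    ((isOpen_extChartAt_target p).mem_nhds hu)

/-- The change from the preferred chart at `q` to that at `p`. -/
def chartChange (I : ModelWithCorners ℝ E H) (q p : M) : E → E :=
  extChartAt I p ∘ (extChartAt I q).symm

variable {p q : M}

theorem chartChange_apply (q p : M) : chartChange I q p (extChartAt I q q) = extChartAt I p q := by
  simp [chartChange]

theorem contDiffAt_chartChange (hq : q ∈ (extChartAt I p).source) :
    ∀ᶠ y in 𝓝 (extChartAt I q q), ContDiffAt ℝ ∞ (chartChange I q p) y := by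
  have ho : IsOpen ((extChartAt I q).symm ≫ extChartAt I p).source := by
    rw [PartialEquiv.trans_source, PartialEquiv.symm_source]
    exact (continuousOn_extChartAt_symm q).isOpen_inter_preimage (isOpen_extChartAt_target q)
      (isOpen_extChartAt_source p)
  have hmem : extChartAt I q q ∈ ((extChartAt I q).symm ≫ extChartAt I p).source := by
    rw [PartialEquiv.trans_source, PartialEquiv.symm_source]
    exact ⟨mem_extChartAt_target q, by simpa using hq⟩
  filter_upwards [ho.mem_nhds hmem] with y hy
  have h1 := contDiffWithinAt_ext_coord_change (I := I) (n := ∞) p q hy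
  rw [I.range_eq_univ] at h1
  exact h1.contDiffAt univ_mem

theorem fderiv_chartChange [IsManifold I 1 M] (q p : M) :
    fderiv ℝ (chartChange I q p) (extChartAt I q q) = tangentCoordChange I q p q := by
  rw [tangentCoordChange_def, I.range_eq_univ, fderivWithin_univ]
  rfl

theorem det_fderiv_chartChange (hq : q ∈ (extChartAt I p).source) :
    LinearMap.det (fderiv ℝ (chartChange I q p) (extChartAt I q q) : E →ₗ[ℝ] E) ≠ 0 := by
  have : IsManifold I 1 M := IsManifold.of_le (n := ∞) (by simp)
  have hqq := mem_extChartAt_source (I := I) q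
  have h1 : (tangentCoordChange I p q q : E →ₗ[ℝ] E) ∘ₗ
      (tangentCoordChange I q p q : E →ₗ[ℝ] E) = LinearMap.id := by
    ext v
    exact (tangentCoordChange_comp ⟨⟨hqq, hq⟩, hqq⟩).trans (tangentCoordChange_self hqq)
  have h2 := congrArg LinearMap.det h1
  rw [LinearMap.det_comp, LinearMap.det_id] at h2
  rw [fderiv_chartChange]
  exact right_ne_zero_of_mul_eq_one h2

theorem inChart_chartChange {W : Type*} (f : M → W) (hq : q ∈ (extChartAt I p).source) :
    ∀ᶠ y in 𝓝 (extChartAt I q q), f ((extChartAt I q).symm y)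
      = f ((extChartAt I p).symm (chartChange I q p y)) := by
  have h1 : ContinuousAt (extChartAt I q).symm (extChartAt I q q) :=
    continuousAt_extChartAt_symm q
  have h2 : ∀ᶠ y in 𝓝 (extChartAt I q q), (extChartAt I q).symm y ∈ (extChartAt I p).source :=
    h1.eventually (by simpa using (isOpen_extChartAt_source p).mem_nhds hq)
  filter_upwards [h2] with y hy
  rw [chartChange, Function.comp_apply, (extChartAt I p).left_inv hy]

theorem reparam_chartChange [FiniteDimensional ℝ E] (x η : M → V)
    (hq : q ∈ (extChartAt I p).source) :
    Reparam (chartChange I q p) (inChart I x p) (inChart I x q) (inChart I η p) (inChart I η q)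
      (extChartAt I q q) := by
  refine ⟨contDiffAt_chartChange hq, ?_, inChart_chartChange x hq, inChart_chartChange η hq⟩
  have h1 : ContinuousAt (fderiv ℝ (chartChange I q p)) (extChartAt I q q) :=
    ((contDiffAt_chartChange hq).self_of_nhds.fderiv_right (m := ∞) (by simp)).continuousAt
  have h2 : ContinuousAt (fun y => LinearMap.det (fderiv ℝ (chartChange I q p) y : E →ₗ[ℝ] E))
      (extChartAt I q q) := ContinuousLinearMap.continuous_det.continuousAt.comp h1
  exact h2.eventually_ne (det_fderiv_chartChange hq)

/-- At each point a nondegenerate hypersurface is nondegenerate in the preferred chart. -/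
theorem nondegNear_inChart {x η : M → V} (hx : ContMDiff I 𝓘(ℝ, V) ∞ x) (p : M)
    (hd : hDisc F (inChart I x p) (extChartAt I p p) ≠ 0) (hη : ContinuousAt η p)
    (hs : coordDet F (inChart I x p) (extChartAt I p p) (η p) ≠ 0) :
    ∃ σ, NondegNear F (inChart I x p) (inChart I η p) σ (extChartAt I p p) := by
  have hηu : inChart I η p (extChartAt I p p) = η p := by simp [inChart]
  refine ⟨_, nondegNear_of_ne ?_ hd ?_ (by rwa [hηu])⟩
  · filter_upwards [(isOpen_extChartAt_target p).mem_nhds (mem_extChartAt_target (I := I) p)]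
      with y hy
    exact contDiffAt_inChart hx p hy
  · exact ContinuousAt.comp (g := η) (by simpa using hη) (continuousAt_extChartAt_symm p)

namespace IsHyperbolicAffineSphere

variable {x η : M → V} {L : ℝ} (hx : IsHyperbolicAffineSphere F I x η L)
include hx

theorem exists_nondegNear (p : M) :
    ∃ σ, NondegNear F (inChart I x p) (inChart I η p) σ (extChartAt I p p) :=
  nondegNear_inChart hx.smooth p (hx.nondegenerate p) hx.side_continuous.continuousAt
    (hx.side_transversal p)

/-- The affine normal, read in a chart. -/
theorem affNormal_inChart [Nonempty κ] (p : M) : ∀ᶠ u in 𝓝 (extChartAt I p p),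
    affNormal F (inChart I x p) (inChart I η p) u
      = normalAt F I x η ((extChartAt I p).symm u) := by
  have : FiniteDimensional ℝ E := Module.Finite.of_basis F.source
  obtain ⟨σ, h⟩ := hx.exists_nondegNear p
  filter_upwards [h.eventually, (isOpen_extChartAt_target p).mem_nhds
      (mem_extChartAt_target (I := I) p)] with u hu ht
  set q := (extChartAt I p).symm u with hq
  have hqs : q ∈ (extChartAt I p).source := (extChartAt I p).map_target ht
  have hqu : extChartAt I p q = u := (extChartAt I p).right_inv ht
  obtain ⟨σ', h'⟩ := hx.exists_nondegNear q
  have := (reparam_chartChange x η hqs).affNormal_eq (F := F) (σ := σ) (σ' := σ')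
    (by rwa [chartChange_apply, hqu]) h'
  rw [chartChange_apply, hqu] at this
  exact this.symm

/-- The affine normal of a hypersphere is a constant multiple of the position vector. -/
theorem normalAt_eq [Nonempty κ] (p : M) : normalAt F I x η p = (-L) • x p := by
  obtain ⟨σ, h⟩ := hx.exists_nondegNear p
  have hshape : ∀ v, shape F (inChart I x p) (inChart I η p) (extChartAt I p p) v = L • v :=
    hx.shape_eq p
  -- The hypothesis refers at each point to the normal in the chart of that point; independence of
  -- the parametrization makes it a statement in one chart near `p`.
  have hcenter : ∀ᶠ u in 𝓝 (extChartAt I p p), ∃ t : ℝ,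
      inChart I x p u + t • affNormal F (inChart I x p) (inChart I η p) u = 0 := by
    filter_upwards [hx.affNormal_inChart p] with u hu
    rw [hu]
    exact hx.center _
  have hxp : x p = inChart I x p (extChartAt I p p) := by simp [inChart]
  rw [hxp, normalAt]
  clear hxp
  set u₀ := extChartAt I p p
  set X := inChart I x p
  set N := inChart I η p
  -- This formula is obtained from `X = -t ξ` by applying `coordDet`; it shows that the factor,
  -- given only pointwise, is smooth.
  let t : E → ℝ := fun u => -(coordDet F X u (X u) / affVol F X σ u)
  have ht : ∀ᶠ u in 𝓝 u₀, X u = -(t u • affNormal F X N u) := by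
    filter_upwards [hcenter, h.eventually] with u ⟨s, hs⟩ hu
    have h1 : X u = (-s) • affNormal F X N u := by
      rw [neg_smul]
      exact eq_neg_of_add_eq_zero_left hs
    have h2 := congrArg (coordDet F X u) h1
    rw [(isLinearMap_coordDet F X u).map_smul, hu.coordDet_affNormal, smul_eq_mul] at h2
    have h3 : t u = s := by
      simp only [t, h2]
      field_simp [hu.affVol_ne]
    rw [h3, ← neg_smul]
    exact h1
  have htd : DifferentiableAt ℝ t u₀ :=
    (((contDiffAt_coordDet h.smooth h.smooth).div h.contDiffAt_affVol
      h.affVol_ne).neg).differentiableAt (by simp)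
  have hnd : DifferentiableAt ℝ (affNormal F X N) u₀ :=
    h.contDiffAt_affNormal.differentiableAt (by simp)
  have hne : coordDet F X u₀ (affNormal F X N u₀) ≠ 0 := by
    rw [h.coordDet_affNormal]
    exact h.affVol_ne
  have hdn : ∀ v, fderiv ℝ (affNormal F X N) u₀ v = fderiv ℝ X u₀ ((-L) • v) := by
    intro v
    obtain ⟨a, ha⟩ := exists_decomposition hne (fderiv ℝ (affNormal F X N) u₀ v)
    rw [h.coordDet_fderiv_affNormal, zero_div] at ha
    have h1 := hshape v
    rw [shape, ha, decomp, inverse_coprod_apply hne] at h1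
    rw [ha, zero_smul, add_zero, neg_smul, ← h1, neg_neg]
  have hdX : ∀ v, fderiv ℝ X u₀ v
      = -(t u₀ • fderiv ℝ X u₀ ((-L) • v) + fderiv ℝ t u₀ v • affNormal F X N u₀) := by
    intro v
    have h1 : X =ᶠ[𝓝 u₀] fun u => -(t u • affNormal F X N u) := ht
    have h2 := (htd.hasFDerivAt.smul hnd.hasFDerivAt).neg
    rw [← hdn, h1.fderiv_eq]
    have h3 : fderiv ℝ (fun u => -(t u • affNormal F X N u)) u₀ = _ := h2.fderiv
    rw [h3]
    simp
  obtain ⟨i⟩ := ‹Nonempty κ›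
  -- Differentiating `X = -t ξ` with `dξ = -L dX` and separating the tangential part forces `t L =
  -- 1`. One nonzero direction suffices, hence the need for `Nonempty κ`.
  have h1 : fderiv ℝ X u₀ ((1 - t u₀ * L) • F.source i)
      + fderiv ℝ t u₀ (F.source i) • affNormal F X N u₀ = 0 := by
    rw [sub_smul, one_smul, map_sub, hdX (F.source i), map_smul, map_smul, smul_smul, mul_smul]
    module
  have h2 := (transversal_injective hne h1).1
  have h3 : t u₀ * L = 1 := by
    have := (smul_eq_zero.1 h2).resolve_right (F.source.ne_zero i)
    linarith
  have h4 := ht.self_of_nhds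
  rw [h4, smul_neg, smul_smul, neg_mul, mul_comm, h3]
  simp

/-- A hyperbolic affine hypersphere is one in every preferred chart. -/
theorem exists_sphereNear [Nonempty κ] (p : M) :
    ∃ σ, SphereNear F (inChart I x p) (inChart I η p) L σ (extChartAt I p p) := by
  obtain ⟨σ, h⟩ := hx.exists_nondegNear p
  refine ⟨σ, h, hx.neg, ?_⟩
  filter_upwards [hx.affNormal_inChart p] with u hu
  rw [hu, hx.normalAt_eq]
  rfl

/-- The affine metric read in two charts. -/
theorem metricNear_chartChange {p q : M} (hq : q ∈ (extChartAt I p).source)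
    [IsManifold I 1 M] (v w : E) :
    metricNear F I x η q (extChartAt I q q) v w = metricNear F I x η p (extChartAt I p q)
      (tangentCoordChange I q p q v) (tangentCoordChange I q p q w) := by
  have : FiniteDimensional ℝ E := Module.Finite.of_basis F.source
  have h1 := (reparam_chartChange x η hq).affMetric_eq (F := F) (by
    rw [chartChange_apply]
    filter_upwards [(isOpen_extChartAt_target p).mem_nhds ((extChartAt I p).map_source hq)] with y hy
    exact contDiffAt_inChart hx.smooth p hy) v w
  rw [fderiv_chartChange, chartChange_apply] at h1
  exact h1

end IsHyperbolicAffineSphere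

/-- A family of metrics in the preferred charts which is the family of the expressions of one
metric on the manifold. -/
structure IsTensorial [IsManifold I 1 M] (e : Module.Basis κ ℝ E) (G : M → E → E → E → ℝ) :
    Prop where
  isMetricNear : ∀ p, IsMetricNear e (G p) (extChartAt I p p)
  change : ∀ p q, q ∈ (extChartAt I p).source → ∀ v w, G q (extChartAt I q q) v w
    = G p (extChartAt I p q) (tangentCoordChange I q p q v) (tangentCoordChange I q p q w)

namespace IsTensorial

variable [IsManifold I 1 M] {e : Module.Basis κ ℝ E} {G : M → E → E → E → ℝ}
  (h : IsTensorial (I := I) e G)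
include h

/-- Parallel transport preserves the metric. -/
theorem parallel_const {γ : ℝ → M} (hγ : ContMDiff 𝓘(ℝ, ℝ) I 1 γ) {v w : ℝ → E}
    (hv : IsParallelAlong e I G γ v) (hw : IsParallelAlong e I G γ w) (s t : ℝ) :
    G (γ s) (extChartAt I (γ s) (γ s)) (v s) (w s)
      = G (γ t) (extChartAt I (γ t) (γ t)) (v t) (w t) := by
  have hd : ∀ t₀, HasDerivAt (fun t => G (γ t) (extChartAt I (γ t) (γ t)) (v t) (w t)) 0 t₀ := by
    intro t₀
    have hm := h.isMetricNear (γ t₀)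
    have hself := mem_extChartAt_source (I := I) (γ t₀)
    have hc : HasDerivAt (fun t => extChartAt I (γ t₀) (γ t))
        (deriv (fun t => extChartAt I (γ t₀) (γ t)) t₀) t₀ := by
      have h1 : ContMDiffAt 𝓘(ℝ, ℝ) 𝓘(ℝ, E) 1 (fun t => extChartAt I (γ t₀) (γ t)) t₀ :=
        ContMDiffAt.comp t₀ (contMDiffAt_extChartAt (n := 1)) (hγ t₀)
      exact (h1.contDiffAt.differentiableAt (by simp)).hasDerivAt
    obtain ⟨D, hD, hD'⟩ := hm.hasFDerivAt_apply (c := fun t => extChartAt I (γ t₀) (γ t)) rfl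
      hc.hasFDerivAt (hv t₀).hasFDerivAt (hw t₀).hasFDerivAt
    -- Near `t₀` everything is read in the single chart at `γ t₀`, where the parallel equation gives
    -- the derivatives; metric compatibility then cancels them.
    have hev : (fun t => G (γ t) (extChartAt I (γ t) (γ t)) (v t) (w t)) =ᶠ[𝓝 t₀] fun t =>
        G (γ t₀) (extChartAt I (γ t₀) (γ t)) (tangentCoordChange I (γ t) (γ t₀) (γ t) (v t))
          (tangentCoordChange I (γ t) (γ t₀) (γ t) (w t)) := by
      filter_upwards [hγ.continuous.continuousAt.eventually
        ((isOpen_extChartAt_source (γ t₀)).mem_nhds hself)] with t ht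
      exact h.change _ _ ht _ _
    have h2 := (hD.congr_of_eventuallyEq hev).hasDerivAt
    have h3 : D 1 = 0 := by
      rw [hD']
      simp only [tangentCoordChange_self hself, ContinuousLinearMap.toSpanSingleton_apply,
        one_smul]
      rw [hm.compatible]
      have h4 : ∀ a, -christoffel e (G (γ t₀)) (extChartAt I (γ t₀) (γ t₀))
        (deriv (fun t => extChartAt I (γ t₀) (γ t)) t₀) a = (-1 : ℝ) • christoffel e (G (γ t₀))
          (extChartAt I (γ t₀) (γ t₀)) (deriv (fun t => extChartAt I (γ t₀) (γ t)) t₀) a :=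
        fun a => by simp
      rw [h4, h4, hm.symmBilin.smul_left, hm.symmBilin.smul_right]
      ring
    rwa [h3] at h2
  exact is_const_of_deriv_eq_zero (fun t => (hd t).differentiableAt) (fun t => (hd t).deriv) s t

theorem isTransport_isometry {p q : M} {T : E →L[ℝ] E} (hT : IsTransport e I G p q T) (v w : E) :
    G q (extChartAt I q q) (T v) (T w) = G p (extChartAt I p p) v w := by
  induction hT with
  | refl => rfl
  | step γ S T _ hγ hS ih =>
    obtain ⟨a, ha, ha0, ha1⟩ := hS (T v)
    obtain ⟨b, hb, hb0, hb1⟩ := hS (T w)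
    have := h.parallel_const hγ ha hb 1 0
    rw [ha0, ha1, hb0, hb1] at this
    rw [← ih, ← this]
    rfl

/-- The holonomy algebra consists of skew-symmetric endomorphisms. -/
theorem holonomy_skew {p : M} {T : E →L[ℝ] E} (hT : T ∈ holonomyAlgebra e I G p) (v w : E) :
    G p (extChartAt I p p) (T v) w + G p (extChartAt I p p) v (T w) = 0 := by
  have : FiniteDimensional ℝ E := Module.Finite.of_basis e
  have : CompleteSpace E := FiniteDimensional.complete ℝ E
  have hm := h.isMetricNear p
  have he : HasDerivAt (fun t : ℝ => NormedSpace.exp (t • T)) T 0 := by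
    simpa using hasDerivAt_exp_smul_const (𝕂 := ℝ) T (0 : ℝ)
  have hev : ∀ a, HasDerivAt (fun t : ℝ => NormedSpace.exp (t • T) a) (T a) 0 := fun a => by
    simpa using he.clm_apply (hasDerivAt_const (0 : ℝ) a)
  obtain ⟨D, hD, hD'⟩ := hm.hasFDerivAt_apply (c := fun _ : ℝ => extChartAt I p p) (s := 0) rfl
    (hasFDerivAt_const _ _) (hev v).hasFDerivAt (hev w).hasFDerivAt
  -- Each `exp(tT)` is a parallel transport around a loop, hence an isometry; the claim is the
  -- derivative of this identity at `t = 0`.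
  have hc : (fun t : ℝ => G p (extChartAt I p p) (NormedSpace.exp (t • T) v)
      (NormedSpace.exp (t • T) w)) = fun _ => G p (extChartAt I p p) v w := by
    funext t
    exact h.isTransport_isometry (hT t) v w
  rw [hc] at hD
  have h1 := hD' 1
  rw [hD.unique (hasFDerivAt_const _ _)] at h1
  simpa using h1.symm

end IsTensorial

end OnManifold

/-! ### The linear functionals `log e_a` -/

section Weights

/-- The coefficient of the coordinate numbered `l` in the exponent of the factor numbered `a`, for
the weights `w`. -/
def expCoef (w : ℕ → ℝ) (l a : ℕ) : ℝ :=
  if l + 1 = a then -(1 / w a) else if a ≤ l then 1 / ∑ b ∈ Finset.range (l + 1), w b else 0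

/-- The squared length of a coordinate vector. -/
def expNorm (w : ℕ → ℝ) (l : ℕ) : ℝ :=
  (∑ b ∈ Finset.range (l + 2), w b) / ((∑ b ∈ Finset.range (l + 1), w b) * w (l + 1))

variable {w : ℕ → ℝ} (hw : ∀ a, 0 < w a)
include hw

theorem sum_weights_pos (l : ℕ) : 0 < ∑ b ∈ Finset.range (l + 1), w b :=
  Finset.sum_pos (fun a _ => hw a) ⟨0, by simp⟩

theorem expNorm_pos (l : ℕ) : 0 < expNorm w l :=
  div_pos (sum_weights_pos hw _) (mul_pos (sum_weights_pos hw _) (hw _))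

/-- A coordinate acts as a Helmert contrast: the weighted mean of the values at `0, …, l` minus the
value at `l + 1`. Larger indices have coefficient zero. -/
theorem sum_weight_mul_expCoef {K l : ℕ} (hl : l + 1 < K) (φ : ℕ → ℝ) :
    ∑ a ∈ Finset.range K, w a * expCoef w l a * φ a
      = -φ (l + 1) + (∑ a ∈ Finset.range (l + 1), w a * φ a) /
        ∑ b ∈ Finset.range (l + 1), w b := by
  have h1 : ∑ a ∈ Finset.range K, w a * expCoef w l a * φ a
      = ∑ a ∈ Finset.range (l + 2), w a * expCoef w l a * φ a := by
    symm
    refine Finset.sum_subset (Finset.range_subset_range.2 hl) fun a _ ha => ?_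
    have h2 : l + 2 ≤ a := by simpa using ha
    rw [expCoef, if_neg (by omega), if_neg (by omega)]
    ring
  rw [h1, Finset.sum_range_succ, add_comm, Finset.sum_div]
  congr 1
  · rw [expCoef, if_pos rfl]
    have := (hw (l + 1)).ne'
    field_simp
  · refine Finset.sum_congr rfl fun a ha => ?_
    have h2 : a < l + 1 := by simpa using ha
    rw [expCoef, if_neg (by omega), if_pos (by omega)]
    ring

/-- A later contrast has constant coefficients on the indices that an earlier one uses, and
contrasts annihilate constants. -/
theorem sum_weight_mul_expCoef_mul_expCoef {K l k : ℕ} (hl : l + 1 < K) (hk : k + 1 < K) :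
    ∑ a ∈ Finset.range K, w a * expCoef w l a * expCoef w k a
      = if l = k then expNorm w l else 0 := by
  have key : ∀ {l k : ℕ}, l + 1 < K → l < k →
      ∑ a ∈ Finset.range K, w a * expCoef w l a * expCoef w k a = 0 := by
    intro l k hl hlk
    rw [sum_weight_mul_expCoef hw hl]
    have h1 : ∀ a ∈ Finset.range (l + 1), w a * expCoef w k a
        = w a * (1 / ∑ b ∈ Finset.range (k + 1), w b) := by
      intro a ha
      have h2 : a < l + 1 := by simpa using ha
      rw [expCoef, if_neg (by omega), if_pos (by omega)]
    rw [Finset.sum_congr rfl h1, ← Finset.sum_mul, mul_div_assoc, mul_div_left_comm,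
      div_self (sum_weights_pos hw l).ne', mul_one, expCoef, if_neg (by omega), if_pos (by omega)]
    ring
  split_ifs with h
  · subst h
    rw [sum_weight_mul_expCoef hw hl]
    have h1 : ∀ a ∈ Finset.range (l + 1), w a * expCoef w l a
        = w a * (1 / ∑ b ∈ Finset.range (l + 1), w b) := by
      intro a ha
      have h2 : a < l + 1 := by simpa using ha
      rw [expCoef, if_neg (by omega), if_pos (by omega)]
    rw [Finset.sum_congr rfl h1, ← Finset.sum_mul, expCoef, if_pos rfl, expNorm,
      Finset.sum_range_succ _ (l + 1)]
    have h3 := (sum_weights_pos hw l).ne'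
    have h4 := (hw (l + 1)).ne'
    field_simp
  · rcases lt_or_gt_of_ne h with h | h
    · exact key hl h
    · rw [← key hk h]
      exact Finset.sum_congr rfl fun a _ => by ring

/-- Completeness of the functionals `log e_a`. -/
theorem sum_expCoef_mul (W : ℕ → ℝ) (m : ℕ) {a : ℕ} (ha : a ≤ m) :
    ∑ l ∈ Finset.range m, expCoef w l a * ((expNorm w l)⁻¹ *
      (-W (l + 1) + (∑ b ∈ Finset.range (l + 1), w b * W b) / ∑ b ∈ Finset.range (l + 1), w b))
      = W a - (∑ b ∈ Finset.range (m + 1), w b * W b) / ∑ b ∈ Finset.range (m + 1), w b := by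
  induction m with
  | zero =>
    obtain rfl : a = 0 := by omega
    have := (hw 0).ne'
    simp only [Finset.range_zero, Finset.sum_empty, zero_add, Finset.sum_range_one]
    field_simp
    ring
  | succ m ih =>
    have h1 := (sum_weights_pos hw m).ne'
    have h2 := (sum_weights_pos hw (m + 1)).ne'
    have h3 := (hw (m + 1)).ne'
    -- One more contrast turns the deviation from the mean of the first `m + 1` values into that
    -- from the mean of the first `m + 2`. At the index `m + 1` itself the earlier contrasts vanish,
    -- so the new one gives everything.
    rw [Finset.sum_range_succ, expNorm]
    rcases Nat.lt_or_ge m a with h | h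
    · obtain rfl : a = m + 1 := by omega
      have h4 : ∀ l ∈ Finset.range m, expCoef w l (m + 1) * ((expNorm w l)⁻¹ *
          (-W (l + 1) + (∑ b ∈ Finset.range (l + 1), w b * W b) /
            ∑ b ∈ Finset.range (l + 1), w b)) = 0 := by
        intro l hl
        have : l < m := by simpa using hl
        rw [expCoef, if_neg (by omega), if_neg (by omega), zero_mul]
      rw [Finset.sum_eq_zero h4, expCoef, if_pos rfl,
        Finset.sum_range_succ (fun b => w b * W b) (m + 1)]
      rw [Finset.sum_range_succ w (m + 1)] at h2 ⊢
      field_simp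
      ring
    · rw [ih h, expCoef, if_neg (by omega), if_pos (by omega),
        Finset.sum_range_succ (fun b => w b * W b) (m + 1)]
      rw [Finset.sum_range_succ w (m + 1)] at h2 ⊢
      field_simp
      ring

end Weights

/-! ### The functionals for the given dimensions and the splitting of `ℝ^K`. -/

section Functionals

variable (r : ℕ) {s : ℕ} (n : Fin s → ℕ)

/-- The weight `n_a + 1` of a factor, extended by `1`. -/
def wt (a : ℕ) : ℝ := if h : a < r + s then (dims r n ⟨a, h⟩ : ℝ) + 1 else 1

theorem wt_pos (a : ℕ) : 0 < wt r n a := by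
  rw [wt]
  split_ifs <;> positivity

theorem wt_fin (a : Fin (r + s)) : wt r n a = (dims r n a : ℝ) + 1 := by
  rw [wt, dif_pos a.2]

theorem wt_castAdd (a : Fin r) : wt r n (Fin.castAdd s a) = 1 := by
  rw [wt_fin, dims, Fin.append_left]
  simp

theorem wt_natAdd (α : Fin s) : wt r n (Fin.natAdd r α) = (n α : ℝ) + 1 := by
  rw [wt_fin, dims, Fin.append_right]

theorem f_eq {k : ℕ} (hk : k ≤ r + s) : (f r n k : ℝ) = ∑ b ∈ Finset.range k, wt r n b := by
  have h1 : (f r n k : ℝ) = ∑ b : Fin (r + s), if (b : ℕ) < k then wt r n b else 0 := by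
    rw [f]
    push_cast
    refine Finset.sum_congr rfl fun b _ => ?_
    split_ifs
    · rw [wt_fin]
    · rfl
  rw [h1, Fin.sum_univ_eq_sum_range (fun b => if b < k then wt r n b else 0)]
  rw [← Finset.sum_subset (Finset.range_subset_range.2 hk)]
  · exact Finset.sum_congr rfl fun b hb => by rw [if_pos (by simpa using hb)]
  · intro b _ hb
    rw [if_neg (by simpa using hb)]

/-- The linear functional `log e_a`. -/
def ell (a : Fin (r + s)) : (Fin (r + s - 1) → ℝ) →L[ℝ] ℝ :=
  ∑ l : Fin (r + s - 1), expCoef (wt r n) l a • ContinuousLinearMap.proj l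

theorem ell_apply (a : Fin (r + s)) (t : Fin (r + s - 1) → ℝ) :
    ell r n a t = ∑ l : Fin (r + s - 1), expCoef (wt r n) l a * t l := by
  simp [ell, sum_apply]

theorem expFactor_eq (t : Fin (r + s - 1) → ℝ) (a : Fin (r + s)) :
    expFactor r n t a = Real.exp (ell r n a t) := by
  rw [expFactor, ell_apply]
  congr 1
  refine Finset.sum_congr rfl fun l _ => ?_
  have := l.2
  rw [expCoef]
  split_ifs
  · rw [wt_fin]
    ring
  · rw [f_eq r n (by omega)]
    ring
  · ring

/-- The vector with prescribed logarithmic derivatives, up to a common summand. -/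
def zeta (W : Fin (r + s) → ℝ) : Fin (r + s - 1) → ℝ := fun l =>
  (expNorm (wt r n) l)⁻¹ * ∑ a : Fin (r + s), wt r n a * expCoef (wt r n) l a * W a

theorem zeta_smul (c : ℝ) (W : Fin (r + s) → ℝ) :
    zeta r n (fun a => c * W a) = c • zeta r n W := by
  ext l
  simp only [zeta, Pi.smul_apply, smul_eq_mul, Finset.mul_sum]
  exact Finset.sum_congr rfl fun a _ => by ring

theorem sum_wt (hK : 2 ≤ r + s) : ∑ b ∈ Finset.range (r + s), wt r n b = (compDim r n : ℝ) + 1 := by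
  rw [← Fin.sum_univ_eq_sum_range (wt r n), Fin.sum_univ_add]
  simp only [wt_castAdd, wt_natAdd, Finset.sum_add_distrib, compDim]
  have : (((r + s - 1 : ℕ) : ℝ)) = r + s - 1 := by
    rw [Nat.cast_sub (by omega)]
    push_cast
    ring
  simp [this]
  ring

/-- Contrasts annihilate constants. Equivalently, the product of the `e_a` to the powers `w_a` is
`1`. -/
theorem sum_wt_mul_ell (t : Fin (r + s - 1) → ℝ) :
    ∑ a : Fin (r + s), wt r n a * ell r n a t = 0 := by
  simp only [ell_apply, Finset.mul_sum]
  rw [Finset.sum_comm]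
  refine Finset.sum_eq_zero fun l _ => ?_
  have hl := l.2
  have h1 := sum_weight_mul_expCoef (wt_pos r n) (K := r + s) (l := l) (by omega) fun _ => 1
  simp only [mul_one] at h1
  rw [div_self (sum_weights_pos (wt_pos r n) l).ne', neg_add_cancel,
    ← Fin.sum_univ_eq_sum_range (fun a => wt r n a * expCoef (wt r n) l a)] at h1
  simp only [← mul_assoc, ← Finset.sum_mul, h1, zero_mul]

/-- The Euclidean metric on `ℝ^(r+s-1)` is diagonal. -/
theorem sum_wt_mul_ell_mul_ell (t t' : Fin (r + s - 1) → ℝ) :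
    ∑ a : Fin (r + s), wt r n a * ell r n a t * ell r n a t'
      = ∑ l : Fin (r + s - 1), expNorm (wt r n) l * t l * t' l := by
  have h1 : ∀ l k : Fin (r + s - 1), ∑ a : Fin (r + s), wt r n a * expCoef (wt r n) l a *
      expCoef (wt r n) k a = if l = k then expNorm (wt r n) l else 0 := by
    intro l k
    have hl := l.2
    have hk := k.2
    have := sum_weight_mul_expCoef_mul_expCoef (wt_pos r n) (K := r + s) (l := l) (k := k)
      (by omega) (by omega)
    rw [← Fin.sum_univ_eq_sum_range
      (fun a => wt r n a * expCoef (wt r n) l a * expCoef (wt r n) k a)] at this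
    rw [this]
    simp [Fin.ext_iff]
  have h2 : ∀ a : Fin (r + s), wt r n a * ell r n a t * ell r n a t'
      = ∑ l : Fin (r + s - 1), ∑ k : Fin (r + s - 1), (t l * t' k) *
        (wt r n a * expCoef (wt r n) l a * expCoef (wt r n) k a) := by
    intro a
    rw [ell_apply, ell_apply, mul_assoc, Finset.sum_mul_sum, Finset.mul_sum]
    refine Finset.sum_congr rfl fun l _ => ?_
    rw [Finset.mul_sum]
    exact Finset.sum_congr rfl fun k _ => by ring
  simp only [h2]
  rw [Finset.sum_comm]
  refine Finset.sum_congr rfl fun l _ => ?_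
  rw [Finset.sum_comm]
  simp only [← Finset.mul_sum, h1]
  simp
  ring

/-- Completeness of the contrasts and constants: `zeta` recovers `W` up to its weighted mean. In the
Gauss formula this mean becomes the coefficient of the position vector. -/
theorem ell_zeta (hK : 2 ≤ r + s) (W : Fin (r + s) → ℝ) (a : Fin (r + s)) :
    ell r n a (zeta r n W) = W a - (∑ b : Fin (r + s), wt r n b * W b) / ((compDim r n : ℝ) + 1) := by
  let W' : ℕ → ℝ := fun b => if h : b < r + s then W ⟨b, h⟩ else 0
  have hW : ∀ b : Fin (r + s), W b = W' b := fun b => by simp only [W', dif_pos b.2]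
  have hm : r + s - 1 + 1 = r + s := by omega
  have ha := a.2
  have h1 := sum_expCoef_mul (wt_pos r n) W' (r + s - 1) (a := a) (by omega)
  rw [hm, sum_wt r n hK, ← Fin.sum_univ_eq_sum_range (fun b => wt r n b * W' b)] at h1
  simp only [hW, ell_apply, zeta]
  rw [← h1, ← Fin.sum_univ_eq_sum_range]
  refine Finset.sum_congr rfl fun l _ => ?_
  have hl := l.2
  have h2 := sum_weight_mul_expCoef (wt_pos r n) (K := r + s) (l := l) (by omega) W'
  rw [← Fin.sum_univ_eq_sum_range (fun a => wt r n a * expCoef (wt r n) l a * W' a)] at h2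
  rw [h2]

/-- The constant by which `ℓ_a(ζ(W))` differs from `W_a` is invisible in the pairing with the `ℓ_a`.
-/
theorem sum_ell_zeta (hK : 2 ≤ r + s) (W : Fin (r + s) → ℝ) (t : Fin (r + s - 1) → ℝ) :
    ∑ a : Fin (r + s), wt r n a * ell r n a (zeta r n W) * ell r n a t
      = ∑ a : Fin (r + s), wt r n a * W a * ell r n a t := by
  have h1 := sum_wt_mul_ell r n t
  simp only [ell_zeta r n hK]
  set q := (∑ b : Fin (r + s), wt r n b * W b) / ((compDim r n : ℝ) + 1)
  have h2 : ∀ a : Fin (r + s), wt r n a * (W a - q) * ell r n a t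
      = wt r n a * W a * ell r n a t - q * (wt r n a * ell r n a t) := fun a => by ring
  simp only [h2, Finset.sum_sub_distrib, ← Finset.mul_sum, h1, mul_zero, sub_zero]

end Functionals

/-! ### The derivatives of the composition -/

section LocalComposition

variable {r s : ℕ} {n : Fin s → ℕ} (X η : ∀ α, EuclideanSpace ℝ (Fin (n α)) → Fin (n α + 1) → ℝ)
  (L : Fin s → ℝ) (c : Fin (r + s) → ℝ)

/-- The ambient vector with the components `c_a e_a q_a` and `c_a e_a z_a`. -/
def compVec (t : Fin (r + s - 1) → ℝ) (q : Fin (r + s) → ℝ) (z : ∀ α, Fin (n α + 1) → ℝ) :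
    CompIndex r n → ℝ :=
  Sum.elim
    (fun a => c (Fin.castAdd s a) * Real.exp (ell r n (Fin.castAdd s a) t) * q (Fin.castAdd s a))
    (fun i => c (Fin.natAdd r i.1) * Real.exp (ell r n (Fin.natAdd r i.1) t) * z i.1 i.2)

theorem composition_eq (u : CompTangent r n) :
    composition X c u = compVec c u.1 (fun _ => 1) fun α => X α (u.2 α) := by
  ext i
  rcases i with a | ⟨α, i⟩
  · simp [composition, compVec, expFactor_eq]
  · simp [composition, compVec, expFactor_eq]

theorem compVec_add (t : Fin (r + s - 1) → ℝ) (q q' : Fin (r + s) → ℝ)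
    (z z' : ∀ α, Fin (n α + 1) → ℝ) :
    compVec c t (fun a => q a + q' a) (fun α => z α + z' α)
      = compVec c t q z + compVec c t q' z' := by
  ext i
  rcases i with a | i <;> simp [compVec] <;> ring

theorem compVec_smul (t : Fin (r + s - 1) → ℝ) (k : ℝ) (q : Fin (r + s) → ℝ)
    (z : ∀ α, Fin (n α + 1) → ℝ) :
    compVec c t (fun a => k * q a) (fun α => k • z α) = k • compVec c t q z := by
  ext i
  rcases i with a | i <;> simp [compVec] <;> ring

theorem hasFDerivAt_component {a : Fin (r + s)} {α : Fin s} {u : CompTangent r n}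
    {g : EuclideanSpace ℝ (Fin (n α)) → ℝ} (hg : DifferentiableAt ℝ g (u.2 α)) :
    ∃ D : CompTangent r n →L[ℝ] ℝ,
      HasFDerivAt (fun u : CompTangent r n => c a * Real.exp (ell r n a u.1) * g (u.2 α)) D u ∧
      ∀ v, D v = c a * Real.exp (ell r n a u.1) *
        (ell r n a v.1 * g (u.2 α) + fderiv ℝ g (u.2 α) (v.2 α)) := by
  have h1 : HasFDerivAt (fun u : CompTangent r n => ell r n a u.1)
      ((ell r n a).comp (ContinuousLinearMap.fst ℝ _ _)) u :=
    (ell r n a).hasFDerivAt.comp u hasFDerivAt_fst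
  have h2 : HasFDerivAt (fun u : CompTangent r n => u.2 α)
      ((ContinuousLinearMap.proj (R := ℝ)
        (φ := fun α : Fin s => EuclideanSpace ℝ (Fin (n α))) α).comp
        (ContinuousLinearMap.snd ℝ (Fin (r + s - 1) → ℝ) _)) u :=
    ((ContinuousLinearMap.proj (R := ℝ)
        (φ := fun α : Fin s => EuclideanSpace ℝ (Fin (n α))) α).comp
        (ContinuousLinearMap.snd ℝ (Fin (r + s - 1) → ℝ) _)).hasFDerivAt
  have h3 := (h1.exp.const_mul (c a)).mul (hg.hasFDerivAt.comp u h2)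
  refine ⟨_, h3, fun v => ?_⟩
  simp
  ring

/-- Vectors of the form `compVec` are stable under differentiation, the exponentials only bringing
down `ℓ_a(v)`; applied twice, this gives the second derivatives. -/
theorem hasFDerivAt_compVec {u : CompTangent r n} (q : Fin (r + s) → ℝ)
    {z : ∀ α, EuclideanSpace ℝ (Fin (n α)) → Fin (n α + 1) → ℝ}
    (hz : ∀ α, DifferentiableAt ℝ (z α) (u.2 α)) :
    DifferentiableAt ℝ (fun u : CompTangent r n => compVec c u.1 q fun α => z α (u.2 α)) u ∧
    ∀ v, fderiv ℝ (fun u : CompTangent r n => compVec c u.1 q fun α => z α (u.2 α)) u v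
      = compVec c u.1 (fun a => ell r n a v.1 * q a)
        (fun α => ell r n (Fin.natAdd r α) v.1 • z α (u.2 α)
          + fderiv ℝ (z α) (u.2 α) (v.2 α)) := by
  have hcomp : ∀ i : CompIndex r n, ∃ D : CompTangent r n →L[ℝ] ℝ,
      HasFDerivAt (fun u : CompTangent r n => compVec c u.1 q (fun α => z α (u.2 α)) i) D u ∧
      ∀ v, D v = compVec c u.1 (fun a => ell r n a v.1 * q a)
        (fun α => ell r n (Fin.natAdd r α) v.1 • z α (u.2 α)
          + fderiv ℝ (z α) (u.2 α) (v.2 α)) i := by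
    rintro (a | ⟨α, i⟩)
    · have h1 : HasFDerivAt (fun u : CompTangent r n => ell r n (Fin.castAdd s a) u.1)
          ((ell r n (Fin.castAdd s a)).comp (ContinuousLinearMap.fst ℝ _ _)) u :=
        (ell r n (Fin.castAdd s a)).hasFDerivAt.comp u hasFDerivAt_fst
      refine ⟨_, (h1.exp.const_mul (c (Fin.castAdd s a))).mul_const (q (Fin.castAdd s a)),
        fun v => ?_⟩
      simp [compVec]
      ring
    · have hz' := hasFDerivAt_pi'.1 (hz α).hasFDerivAt i
      obtain ⟨D, hD, hD'⟩ := hasFDerivAt_component c (a := Fin.natAdd r α) (α := α) (u := u)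
        hz'.differentiableAt
      refine ⟨D, hD, fun v => ?_⟩
      rw [hD', hz'.fderiv]
      rfl
  choose D hD hD' using hcomp
  have h1 : HasFDerivAt (fun u : CompTangent r n => compVec c u.1 q fun α => z α (u.2 α))
      (ContinuousLinearMap.pi D) u := hasFDerivAt_pi.2 hD
  refine ⟨h1.differentiableAt, fun v => ?_⟩
  rw [h1.fderiv]
  ext i
  exact hD' i v

variable {X} {u : CompTangent r n}

theorem fderiv_composition (hX : ∀ α, ContDiffAt ℝ ∞ (X α) (u.2 α)) (v : CompTangent r n) :
    fderiv ℝ (composition X c) u v = compVec c u.1 (fun a => ell r n a v.1)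
      (fun α => ell r n (Fin.natAdd r α) v.1 • X α (u.2 α) + fderiv ℝ (X α) (u.2 α) (v.2 α)) := by
  have h1 : composition X c = fun u : CompTangent r n =>
      compVec c u.1 (fun _ => 1) fun α => X α (u.2 α) := funext (composition_eq X c)
  rw [h1, (hasFDerivAt_compVec c (fun _ => 1) fun α => (hX α).differentiableAt (by simp)).2]
  simp

theorem eventually_factor {P : ∀ α, EuclideanSpace ℝ (Fin (n α)) → Prop}
    (hP : ∀ α, ∀ᶠ y in 𝓝 (u.2 α), P α y) : ∀ᶠ y in 𝓝 u, ∀ α, P α (y.2 α) := by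
  refine eventually_all.2 fun α => ?_
  have h1 : ContinuousAt (fun y : CompTangent r n => y.2 α) u := by fun_prop
  exact h1.eventually (hP α)

theorem second_composition (hX : ∀ α, ∀ᶠ y in 𝓝 (u.2 α), ContDiffAt ℝ ∞ (X α) y)
    (v w : CompTangent r n) :
    second (composition X c) u v w
      = compVec c u.1 (fun a => ell r n a v.1 * ell r n a w.1)
        (fun α => ell r n (Fin.natAdd r α) v.1 • (ell r n (Fin.natAdd r α) w.1 • X α (u.2 α)
            + fderiv ℝ (X α) (u.2 α) (w.2 α))
          + (ell r n (Fin.natAdd r α) w.1 • fderiv ℝ (X α) (u.2 α) (v.2 α)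
            + second (X α) (u.2 α) (v.2 α) (w.2 α))) := by
  have h1 : (fun y => fderiv ℝ (composition X c) y w) =ᶠ[𝓝 u] fun y : CompTangent r n =>
      compVec c y.1 (fun a => ell r n a w.1) fun α => (fun y => ell r n (Fin.natAdd r α) w.1 • X α y
        + fderiv ℝ (X α) y (w.2 α)) (y.2 α) := by
    filter_upwards [eventually_factor hX] with y hy
    exact fderiv_composition c hy w
  have hd : ∀ α, DifferentiableAt ℝ (X α) (u.2 α) := fun α =>
    (hX α).self_of_nhds.differentiableAt (by simp)
  have hd' : ∀ α, DifferentiableAt ℝ (fun y => fderiv ℝ (X α) y (w.2 α)) (u.2 α) := fun α =>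
    (contDiffAt_fderiv_apply (hX α).self_of_nhds _).differentiableAt (by simp)
  rw [second, h1.fderiv_eq, (hasFDerivAt_compVec c (fun a => ell r n a w.1)
    (z := fun α y => ell r n (Fin.natAdd r α) w.1 • X α y + fderiv ℝ (X α) y (w.2 α))
    fun α => ((hd α).fun_const_smul _).fun_add (hd' α)).2]
  congr 1
  funext α
  have h2 : fderiv ℝ (fun y => ell r n (Fin.natAdd r α) w.1 • X α y + fderiv ℝ (X α) y (w.2 α))
      (u.2 α) = ell r n (Fin.natAdd r α) w.1 • fderiv ℝ (X α) (u.2 α)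
        + fderiv ℝ (fun y => fderiv ℝ (X α) y (w.2 α)) (u.2 α) :=
    (((hd α).hasFDerivAt.fun_const_smul _).fun_add (hd' α).hasFDerivAt).fderiv
  rw [h2]
  rfl

theorem contDiffAt_composition (hX : ∀ α, ContDiffAt ℝ ∞ (X α) (u.2 α)) :
    ContDiffAt ℝ ∞ (composition X c : CompTangent r n → CompIndex r n → ℝ) u := by
  have h1 : composition X c = fun u : CompTangent r n =>
      compVec c u.1 (fun _ => 1) fun α => X α (u.2 α) := funext (composition_eq X c)
  have h2 : ∀ a, ContDiffAt ℝ ∞ (fun u : CompTangent r n => c a * Real.exp (ell r n a u.1)) u :=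
    fun a => contDiffAt_const.mul ((((ell r n a).contDiff).comp contDiff_fst).exp.contDiffAt)
  rw [h1]
  refine contDiffAt_pi.2 ?_
  rintro (a | ⟨α, i⟩)
  · exact (h2 _).mul contDiffAt_const
  · refine (h2 _).mul ?_
    have h3 : ContDiffAt ℝ ∞ (fun u : CompTangent r n => X α (u.2 α)) u :=
      (hX α).comp u (contDiffAt_pi.1 contDiffAt_snd α)
    exact contDiffAt_pi.1 h3 i

/-! ### The Gauss formula of the composition -/

/-- The metric of the factor `M_α`, up to a constant. -/
def blockForm (X η : ∀ α, EuclideanSpace ℝ (Fin (n α)) → Fin (n α + 1) → ℝ) (L : Fin s → ℝ)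
    (α : Fin s) (y v w : EuclideanSpace ℝ (Fin (n α))) : ℝ :=
  ((n α : ℝ) + 1) * (-L α) * affMetric (stdFrame (n α)) (X α) (η α) y v w

/-- The metric of the composition, up to a constant. -/
def compForm (X η : ∀ α, EuclideanSpace ℝ (Fin (n α)) → Fin (n α + 1) → ℝ) (L : Fin s → ℝ)
    (u v w : CompTangent r n) : ℝ :=
  ∑ a : Fin (r + s), wt r n a * ell r n a v.1 * ell r n a w.1
    + ∑ α, blockForm X η L α (u.2 α) (v.2 α) (w.2 α)

/-- The second fundamental forms of all factors. -/
def compWeights (X η : ∀ α, EuclideanSpace ℝ (Fin (n α)) → Fin (n α + 1) → ℝ) (L : Fin s → ℝ)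
    (u v w : CompTangent r n) (a : Fin (r + s)) : ℝ :=
  ell r n a v.1 * ell r n a w.1 + Fin.addCases (motive := fun _ => ℝ) (fun _ => 0)
    (fun α => affMetric (stdFrame (n α)) (X α) (η α) (u.2 α) (v.2 α) (w.2 α) * (-L α)) a

/-- The common shape of the affine connection and the Fubini-Pick form of the composition. -/
def compTensor (X η : ∀ α, EuclideanSpace ℝ (Fin (n α)) → Fin (n α + 1) → ℝ) (L : Fin s → ℝ)
    (u v w : CompTangent r n) (T : ∀ α, EuclideanSpace ℝ (Fin (n α))) : CompTangent r n :=
  (zeta r n (compWeights X η L u v w), fun α =>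
    ell r n (Fin.natAdd r α) v.1 • w.2 α + ell r n (Fin.natAdd r α) w.1 • v.2 α + T α)

/-- For `φ = 1` the right side is `compForm`, so the weighted mean of the weights is `compForm / (n
+ 1)`. General `φ` is needed for pairing `compTensor` with a third vector. -/
theorem sum_wt_mul_compWeights (X η : ∀ α, EuclideanSpace ℝ (Fin (n α)) → Fin (n α + 1) → ℝ)
    (L : Fin s → ℝ) (u v w : CompTangent r n) (φ : Fin (r + s) → ℝ) :
    ∑ a : Fin (r + s), wt r n a * compWeights X η L u v w a * φ a
      = ∑ a : Fin (r + s), wt r n a * ell r n a v.1 * ell r n a w.1 * φ a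
        + ∑ α, blockForm X η L α (u.2 α) (v.2 α) (w.2 α) * φ (Fin.natAdd r α) := by
  have h1 : ∀ a : Fin (r + s), wt r n a * compWeights X η L u v w a * φ a
      = wt r n a * ell r n a v.1 * ell r n a w.1 * φ a + wt r n a *
        Fin.addCases (motive := fun _ => ℝ) (fun _ => 0) (fun α => affMetric (stdFrame (n α)) (X α)
          (η α) (u.2 α) (v.2 α) (w.2 α) * (-L α)) a * φ a := fun a => by
    rw [compWeights]
    ring
  simp only [h1, Finset.sum_add_distrib]
  congr 1
  rw [Fin.sum_univ_add]
  simp only [Fin.addCases_left, Fin.addCases_right, mul_zero, zero_mul, Finset.sum_const_zero,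
    zero_add, wt_natAdd, blockForm]
  exact Finset.sum_congr rfl fun α _ => by ring

variable {η L} {σ : Fin s → ℝ}

theorem nonempty_of_pos (hn : ∀ α, 0 < n α) (α : Fin s) : Nonempty (Fin (n α)) :=
  ⟨⟨0, hn α⟩⟩

/-- Slot by slot the Gauss formulas of the factors leave tangential terms and the multiple
`compWeights` of the slot of `x`. By `ell_zeta` these multiples, minus their mean, are the effect of
a vector tangent to `ℝ^(K-1)`. -/
theorem gauss_composition (hK : 2 ≤ r + s) (hn : ∀ α, 0 < n α)
    (hX : ∀ α, SphereNear (stdFrame (n α)) (X α) (η α) (L α) (σ α) (u.2 α))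
    (v w : CompTangent r n) :
    second (composition X c) u v w = fderiv ℝ (composition X c) u (compTensor X η L u v w
      fun α => affConnection (stdFrame (n α)) (X α) (η α) (u.2 α) (v.2 α) (w.2 α))
      + (compForm X η L u v w / ((compDim r n : ℝ) + 1)) • composition X c u := by
  have hs : ∀ α, ∀ᶠ y in 𝓝 (u.2 α), ContDiffAt ℝ ∞ (X α) y := fun α => by
    filter_upwards [(hX α).eventually] with y hy using hy.nondeg.smooth
  have hsum := sum_wt_mul_compWeights X η L u v w fun _ => 1
  simp only [mul_one] at hsum
  rw [second_composition c hs, fderiv_composition c (fun α => (hs α).self_of_nhds),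
    composition_eq, ← compVec_smul, ← compVec_add]
  have hz : ∀ a, ell r n a (zeta r n (compWeights X η L u v w))
      = compWeights X η L u v w a - compForm X η L u v w / ((compDim r n : ℝ) + 1) := by
    intro a
    rw [ell_zeta r n hK, hsum]
    rfl
  simp only [compTensor, hz]
  ext i
  rcases i with a | ⟨α, i⟩
  · simp [compVec, compWeights]
  · have := nonempty_of_pos hn α
    simp only [compVec, Sum.elim_inr, (hX α).second_eq, compWeights, Fin.addCases_right, map_add,
      map_smul, Pi.add_apply, Pi.smul_apply, smul_eq_mul]
    ring

end LocalComposition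

theorem det_blockDiagonal_sigma {s : ℕ} {m : Fin s → Type*} [∀ α, Fintype (m α)]
    [∀ α, DecidableEq (m α)] (B : ∀ α, Matrix (m α) (m α) ℝ) :
    (Matrix.blockDiagonal' B).det = ∏ α, (B α).det := by
  rw [(Matrix.blockTriangular_blockDiagonal' B).det_fintype]
  refine Finset.prod_congr rfl fun α _ => ?_
  rw [← Matrix.det_submatrix_equiv_self (Equiv.sigmaSubtype α).symm]
  congr 1
  ext i j
  exact Matrix.blockDiagonal'_apply_eq B α i j

/-! ### The determinants of the composition and of its metric. -/

section CompositionDeterminants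

variable {r s : ℕ} {n : Fin s → ℕ} {X η : ∀ α, EuclideanSpace ℝ (Fin (n α)) → Fin (n α + 1) → ℝ}
  {L : Fin s → ℝ} (c : Fin (r + s) → ℝ) {u : CompTangent r n} {σ : Fin s → ℝ}

theorem compFrame_source_inl (hK : 2 ≤ r + s) (l : Fin (r + s - 1)) :
    (compFrame r n hK).source (Sum.inl l) = (Pi.single l 1, 0) := by
  simp [compFrame]

theorem compFrame_source_inr (hK : 2 ≤ r + s) (α : Fin s) (j : Fin (n α)) :
    (compFrame r n hK).source (Sum.inr ⟨α, j⟩) = (0, Pi.single α ((stdFrame (n α)).source j)) := by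
  ext1
  · simp [compFrame]
  · simp [compFrame, stdFrame]

theorem ell_single (a : Fin (r + s)) (l : Fin (r + s - 1)) :
    ell r n a (Pi.single l 1) = expCoef (wt r n) l a := by
  simp [ell_apply, Pi.single_apply]

theorem symmBilin_blockForm (hX : ∀ α, SphereNear (stdFrame (n α)) (X α) (η α) (L α) (σ α) (u.2 α))
    (α : Fin s) : SymmBilin (blockForm X η L α (u.2 α)) :=
  (hX α).nondeg.symmBilin.const_mul _

theorem gram_compForm (hK : 2 ≤ r + s)
    (hX : ∀ α, SphereNear (stdFrame (n α)) (X α) (η α) (L α) (σ α) (u.2 α)) :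
    gram (compFrame r n hK).source (compForm X η L) u = Matrix.fromBlocks
      (Matrix.diagonal fun l : Fin (r + s - 1) => expNorm (wt r n) l) 0 0
      (Matrix.blockDiagonal' fun α =>
        gram (stdFrame (n α)).source (blockForm X η L α) (u.2 α)) := by
  have hb := symmBilin_blockForm hX
  ext i j
  rcases i with l | ⟨α, i⟩ <;> rcases j with k | ⟨β, j⟩
  · simp only [gram, Matrix.of_apply, compFrame_source_inl, compForm, sum_wt_mul_ell_mul_ell,
      Pi.zero_apply, (hb _).zero_left, Finset.sum_const_zero, add_zero, Matrix.fromBlocks_apply₁₁,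
      Matrix.diagonal_apply]
    rw [Finset.sum_eq_single l (fun b _ hbl => by simp [hbl]) (by simp)]
    by_cases h : l = k <;> simp [h]
  · simp [gram, compFrame_source_inl, compFrame_source_inr, compForm, (hb _).zero_left]
  · simp [gram, compFrame_source_inl, compFrame_source_inr, compForm, (hb _).zero_right]
  · simp only [gram, Matrix.of_apply, compFrame_source_inr, compForm, map_zero, mul_zero,
      Finset.sum_const_zero, zero_add, Matrix.fromBlocks_apply₂₂]
    rw [Finset.sum_eq_single α (fun γ _ hγ => by
      rw [Pi.single_eq_of_ne hγ, (hb _).zero_left]) (by simp), Pi.single_eq_same]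
    by_cases h : α = β
    · subst h
      rw [Pi.single_eq_same, Matrix.blockDiagonal'_apply_eq]
      rfl
    · rw [Pi.single_eq_of_ne h, (hb _).zero_right, Matrix.blockDiagonal'_apply_ne _ _ _ h]

/-- The affine metric of a factor has determinant `L_α² det(∂x_α, x_α)²` up to sign; the rescaling
by `(n_α + 1)(-L_α)` supplies the further `n_α` powers. -/
theorem abs_det_gram_compForm (hK : 2 ≤ r + s) (hn : ∀ α, 0 < n α)
    (hX : ∀ α, SphereNear (stdFrame (n α)) (X α) (η α) (L α) (σ α) (u.2 α)) :
    |(gram (compFrame r n hK).source (compForm X η L) u).det|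
      = (∏ l : Fin (r + s - 1), expNorm (wt r n) l) * ∏ α, (((n α : ℝ) + 1) ^ n α *
        (-L α) ^ (n α + 2) * coordDet (stdFrame (n α)) (X α) (u.2 α) (X α (u.2 α)) ^ 2) := by
  rw [gram_compForm hK hX, Matrix.det_fromBlocks_zero₂₁, Matrix.det_diagonal,
    det_blockDiagonal_sigma, abs_mul, abs_of_pos (show (0 : ℝ) <
      ∏ l : Fin (r + s - 1), expNorm (wt r n) l from
      Finset.prod_pos fun l _ => expNorm_pos (wt_pos r n) l), Finset.abs_prod]
  congr 1
  refine Finset.prod_congr rfl fun α _ => ?_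
  have := nonempty_of_pos hn α
  have hL : 0 < -L α := neg_pos.2 (hX α).neg
  have h1 : gram (stdFrame (n α)).source (blockForm X η L α) (u.2 α)
      = (((n α : ℝ) + 1) * (-L α)) •
        gram (stdFrame (n α)).source (affMetric (stdFrame (n α)) (X α) (η α)) (u.2 α) := by
    ext i j
    simp [gram, blockForm]
  rw [h1, Matrix.det_smul, abs_mul, (hX α).nondeg.abs_det_gram, ← (hX α).coordDet_self,
    abs_of_nonneg (by positivity), Fintype.card_fin, mul_pow]
  ring

/-- The coordinates of a tangent vector together with a multiple of the position vector. -/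
def rowOf (q : Fin (r + s) → ℝ) (y : (Σ α, Fin (n α)) → ℝ) : CompIndex r n → ℝ :=
  Sum.elim (fun a => q (Fin.castAdd s a))
    fun i => (finSuccEquivLast i.2).elim (q (Fin.natAdd r i.1)) fun j => y ⟨i.1, j⟩

/-- The rows of the coordinate vector fields and of the position vector field. -/
def rowMatrix (r : ℕ) {s : ℕ} (n : Fin s → ℕ) : Option (CompCoord r n) → CompIndex r n → ℝ
  | none => rowOf (fun _ => 1) 0
  | some (Sum.inl l) => rowOf (fun a => expCoef (wt r n) l a) 0
  | some (Sum.inr k) => rowOf 0 (Pi.single k 1)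

/-- The block diagonal matrix of the components of the composition. -/
def blockMatrix (X : ∀ α, EuclideanSpace ℝ (Fin (n α)) → Fin (n α + 1) → ℝ)
    (c : Fin (r + s) → ℝ) (u : CompTangent r n) : Matrix (CompIndex r n) (CompIndex r n) ℝ :=
  Matrix.fromBlocks
    (Matrix.diagonal fun a : Fin r => c (Fin.castAdd s a) * Real.exp (ell r n (Fin.castAdd s a) u.1))
    0 0 (Matrix.blockDiagonal' fun α =>
      (c (Fin.natAdd r α) * Real.exp (ell r n (Fin.natAdd r α) u.1)) •
        Matrix.of fun i => coordCols (stdFrame (n α)) (X α) (u.2 α) (X α (u.2 α))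
          (finSuccEquivLast i))

/-- This separates `det(∂x, x)` into a universal matrix of contrasts and a block diagonal one
holding the data of the factors. -/
theorem vecMul_blockMatrix (q : Fin (r + s) → ℝ) (y : (Σ α, Fin (n α)) → ℝ) :
    Matrix.vecMul (rowOf q y) (blockMatrix X c u)
      = compVec c u.1 q fun α => q (Fin.natAdd r α) • X α (u.2 α)
        + ∑ j, y ⟨α, j⟩ • fderiv ℝ (X α) (u.2 α) ((stdFrame (n α)).source j) := by
  ext i
  simp only [Matrix.vecMul, dotProduct, Fintype.sum_sum_type, blockMatrix]
  rcases i with a | ⟨α, i⟩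
  · simp only [Matrix.fromBlocks_apply₁₁, Matrix.fromBlocks_apply₂₁, Matrix.zero_apply, mul_zero,
      Finset.sum_const_zero, add_zero, Matrix.diagonal_apply, mul_ite]
    simp [rowOf, compVec, mul_comm]
  · simp only [Matrix.fromBlocks_apply₁₂, Matrix.fromBlocks_apply₂₂, Matrix.zero_apply, mul_zero,
      Finset.sum_const_zero, zero_add, Fintype.sum_sigma]
    rw [Finset.sum_eq_single α (fun β _ hβ => Finset.sum_eq_zero fun j _ => by
      rw [Matrix.blockDiagonal'_apply_ne _ _ _ hβ, mul_zero]) (by simp)]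
    simp only [Matrix.blockDiagonal'_apply_eq]
    rw [← finSuccEquivLast.symm.sum_comp, Fintype.sum_option]
    simp only [rowOf, compVec, Sum.elim_inr, Equiv.apply_symm_apply, Option.elim_none,
      Option.elim_some, Matrix.smul_apply, Matrix.of_apply, coordCols, smul_eq_mul,
      Pi.add_apply, Pi.smul_apply, Finset.sum_apply, mul_add, Finset.mul_sum]
    congr 1
    · ring
    · exact Finset.sum_congr rfl fun j _ => by ring

theorem coordCols_composition (hK : 2 ≤ r + s) (hX : ∀ α, ContDiffAt ℝ ∞ (X α) (u.2 α))
    (o : Option (CompCoord r n)) :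
    coordCols (compFrame r n hK) (composition X c) u (composition X c u) o
      = Matrix.vecMul (rowMatrix r n o) (blockMatrix X c u) := by
  rcases o with _ | l | ⟨β, j⟩
  · rw [rowMatrix, vecMul_blockMatrix]
    simp [coordCols, composition_eq]
  · rw [rowMatrix, vecMul_blockMatrix]
    simp [coordCols, compFrame_source_inl, fderiv_composition c hX, ell_single]
  · rw [rowMatrix, vecMul_blockMatrix]
    simp only [coordCols, Option.elim_some, compFrame_source_inr, fderiv_composition c hX, map_zero,
      zero_smul, zero_add, Pi.zero_apply]
    congr 1
    funext α
    by_cases h : α = β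
    · subst h
      rw [Finset.sum_eq_single j (fun k _ hk => by
        rw [Pi.single_eq_of_ne (by simpa using hk), zero_smul]) (by simp)]
      simp
    · rw [Pi.single_eq_of_ne h, map_zero, Finset.sum_eq_zero fun k _ => by
        rw [Pi.single_eq_of_ne (by simp [h]), zero_smul]]

/-- The weights of the ambient coordinates. -/
def rowWeight (r : ℕ) {s : ℕ} (n : Fin s → ℕ) : CompIndex r n → ℝ :=
  Sum.elim (fun _ => 1)
    fun i => (finSuccEquivLast i.2).elim ((n i.1 : ℝ) + 1) fun _ => 1

/-- In each block `rowOf` puts `q` in the last coordinate, and only there is the weight `n_α + 1`;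
so the inner product of rows restricts to the weighted one on `ℝ^K`. -/
theorem sum_rowWeight (q q' : Fin (r + s) → ℝ) (y y' : (Σ α, Fin (n α)) → ℝ) :
    ∑ i, rowOf q y i * rowWeight r n i * rowOf q' y' i
      = ∑ a : Fin (r + s), wt r n a * q a * q' a + ∑ k, y k * y' k := by
  rw [Fintype.sum_sum_type, Fin.sum_univ_add, Fintype.sum_sigma, Fintype.sum_sigma, add_assoc,
    ← Finset.sum_add_distrib]
  congr 1
  · refine Finset.sum_congr rfl fun a _ => ?_
    rw [wt_castAdd]
    simp [rowOf, rowWeight]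
  · refine Finset.sum_congr rfl fun α _ => ?_
    rw [← finSuccEquivLast.symm.sum_comp, Fintype.sum_option]
    simp only [rowOf, rowWeight, Sum.elim_inr, Equiv.apply_symm_apply, Option.elim_none,
      Option.elim_some, wt_natAdd]
    congr 1
    · ring
    · simp

theorem prod_rowWeight : ∏ i, rowWeight r n i = ∏ α, ((n α : ℝ) + 1) := by
  rw [Fintype.prod_sum_type, Fintype.prod_sigma]
  simp only [rowWeight, Sum.elim_inl, Sum.elim_inr, Finset.prod_const_one, one_mul]
  refine Finset.prod_congr rfl fun α _ => ?_
  rw [← finSuccEquivLast.symm.prod_comp, Fintype.prod_option]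
  simp

theorem sum_rowMatrix (hK : 2 ≤ r + s) (o o' : Option (CompCoord r n)) :
    ∑ i, rowMatrix r n o i * rowWeight r n i * rowMatrix r n o' i
      = if o = o' then o.elim ((compDim r n : ℝ) + 1)
          (Sum.elim (fun l => expNorm (wt r n) l) fun _ => 1) else 0 := by
  have h0 : ∑ a : Fin (r + s), wt r n a = (compDim r n : ℝ) + 1 := by
    rw [Fin.sum_univ_eq_sum_range (wt r n), sum_wt r n hK]
  have h1 : ∀ l : Fin (r + s - 1), ∑ a : Fin (r + s), wt r n a * expCoef (wt r n) l a = 0 := by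
    intro l
    simpa [ell_single] using sum_wt_mul_ell r n (Pi.single l 1)
  have h2 : ∀ l k : Fin (r + s - 1), ∑ a : Fin (r + s), wt r n a * expCoef (wt r n) l a *
      expCoef (wt r n) k a = if l = k then expNorm (wt r n) l else 0 := by
    intro l k
    have := sum_wt_mul_ell_mul_ell r n (Pi.single l 1) (Pi.single k 1)
    simp only [ell_single] at this
    rw [this, Finset.sum_eq_single l (fun b _ hbl => by simp [hbl]) (by simp)]
    by_cases h : l = k <;> simp [h]
  rcases o with _ | l | k <;> rcases o' with _ | l' | k' <;>
    simp only [rowMatrix, sum_rowWeight]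
  · simp [h0]
  · simp [h1]
  · simp
  · simp [h1]
  · simp [h2]
  · simp
  · simp
  · simp
  · by_cases h : k = k'
    · subst h
      simp [Pi.single_apply]
    · simp [h, Pi.single_apply, Ne.symm h]

/-- The rows are orthogonal for the weights, so `P W Pᵀ` is diagonal with their squared lengths. The
square of the determinant does not depend on the arbitrary ordering `compEquiv`. -/
theorem det_rowMatrix_sq (hK : 2 ≤ r + s) :
    (Matrix.of fun J => rowMatrix r n (compEquiv r n hK J)).det ^ 2 * ∏ α, ((n α : ℝ) + 1)
      = ((compDim r n : ℝ) + 1) * ∏ l : Fin (r + s - 1), expNorm (wt r n) l := by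
  set P : Matrix (CompIndex r n) (CompIndex r n) ℝ :=
    Matrix.of fun J => rowMatrix r n (compEquiv r n hK J) with hP
  have h1 : P * Matrix.diagonal (rowWeight r n) * P.transpose
      = Matrix.diagonal fun J => (compEquiv r n hK J).elim ((compDim r n : ℝ) + 1)
          (Sum.elim (fun l => expNorm (wt r n) l) fun _ => 1) := by
    ext J J'
    rw [Matrix.mul_apply]
    simp only [Matrix.mul_diagonal, Matrix.transpose_apply, hP, Matrix.of_apply, sum_rowMatrix hK,
      Matrix.diagonal_apply, (compEquiv r n hK).injective.eq_iff]
  have h2 := congrArg Matrix.det h1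
  rw [Matrix.det_mul, Matrix.det_mul, Matrix.det_transpose, Matrix.det_diagonal,
    Matrix.det_diagonal, prod_rowWeight, (compEquiv r n hK).prod_comp fun o => o.elim
      ((compDim r n : ℝ) + 1) (Sum.elim (fun l => expNorm (wt r n) l) fun _ => 1),
    Fintype.prod_option, Fintype.prod_sum_type] at h2
  simp only [Option.elim_none, Option.elim_some, Sum.elim_inl, Sum.elim_inr,
    Finset.prod_const_one, mul_one] at h2
  rw [← h2]
  ring

theorem det_blockMatrix : (blockMatrix X c u).det
    = (∏ a : Fin r, c (Fin.castAdd s a)) * ∏ α, (c (Fin.natAdd r α) ^ (n α + 1) *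
      coordDet (stdFrame (n α)) (X α) (u.2 α) (X α (u.2 α))) := by
  have hδ : ∀ α, (Matrix.of fun i => coordCols (stdFrame (n α)) (X α) (u.2 α) (X α (u.2 α))
      (finSuccEquivLast i)).det = coordDet (stdFrame (n α)) (X α) (u.2 α) (X α (u.2 α)) := by
    intro α
    rw [coordDet_eq]
    simp only [stdFrame, Module.Basis.det_reindex, Pi.basisFun_det]
    rfl
  -- Each exponential occurs to the power of its block size `w_a`, and `∑ w_a ℓ_a = 0`.
  have hexp : (∏ a : Fin r, Real.exp (ell r n (Fin.castAdd s a) u.1)) *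
      ∏ α : Fin s, Real.exp (ell r n (Fin.natAdd r α) u.1) ^ (n α + 1) = 1 := by
    have h1 := sum_wt_mul_ell r n u.1
    rw [Fin.sum_univ_add] at h1
    simp only [wt_castAdd, wt_natAdd, one_mul] at h1
    simp only [← Real.exp_nat_mul, ← Real.exp_sum, ← Real.exp_add]
    push_cast
    rw [h1, Real.exp_zero]
  rw [blockMatrix, Matrix.det_fromBlocks_zero₂₁, Matrix.det_diagonal, det_blockDiagonal_sigma]
  simp only [Matrix.det_smul, hδ, Fintype.card_fin, mul_pow, Finset.prod_mul_distrib]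
  linear_combination ((∏ a : Fin r, c (Fin.castAdd s a)) *
    (∏ α : Fin s, c (Fin.natAdd r α) ^ (n α + 1)) *
    ∏ α : Fin s, coordDet (stdFrame (n α)) (X α) (u.2 α) (X α (u.2 α))) * hexp

theorem coordDet_composition (hK : 2 ≤ r + s) (hX : ∀ α, ContDiffAt ℝ ∞ (X α) (u.2 α)) :
    coordDet (compFrame r n hK) (composition X c) u (composition X c u)
      = (Matrix.of fun J => rowMatrix r n (compEquiv r n hK J)).det * (blockMatrix X c u).det := by
  rw [coordDet_eq, ← Matrix.det_mul]
  have h1 : (compFrame r n hK).target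
      = (Pi.basisFun ℝ (CompIndex r n)).reindex (compEquiv r n hK) := rfl
  rw [h1, Module.Basis.det_reindex, Pi.basisFun_det]
  change Matrix.det _ = _
  congr 1
  ext J I
  exact congrFun (coordCols_composition c hK hX (compEquiv r n hK J)) I

end CompositionDeterminants

/-! ### The Fubini–Pick form and its pairing with the metric. -/

section FubiniPick

variable {κ E V : Type*} [Fintype κ] [DecidableEq κ]
  [NormedAddCommGroup E] [NormedSpace ℝ E] [NormedAddCommGroup V] [NormedSpace ℝ V]
  {F : Frame κ E V} {X η : E → V} {σ : ℝ} {u : E}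

theorem isLinearMap_cubic (hg : SymmBilin (affMetric F X η u)) (v w : E) :
    IsLinearMap ℝ (cubic F X η u v w) := by
  constructor
  · intro a b
    simp only [cubic, affConnection, second, map_add, Prod.fst_add, hg.add_left, hg.add_right]
    ring
  · intro t a
    simp only [cubic, affConnection, second, map_smul, Prod.smul_fst, hg.smul_left, hg.smul_right,
      smul_eq_mul]
    ring

theorem NondegNear.affMetric_cubicVec (h : NondegNear F X η σ u) (v w z : E) :
    affMetric F X η u (cubicVec F X η u v w) z = cubic F X η u v w z :=
  sharp_spec F.source h.symmBilin h.isMetricNear.det_ne (isLinearMap_cubic h.symmBilin v w) z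

end FubiniPick

/-! ### The affine invariants of the composition in coordinates. -/

section LocalComposition

variable {r s : ℕ} {n : Fin s → ℕ} {X η : ∀ α, EuclideanSpace ℝ (Fin (n α)) → Fin (n α + 1) → ℝ}
  {L : Fin s → ℝ} (c : Fin (r + s) → ℝ) {u : CompTangent r n} {σ : Fin s → ℝ}

theorem card_compCoord : Fintype.card (CompCoord r n) = compDim r n := by
  simp [compDim, add_comm]

theorem compC_base_pos (hL : ∀ α, L α < 0) (hc : ∀ a, 0 < c a) :
    0 < 1 / ((compDim r n : ℝ) + 1) * (∏ a : Fin r, c (Fin.castAdd s a) ^ 2) *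
    ∏ α : Fin s, c (Fin.natAdd r α) ^ (2 * (n α + 1)) /
      (((n α : ℝ) + 1) ^ (n α + 1) * (-L α) ^ (n α + 2)) := by
  refine mul_pos (mul_pos (by positivity) (Finset.prod_pos fun a _ => pow_pos (hc _) _))
    (Finset.prod_pos fun α _ => div_pos (pow_pos (hc _) _) ?_)
  exact mul_pos (by positivity) (pow_pos (neg_pos.2 (hL α)) _)

theorem compC_pos (hL : ∀ α, L α < 0) (hc : ∀ a, 0 < c a) : 0 < compC r n L c :=
  Real.rpow_pos_of_pos (compC_base_pos c hL hc) _

theorem compC_pow (hL : ∀ α, L α < 0) (hc : ∀ a, 0 < c a) :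
    compC r n L c ^ (compDim r n + 2) = 1 / ((compDim r n : ℝ) + 1) *
      (∏ a : Fin r, c (Fin.castAdd s a) ^ 2) * ∏ α : Fin s, c (Fin.natAdd r α) ^ (2 * (n α + 1)) /
      (((n α : ℝ) + 1) ^ (n α + 1) * (-L α) ^ (n α + 2)) := by
  have h2 : (compDim r n : ℝ) + 2 ≠ 0 := by positivity
  rw [compC, ← Real.rpow_natCast, ← Real.rpow_mul (compC_base_pos c hL hc).le]
  push_cast
  rw [one_div_mul_cancel h2, Real.rpow_one]

variable (hK : 2 ≤ r + s) (hn : ∀ α, 0 < n α)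
  (hX : ∀ α, SphereNear (stdFrame (n α)) (X α) (η α) (L α) (σ α) (u.2 α))
include hK hn hX

theorem coordDet_composition_ne (hc : ∀ a, 0 < c a) :
    coordDet (compFrame r n hK) (composition X c) u (composition X c u) ≠ 0 := by
  rw [coordDet_composition c hK fun α => (hX α).nondeg.smooth]
  refine mul_ne_zero (fun h0 => ?_) ?_
  · have h1 := det_rowMatrix_sq (n := n) hK
    rw [h0, zero_pow two_ne_zero, zero_mul] at h1
    have h2 : (0 : ℝ) < ∏ l : Fin (r + s - 1), expNorm (wt r n) l :=
      Finset.prod_pos fun l _ => expNorm_pos (wt_pos r n) l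
    have : (0 : ℝ) < (compDim r n : ℝ) + 1 := by positivity
    exact (mul_pos this h2).ne h1
  · rw [det_blockMatrix]
    refine mul_ne_zero (Finset.prod_ne_zero_iff.2 fun a _ => (hc _).ne')
      (Finset.prod_ne_zero_iff.2 fun α _ => mul_ne_zero (pow_ne_zero _ (hc _).ne') ?_)
    have := nonempty_of_pos hn α
    exact (hX α).coordDet_self_ne

theorem hForm_composition (v w : CompTangent r n) :
    hForm (compFrame r n hK) (composition X c) u v w
      = coordDet (compFrame r n hK) (composition X c) u (composition X c u)
        / ((compDim r n : ℝ) + 1) * compForm X η L u v w := by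
  rw [hForm, gauss_composition c hK hn hX]
  rw [coordDet_add_smul]
  ring

/-- The determinants of the factors and the lengths `expNorm` occur on both sides to the same power,
so the quotient is constant; its value is what `C` encodes. -/
theorem sq_coordDet_composition (hc : ∀ a, 0 < c a) :
    coordDet (compFrame r n hK) (composition X c) u (composition X c u) ^ 2
      = |(gram (compFrame r n hK).source (compForm X η L) u).det|
        * (((compDim r n : ℝ) + 1) ^ 2 * compC r n L c ^ (compDim r n + 2)) := by
  have hL : ∀ α, L α < 0 := fun α => (hX α).neg
  have h1 := det_rowMatrix_sq (n := n) hK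
  have h2 : (∏ α, ((n α : ℝ) + 1)) ≠ 0 :=
    Finset.prod_ne_zero_iff.2 fun α _ => by positivity
  have hN : (compDim r n : ℝ) + 1 ≠ 0 := by positivity
  rw [← eq_div_iff h2] at h1
  rw [coordDet_composition c hK fun α => (hX α).nondeg.smooth, mul_pow, h1, det_blockMatrix,
    abs_det_gram_compForm hK hn hX, compC_pow c hL hc]
  have h3 : (∏ α, (((n α : ℝ) + 1) ^ n α *
        (-L α) ^ (n α + 2) * coordDet (stdFrame (n α)) (X α) (u.2 α) (X α (u.2 α)) ^ 2)) *
      ∏ α : Fin s, c (Fin.natAdd r α) ^ (2 * (n α + 1)) /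
      (((n α : ℝ) + 1) ^ (n α + 1) * (-L α) ^ (n α + 2))
      = (∏ α, (c (Fin.natAdd r α) ^ (n α + 1) *
      coordDet (stdFrame (n α)) (X α) (u.2 α) (X α (u.2 α)))) ^ 2 / ∏ α, ((n α : ℝ) + 1) := by
    rw [← Finset.prod_mul_distrib, ← Finset.prod_pow, ← Finset.prod_div_distrib]
    refine Finset.prod_congr rfl fun α _ => ?_
    have h4 : (n α : ℝ) + 1 ≠ 0 := by positivity
    have h5 : (-L α) ^ (n α + 2) ≠ 0 := pow_ne_zero _ (neg_pos.2 (hL α)).ne'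
    rw [pow_succ ((n α : ℝ) + 1)]
    field_simp
    ring
  rw [Finset.prod_pow]
  generalize (∏ α, (c (Fin.natAdd r α) ^ (n α + 1) *
      coordDet (stdFrame (n α)) (X α) (u.2 α) (X α (u.2 α)))) = Q at h3 ⊢
  generalize (∏ α, (((n α : ℝ) + 1) ^ n α *
        (-L α) ^ (n α + 2) * coordDet (stdFrame (n α)) (X α) (u.2 α) (X α (u.2 α)) ^ 2)) = A at h3 ⊢
  generalize (∏ α : Fin s, c (Fin.natAdd r α) ^ (2 * (n α + 1)) /
      (((n α : ℝ) + 1) ^ (n α + 1) * (-L α) ^ (n α + 2))) = B at h3 ⊢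
  generalize (∏ α, ((n α : ℝ) + 1)) = D at h2 h3 ⊢
  generalize (∏ l : Fin (r + s - 1), expNorm (wt r n) l) = e
  generalize (∏ a : Fin r, c (Fin.castAdd s a)) = q
  rw [eq_div_iff h2] at h3
  field_simp
  linear_combination (-(e * q ^ 2)) * h3

/-- Up to sign `det h = (D/(n+1))^n det Q`, and `|det Q|` is a constant times `D²`. The exponents
add up to `n + 2`, so the root in the affine metric is explicit. -/
theorem hDisc_composition (hc : ∀ a, 0 < c a) :
    hDisc (compFrame r n hK) (composition X c) u
      = (|coordDet (compFrame r n hK) (composition X c) u (composition X c u)|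
        / (((compDim r n : ℝ) + 1) * compC r n L c)) ^ (compDim r n + 2) := by
  have hC := compC_pos (n := n) c (fun α => (hX α).neg) hc
  have hN : (0 : ℝ) < (compDim r n : ℝ) + 1 := by positivity
  have h1 := sq_coordDet_composition c hK hn hX hc
  rw [← sq_abs] at h1
  have h2 : gram (compFrame r n hK).source (hForm (compFrame r n hK) (composition X c)) u
      = (coordDet (compFrame r n hK) (composition X c) u (composition X c u)
        / ((compDim r n : ℝ) + 1)) • gram (compFrame r n hK).source (compForm X η L) u := by
    ext i j
    simp [gram, hForm_composition c hK hn hX]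
  rw [hDisc, h2, Matrix.det_smul, abs_mul, abs_pow, card_compCoord, abs_div, abs_of_pos hN,
    ← div_div, div_pow _ (compC r n L c), eq_div_iff (pow_pos hC _).ne']
  generalize |coordDet (compFrame r n hK) (composition X c) u (composition X c u)| = d at h1 ⊢
  rw [pow_add (d / _), div_pow d _ 2, h1]
  field_simp

theorem rpow_hDisc_composition (hc : ∀ a, 0 < c a) :
    hDisc (compFrame r n hK) (composition X c) u
      ^ (1 / ((Fintype.card (CompCoord r n) : ℝ) + 2))
      = |coordDet (compFrame r n hK) (composition X c) u (composition X c u)|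
        / (((compDim r n : ℝ) + 1) * compC r n L c) := by
  have hC := compC_pos (n := n) c (fun α => (hX α).neg) hc
  have h2 : (compDim r n : ℝ) + 2 ≠ 0 := by positivity
  rw [hDisc_composition c hK hn hX hc, card_compCoord, ← Real.rpow_natCast, ← Real.rpow_mul
    (div_nonneg (abs_nonneg _) (by positivity))]
  push_cast
  rw [mul_one_div_cancel h2, Real.rpow_one]

theorem nondegNear_composition (hc : ∀ a, 0 < c a) :
    NondegNear (compFrame r n hK) (composition X c) (composition X c)
      (Real.sign (coordDet (compFrame r n hK) (composition X c) u (composition X c u))) u := by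
  have hC := compC_pos (n := n) c (fun α => (hX α).neg) hc
  have hne := coordDet_composition_ne c hK hn hX hc
  refine nondegNear_of_ne ?_ ?_
    (contDiffAt_composition c fun α => (hX α).nondeg.smooth).continuousAt hne
  · filter_upwards [eventually_factor fun α => (hX α).eventually] with y hy
    exact contDiffAt_composition c fun α => (hy α).nondeg.smooth
  · rw [hDisc_composition c hK hn hX hc]
    have := abs_pos.2 hne
    positivity

/-- The signed density is `D / ((n + 1) C)`, so the position vector divided by `(n + 1) C` has the
normalization required by `NondegNear.sphereNear`. -/
theorem sphereNear_composition (hc : ∀ a, 0 < c a) :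
    SphereNear (compFrame r n hK) (composition X c) (composition X c)
      (-1 / (((compDim r n : ℝ) + 1) * compC r n L c))
      (Real.sign (coordDet (compFrame r n hK) (composition X c) u (composition X c u))) u := by
  have hC := compC_pos (n := n) c (fun α => (hX α).neg) hc
  have hne : Nonempty (CompCoord r n) := ⟨Sum.inl ⟨0, by omega⟩⟩
  have h := nondegNear_composition c hK hn hX hc
  refine h.sphereNear (div_neg_of_neg_of_pos (by norm_num) (by positivity)) ?_
  filter_upwards [eventually_factor fun α => (hX α).eventually, h.eventually] with y hy hy'
  have h1 := real_sign_mul_abs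
    (coordDet (compFrame r n hK) (composition X c) y (composition X c y))
  rw [hy'.side] at h1
  rw [affVol, rpow_hDisc_composition c hK hn hy hc, ← mul_div_assoc, h1]
  ring

theorem affMetric_composition (hc : ∀ a, 0 < c a) (v w : CompTangent r n) :
    affMetric (compFrame r n hK) (composition X c) (composition X c) u v w
      = compC r n L c * compForm X η L u v w := by
  have hC := compC_pos (n := n) c (fun α => (hX α).neg) hc
  have hN : (0 : ℝ) < (compDim r n : ℝ) + 1 := by positivity
  have hne : Nonempty (CompCoord r n) := ⟨Sum.inl ⟨0, by omega⟩⟩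
  have h := sphereNear_composition c hK hn hX hc
  have h0 := coordDet_composition_ne c hK hn hX hc
  rw [h.nondeg.affMetric_eq, hForm_composition c hK hn hX, ← h.coordDet_self]
  field_simp

theorem affConnection_composition (hc : ∀ a, 0 < c a) (v w : CompTangent r n) :
    affConnection (compFrame r n hK) (composition X c) (composition X c) u v w
      = compTensor X η L u v w fun α =>
        affConnection (stdFrame (n α)) (X α) (η α) (u.2 α) (v.2 α) (w.2 α) := by
  have hne : Nonempty (CompCoord r n) := ⟨Sum.inl ⟨0, by omega⟩⟩
  exact (sphereNear_composition c hK hn hX hc).affConnection_eq (gauss_composition c hK hn hX v w)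

omit hn in
-- Apart from the terms in `T` the result is totally symmetric in `v, w, z`; this is why the
-- connection and the Fubini–Pick form share the shape `compTensor`.
theorem compForm_compTensor (v w z : CompTangent r n) (T : ∀ α, EuclideanSpace ℝ (Fin (n α))) :
    compForm X η L u (compTensor X η L u v w T) z
      = ∑ a : Fin (r + s), wt r n a * ell r n a v.1 * ell r n a w.1 * ell r n a z.1
        + ∑ α, (blockForm X η L α (u.2 α) (v.2 α) (w.2 α) * ell r n (Fin.natAdd r α) z.1
          + blockForm X η L α (u.2 α) (w.2 α) (z.2 α) * ell r n (Fin.natAdd r α) v.1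
          + blockForm X η L α (u.2 α) (v.2 α) (z.2 α) * ell r n (Fin.natAdd r α) w.1)
        + ∑ α, blockForm X η L α (u.2 α) (T α) (z.2 α) := by
  have hb := symmBilin_blockForm hX
  simp only [compForm, compTensor, sum_ell_zeta r n hK, sum_wt_mul_compWeights, (hb _).add_left,
    (hb _).smul_left, Finset.sum_add_distrib]
  simp only [mul_comm (ell r n _ _) (blockForm _ _ _ _ _ _ _)]
  ring

/-- The summand on `ℝ^(K-1)` has constant coefficients, so only the factors contribute. -/
theorem fderiv_compForm (v w z : CompTangent r n) :
    fderiv ℝ (fun y => compForm X η L y v w) u z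
      = ∑ α, ((n α : ℝ) + 1) * (-L α) * fderiv ℝ
        (fun y => affMetric (stdFrame (n α)) (X α) (η α) y (v.2 α) (w.2 α)) (u.2 α) (z.2 α) := by
  have h1 : ∀ α, HasFDerivAt (fun y : CompTangent r n => blockForm X η L α (y.2 α) (v.2 α) (w.2 α))
      ((((n α : ℝ) + 1) * (-L α)) • (fderiv ℝ
        (fun y => affMetric (stdFrame (n α)) (X α) (η α) y (v.2 α) (w.2 α)) (u.2 α)).comp
          ((ContinuousLinearMap.proj α).comp (ContinuousLinearMap.snd ℝ _ _))) u := fun α => by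
    have h2 := ((hX α).nondeg.isMetricNear.differentiableAt (v.2 α) (w.2 α)).hasFDerivAt
    have h3 : HasFDerivAt (fun y : CompTangent r n => y.2 α)
      ((ContinuousLinearMap.proj α).comp (ContinuousLinearMap.snd ℝ _ _)) u :=
      (((ContinuousLinearMap.proj α).comp (ContinuousLinearMap.snd ℝ (Fin (r + s - 1) → ℝ) _)) :
        CompTangent r n →L[ℝ] EuclideanSpace ℝ (Fin (n α))).hasFDerivAt
    exact (h2.comp u h3).const_mul _
  have h4 := (HasFDerivAt.fun_sum (u := Finset.univ) fun α _ => h1 α).const_add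
    (∑ a : Fin (r + s), wt r n a * ell r n a v.1 * ell r n a w.1)
  have h5 : (fun y => compForm X η L y v w) = fun y : CompTangent r n =>
    ∑ a : Fin (r + s), wt r n a * ell r n a v.1 * ell r n a w.1
      + ∑ α, blockForm X η L α (y.2 α) (v.2 α) (w.2 α) := rfl
  rw [h5, h4.fderiv]
  simp

theorem cubicVec_composition (hc : ∀ a, 0 < c a) (v w : CompTangent r n) :
    cubicVec (compFrame r n hK) (composition X c) (composition X c) u v w
      = compTensor X η L u v w fun α =>
        cubicVec (stdFrame (n α)) (X α) (η α) (u.2 α) (v.2 α) (w.2 α) := by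
  have h := (sphereNear_composition c hK hn hX hc).nondeg
  have hb := symmBilin_blockForm hX
  refine eq_sharp _ h.symmBilin h.isMetricNear.det_ne (isLinearMap_cubic h.symmBilin v w)
    fun z => ?_
  have h1 : (fun y => affMetric (compFrame r n hK) (composition X c) (composition X c) y v w)
      =ᶠ[𝓝 u] fun y => compC r n L c * compForm X η L y v w := by
    filter_upwards [eventually_factor fun α => (hX α).eventually] with y hy
    exact affMetric_composition c hK hn hy hc v w
  have h2 : ∀ α, blockForm X η L α (u.2 α)
      (cubicVec (stdFrame (n α)) (X α) (η α) (u.2 α) (v.2 α) (w.2 α)) (z.2 α)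
      = -(1 / 2) * (((n α : ℝ) + 1) * (-L α) * fderiv ℝ
        (fun y => affMetric (stdFrame (n α)) (X α) (η α) y (v.2 α) (w.2 α)) (u.2 α) (z.2 α)
        - blockForm X η L α (u.2 α) (affConnection (stdFrame (n α)) (X α) (η α) (u.2 α)
          (z.2 α) (v.2 α)) (w.2 α)
        - blockForm X η L α (u.2 α) (affConnection (stdFrame (n α)) (X α) (η α) (u.2 α)
          (z.2 α) (w.2 α)) (v.2 α)) := fun α => by
    rw [(hb α).symm _ (v.2 α)]
    simp only [blockForm, (hX α).nondeg.affMetric_cubicVec, cubic]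
    ring
  have h3 : fderiv ℝ (fun y => compC r n L c * compForm X η L y v w) u z
      = compC r n L c * fderiv ℝ (fun y => compForm X η L y v w) u z := by
    exact DFunLike.congr_fun (congrFun (fderiv_const_smul_field (𝕜 := ℝ)
      (f := fun y => compForm X η L y v w) (compC r n L c)) u) z
  rw [cubic, h1.fderiv_eq, h3, h.symmBilin.symm v]
  simp only [affMetric_composition c hK hn hX hc, affConnection_composition c hK hn hX hc,
    compForm_compTensor hK hX, fderiv_compForm hK hn hX, h2]
  -- Both connection terms of `-½ ∇g` contribute the same symmetric form, and `-½ · (-2) = 1`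
  -- returns it unchanged.
  have h4 : ∀ a : Fin (r + s), wt r n a * ell r n a z.1 * ell r n a v.1 * ell r n a w.1
      = wt r n a * ell r n a v.1 * ell r n a w.1 * ell r n a z.1 := fun a => by ring
  have h5 : ∀ a : Fin (r + s), wt r n a * ell r n a z.1 * ell r n a w.1 * ell r n a v.1
      = wt r n a * ell r n a v.1 * ell r n a w.1 * ell r n a z.1 := fun a => by ring
  simp only [h4, h5, (hb _).symm (z.2 _), (hb _).symm (w.2 _) (v.2 _), ← Finset.mul_sum,
    Finset.sum_add_distrib, Finset.sum_sub_distrib]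
  ring

end LocalComposition

section Zero

variable {κ E V : Type*} [Fintype κ] [DecidableEq κ]
  [NormedAddCommGroup E] [NormedSpace ℝ E] [NormedAddCommGroup V] [NormedSpace ℝ V]
  (F : Frame κ E V) (X η : E → V) (u : E)

theorem second_zero_right (v : E) : second X u v 0 = 0 := by
  simp [second]

theorem affMetric_zero_left (w : E) : affMetric F X η u 0 w = 0 := by
  simp [affMetric, hForm, second, (isLinearMap_coordDet F X u).map_zero]

theorem affMetric_zero_right (v : E) : affMetric F X η u v 0 = 0 := by
  simp [affMetric, hForm, second_zero_right, (isLinearMap_coordDet F X u).map_zero]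

theorem cubicVec_zero_left (w : E) : cubicVec F X η u 0 w = 0 := by
  simp [cubicVec, sharp, cubic, affConnection, second_zero_right, affMetric_zero_left]

theorem cubicVec_zero_right (v : E) : cubicVec F X η u v 0 = 0 := by
  simp [cubicVec, sharp, cubic, affConnection, second_zero_right, affMetric_zero_right]

end Zero

/-! ### The vectors `H_α`. -/

section MeanCurvature

variable (r : ℕ) {s : ℕ} (n : Fin s → ℕ) (L : Fin s → ℝ) (c : Fin (r + s) → ℝ)

/-- The mean curvature vector of the factor `M_α`. -/
def meanVec (α : Fin s) : Fin (r + s - 1) → ℝ :=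
  (compC r n L c)⁻¹ • zeta r n (Pi.single (Fin.natAdd r α) (1 / ((n α : ℝ) + 1)))

theorem zeta_zero : zeta r n (fun _ => 0) = 0 := by
  ext l
  simp [zeta]

theorem zeta_single (α : Fin s) (l : Fin (r + s - 1)) :
    zeta r n (Pi.single (Fin.natAdd r α) (1 / ((n α : ℝ) + 1))) l
      = (expNorm (wt r n) l)⁻¹ * expCoef (wt r n) l (r + α) := by
  have h : (n α : ℝ) + 1 ≠ 0 := by positivity
  rw [zeta, Finset.sum_eq_single (Fin.natAdd r α) (fun b _ hb => by
    rw [Pi.single_eq_of_ne hb, mul_zero]) (by simp), Pi.single_eq_same, wt_natAdd]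
  congr 1
  rw [mul_right_comm, mul_one_div_cancel h, one_mul]
  rfl

theorem ell_zeta_single (hK : 2 ≤ r + s) (α β : Fin s) :
    ell r n (Fin.natAdd r β) (zeta r n (Pi.single (Fin.natAdd r α) (1 / ((n α : ℝ) + 1))))
      = (if α = β then 1 / ((n α : ℝ) + 1) else 0) - 1 / ((compDim r n : ℝ) + 1) := by
  have h : (n α : ℝ) + 1 ≠ 0 := by positivity
  rw [ell_zeta r n hK, Finset.sum_eq_single (Fin.natAdd r α) (fun b _ hb => by
    rw [Pi.single_eq_of_ne hb, mul_zero]) (by simp), Pi.single_eq_same, wt_natAdd,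
    mul_one_div_cancel h]
  congr 1
  by_cases hαβ : α = β
  · subst hαβ
    simp
  · rw [if_neg hαβ, Pi.single_eq_of_ne]
    exact fun h0 => hαβ (Fin.natAdd_injective _ _ h0).symm

/-- The vector defining `H_β` is concentrated at one factor, where weight times entry is `1`. By
`sum_ell_zeta` the product collapses to a value of one functional, given by `ell_zeta_single`. -/
theorem sum_ell_meanVec (hK : 2 ≤ r + s) (hC : compC r n L c ≠ 0) (α β : Fin s) :
    compC r n L c * ∑ a : Fin (r + s), wt r n a * ell r n a (meanVec r n L c α)
      * ell r n a (meanVec r n L c β)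
      = (compC r n L c)⁻¹ * ((if α = β then 1 / ((n α : ℝ) + 1) else 0)
        - 1 / ((compDim r n : ℝ) + 1)) := by
  have h : (n β : ℝ) + 1 ≠ 0 := by positivity
  have h1 := (sum_ell_zeta r n hK (Pi.single (Fin.natAdd r β) (1 / ((n β : ℝ) + 1)))
    (zeta r n (Pi.single (Fin.natAdd r α) (1 / ((n α : ℝ) + 1))))).trans
    (Finset.sum_eq_single (Fin.natAdd r β) (fun b _ hb => by
      rw [Pi.single_eq_of_ne hb, mul_zero, zero_mul]) (by simp))
  rw [Pi.single_eq_same, wt_natAdd,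
    mul_one_div_cancel h, one_mul, ell_zeta_single r n hK] at h1
  rw [← h1]
  simp only [meanVec, map_smul, smul_eq_mul, Finset.mul_sum]
  refine Finset.sum_congr rfl fun a _ => ?_
  field_simp

theorem meanVec_eq (α : Fin s) : meanVec r n L c α
    = -((f r n (r + α) : ℝ) / (f r n (r + α + 1) * compC r n L c)) • dt r s (r + α)
      + (1 / compC r n L c) • ∑ β : Fin s,
        if α < β then (((n β : ℝ) + 1) / f r n (r + β + 1)) • dt r s (r + β) else 0 := by
  ext l
  have hl := l.2
  have hα := α.2
  have hw := wt_pos r n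
  simp only [meanVec, Pi.smul_apply, zeta_single, smul_eq_mul, Pi.add_apply, Finset.sum_apply]
  have hS := (sum_weights_pos hw l).ne'
  have hS' := (sum_weights_pos hw (l + 1)).ne'
  have hwl := (hw (l + 1)).ne'
  have hterm : ∀ β : Fin s, (if α < β then (((n β : ℝ) + 1) / f r n (r + β + 1)) •
      dt r s (r + β) else 0) l
      = if α < β ∧ (l : ℕ) + 1 = r + β then ((n β : ℝ) + 1) / f r n (r + β + 1) else 0 := by
    intro β
    by_cases h1 : α < β <;> by_cases h2 : (l : ℕ) + 1 = r + β <;> simp [h1, h2, dt]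
  -- Coordinates are counted from `0`: entry `l` belongs to `∂/∂t^(l+1)` and is reached only by the
  -- factor `β = l + 1 - r`.
  have hsum : ∑ β : Fin s, (if α < β then (((n β : ℝ) + 1) / f r n (r + β + 1)) •
      dt r s (r + β) else 0) l
      = if r + α ≤ l then wt r n (l + 1) / ∑ b ∈ Finset.range (l + 2), wt r n b else 0 := by
    simp only [hterm]
    by_cases h : r + (α : ℕ) ≤ l
    · have hb : (l : ℕ) + 1 - r < s := by omega
      rw [if_pos h, Finset.sum_eq_single ⟨(l : ℕ) + 1 - r, hb⟩]
      · have h1 : r + ((l : ℕ) + 1 - r) = l + 1 := by omega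
        have h2 := wt_natAdd r n ⟨(l : ℕ) + 1 - r, hb⟩
        simp only [Fin.natAdd_mk, h1] at h2
        rw [if_pos ⟨Fin.lt_def.2 (by simp only; omega), by simp only; omega⟩]
        simp only [h1]
        rw [f_eq r n (by omega), h2]
      · intro β _ hβ
        rw [if_neg]
        rintro ⟨-, h3⟩
        exact hβ (Fin.ext (by simp only; omega))
      · simp
    · rw [if_neg h]
      refine Finset.sum_eq_zero fun β _ => if_neg ?_
      rintro ⟨h1, h2⟩
      have := Fin.lt_def.1 h1
      omega
  rw [hsum, expNorm, expCoef, dt]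
  -- The three cases of `expCoef` give the negative term, the tail of the sum, and zero. If `r + α =
  -- 0` the first case is empty, in accordance with `dt r s 0 = 0`.
  by_cases h1 : (l : ℕ) + 1 = r + α
  · rw [if_pos h1, if_pos h1, if_neg (by omega), ← h1, f_eq r n (k := (l : ℕ) + 1) (by omega),
      f_eq r n (k := (l : ℕ) + 1 + 1) (by omega)]
    field_simp
    ring
  · rw [if_neg h1, if_neg h1]
    by_cases h2 : r + (α : ℕ) ≤ l
    · rw [if_pos h2, if_pos h2]
      field_simp
      ring
    · rw [if_neg h2, if_neg h2]
      ring

end MeanCurvature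

/-! ### The composition on the product manifold. -/

section Product

variable {r s : ℕ} {n : Fin s → ℕ} {M : Fin s → Type*} [∀ α, TopologicalSpace (M α)]
  [∀ α, ChartedSpace (EuclideanSpace ℝ (Fin (n α))) (M α)] [∀ α, IsManifold (𝓡 (n α)) ∞ (M α)]
  {x η : ∀ α, M α → Fin (n α + 1) → ℝ} {L : Fin s → ℝ} {c : Fin (r + s) → ℝ}

theorem factorMetric_eq (α : Fin s) (p : (Fin (r + s - 1) → ℝ) × (∀ α, M α))
    (v w : EuclideanSpace ℝ (Fin (n α))) :
    factorMetric x η L c α (p.2 α) v w = compC r n L c *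
      blockForm (fun α => inChart (𝓡 (n α)) (x α) (p.2 α))
        (fun α => inChart (𝓡 (n α)) (η α) (p.2 α)) L α ((extChartAt (compModel r n) p p).2 α) v w := by
  change _ * affMetric _ _ _ _ v w = _ * (_ * affMetric _ _ _ _ v w)
  rw [← mul_assoc, mul_comm (compC r n L c)]
  rfl

variable (hK : 2 ≤ r + s) (hn : ∀ α, 0 < n α)
  (hx : ∀ α, IsHyperbolicAffineSphere (stdFrame (n α)) (𝓡 (n α)) (x α) (η α) (L α))
  (hc : ∀ a, 0 < c a)
include hn hx

theorem exists_sphereNear_factors (p : (Fin (r + s - 1) → ℝ) × (∀ α, M α)) :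
    ∃ σ : Fin s → ℝ, ∀ α, SphereNear (stdFrame (n α)) (inChart (𝓡 (n α)) (x α) (p.2 α))
      (inChart (𝓡 (n α)) (η α) (p.2 α)) (L α) (σ α) ((extChartAt (compModel r n) p p).2 α) := by
  have h : ∀ α, ∃ σ, SphereNear (stdFrame (n α)) (inChart (𝓡 (n α)) (x α) (p.2 α))
      (inChart (𝓡 (n α)) (η α) (p.2 α)) (L α) σ ((extChartAt (compModel r n) p p).2 α) := fun α => by
    have := nonempty_of_pos hn α
    exact (hx α).exists_sphereNear (p.2 α)
  choose σ hσ using h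
  exact ⟨σ, hσ⟩

theorem symmBilin_factorMetric (α : Fin s) (q : M α) :
    SymmBilin (factorMetric x η L c α q) := by
  have := nonempty_of_pos hn α
  obtain ⟨σ, h⟩ := (hx α).exists_sphereNear q
  exact h.nondeg.symmBilin.const_mul _

include hc

/-- Invariance of the affine metric under change of charts passes to constant multiples; it makes
the results on curvature and holonomy applicable to `g_α`. -/
theorem isTensorial_factorMetric (α : Fin s) :
    IsTensorial (I := 𝓡 (n α)) (stdFrame (n α)).source (factorMetricNear x η L c α) := by
  have := nonempty_of_pos hn α
  have hC := compC_pos (n := n) c (fun α => (hx α).neg) hc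
  refine ⟨fun q => ?_, fun p q hq v w => ?_⟩
  · obtain ⟨σ, h⟩ := (hx α).exists_sphereNear q
    have h2 : ((n α : ℝ) + 1) * (-L α) * compC r n L c ≠ 0 :=
      mul_ne_zero (mul_ne_zero (by positivity) (neg_pos.2 (hx α).neg).ne') hC.ne'
    exact h.nondeg.isMetricNear.const_mul h2
  · simp only [factorMetricNear, (hx α).metricNear_chartChange hq]

theorem compMetric_eq (p : (Fin (r + s - 1) → ℝ) × (∀ α, M α)) (v w : CompTangent r n) :
    compMetric hK x c p v w
      = compC r n L c * ∑ a : Fin (r + s), wt r n a * ell r n a v.1 * ell r n a w.1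
        + ∑ α, factorMetric x η L c α (p.2 α) (v.2 α) (w.2 α) := by
  obtain ⟨σ, hσ⟩ := exists_sphereNear_factors (r := r) hn hx p
  have h := affMetric_composition c hK hn hσ hc v w
  simp only [factorMetric_eq, ← Finset.mul_sum, ← mul_add]
  -- The preferred chart of the product is the product of the preferred charts, and the composition
  -- read in it unfolds to the composition of the factors so read.
  exact h

theorem compCubic_eq (p : (Fin (r + s - 1) → ℝ) × (∀ α, M α)) (v w : CompTangent r n) :
    compCubic hK x c p v w
      = compTensor (fun α => inChart (𝓡 (n α)) (x α) (p.2 α))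
        (fun α => inChart (𝓡 (n α)) (η α) (p.2 α)) L (extChartAt (compModel r n) p p) v w
        fun α => cubicAt (stdFrame (n α)) (𝓡 (n α)) (x α) (η α) (p.2 α) (v.2 α) (w.2 α) := by
  obtain ⟨σ, hσ⟩ := exists_sphereNear_factors (r := r) hn hx p
  exact cubicVec_composition c hK hn hσ hc v w

theorem isHyperbolicAffineSphere_composition :
    IsHyperbolicAffineSphere (compFrame r n hK) (compModel r n) (composition x c)
      (composition x c) (-1 / (((compDim r n : ℝ) + 1) * compC r n L c)) := by
  have hC := compC_pos (n := n) c (fun α => (hx α).neg) hc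
  have hne : Nonempty (CompCoord r n) := ⟨Sum.inl ⟨0, by omega⟩⟩
  have hneg : -1 / (((compDim r n : ℝ) + 1) * compC r n L c) < 0 :=
    div_neg_of_neg_of_pos (by norm_num) (by positivity)
  have hcont : Continuous (composition x c) := by
    have h1 : ∀ a, Continuous fun p : (Fin (r + s - 1) → ℝ) × (∀ α, M α) =>
        c a * expFactor r n p.1 a := fun a => by
      simp only [expFactor_eq]
      fun_prop
    refine continuous_pi ?_
    rintro (a | ⟨α, i⟩)
    · exact h1 _
    · have h2 : Continuous fun p : (Fin (r + s - 1) → ℝ) × (∀ α, M α) => x α (p.2 α) :=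
        (hx α).smooth.continuous.comp ((continuous_apply α).comp continuous_snd)
      exact (h1 _).mul ((continuous_apply i).comp h2)
  have hself : ∀ p, inChart (compModel r n) (composition x c) p (extChartAt (compModel r n) p p)
      = composition x c p := fun p => by
    rw [inChart, extChartAt_to_inv]
  have hS : ∀ p, ∃ σ, SphereNear (compFrame r n hK) (inChart (compModel r n) (composition x c) p)
      (inChart (compModel r n) (composition x c) p)
      (-1 / (((compDim r n : ℝ) + 1) * compC r n L c)) σ (extChartAt (compModel r n) p p) := by
    intro p
    obtain ⟨σ, hσ⟩ := exists_sphereNear_factors (r := r) hn hx p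
    exact ⟨_, sphereNear_composition c hK hn hσ hc⟩
  refine ⟨fun p => ?_, fun p => ?_, hcont, fun p => ?_, hneg, fun p v => ?_, fun p => ?_⟩
  · obtain ⟨σ, h⟩ := hS p
    exact contMDiffAt_iff.2 ⟨hcont.continuousAt, h.nondeg.smooth.contDiffWithinAt⟩
  · obtain ⟨σ, h⟩ := hS p
    exact h.nondeg.hDisc_pos.ne'
  · obtain ⟨σ, h⟩ := hS p
    have := h.coordDet_self_ne
    rwa [hself] at this
  · obtain ⟨σ, h⟩ := hS p
    exact h.shape_eq v
  · obtain ⟨σ, h⟩ := hS p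
    have h1 := h.normal.self_of_nhds
    rw [hself] at h1
    -- The affine normal is `-L₁ x`, so the normal line meets the origin at the parameter `1 / L₁`.
    refine ⟨1 / (-1 / (((compDim r n : ℝ) + 1) * compC r n L c)), ?_⟩
    rw [normalAt, h1, smul_smul, mul_neg, one_div_mul_cancel hneg.ne, neg_one_smul, add_neg_cancel]

/-- For two vectors tangent to `M_α` the weights live in the single slot `α` and are proportional to
`g_α`; linearity of `zeta` gives `A^0_αα = g_α ⊗ H_α`, an umbilicity from which the trace and the
invariance statements follow. -/
theorem cubicBlock_none (α : Fin s) (p : (Fin (r + s - 1) → ℝ) × (∀ α, M α))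
    (v w : EuclideanSpace ℝ (Fin (n α))) :
    cubicBlock hK x c (some α) (some α) none p v w
      = factorMetric x η L c α (p.2 α) v w • meanVec r n L c α := by
  have hC := compC_pos (n := n) c (fun α => (hx α).neg) hc
  have h1 : (compWeights (r := r) (fun α => inChart (𝓡 (n α)) (x α) (p.2 α))
      (fun α => inChart (𝓡 (n α)) (η α) (p.2 α)) L (extChartAt (compModel r n) p p)
      (0, Pi.single α v) (0, Pi.single α w)) = fun a => ((compC r n L c)⁻¹ *
        factorMetric x η L c α (p.2 α) v w) *
        (Pi.single (Fin.natAdd r α) (1 / ((n α : ℝ) + 1)) : Fin (r + s) → ℝ) a := by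
    funext a
    rw [factorMetric_eq, inv_mul_cancel_left₀ hC.ne', compWeights]
    refine Fin.addCases (fun a => ?_) (fun β => ?_) a
    · rw [Fin.addCases_left, Pi.single_eq_of_ne]
      · simp
      · intro h
        have h1 := congrArg Fin.val h
        have h2 := a.2
        simp only [Fin.val_castAdd, Fin.val_natAdd] at h1
        omega
    · rw [Fin.addCases_right]
      by_cases h : β = α
      · subst h
        have : (n β : ℝ) + 1 ≠ 0 := by positivity
        simp only [Pi.single_eq_same, map_zero, blockForm]
        field_simp
        ring
      · have hv : (Pi.single α v : ∀ α, EuclideanSpace ℝ (Fin (n α))) β = 0 :=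
          Pi.single_eq_of_ne (M := fun α => EuclideanSpace ℝ (Fin (n α))) h v
        have ha : (Pi.single (Fin.natAdd r α) (1 / ((n α : ℝ) + 1)) : Fin (r + s) → ℝ)
            (Fin.natAdd r β) = 0 :=
          Pi.single_eq_of_ne (fun h0 => h (Fin.natAdd_injective _ _ h0)) _
        rw [ha]
        simp [hv, affMetric_zero_left]
  change (compCubic hK x c p (0, Pi.single α v) (0, Pi.single α w)).1 = _
  rw [compCubic_eq hK hn hx hc, compTensor, h1, zeta_smul, meanVec, smul_smul]
  rw [mul_comm]

theorem cubicBlock_some (α : Fin s) (p : (Fin (r + s - 1) → ℝ) × (∀ α, M α))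
    (v w : EuclideanSpace ℝ (Fin (n α))) :
    cubicBlock hK x c (some α) (some α) (some α) p v w
      = cubicAt (stdFrame (n α)) (𝓡 (n α)) (x α) (η α) (p.2 α) v w := by
  change (compCubic hK x c p (0, Pi.single α v) (0, Pi.single α w)).2 α = _
  rw [compCubic_eq hK hn hx hc, compTensor]
  simp

theorem cubicBlock_eq_zero (p : (Fin (r + s - 1) → ℝ) × (∀ α, M α)) (i j k : Option (Fin s))
    (h0 : (i, j, k) ≠ (none, none, none))
    (h : ∀ α, (i, j, k) ≠ (some α, some α, none) ∧ (i, j, k) ≠ (some α, none, some α) ∧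
      (i, j, k) ≠ (none, some α, some α) ∧ (i, j, k) ≠ (some α, some α, some α))
    (v : Block r n i) (w : Block r n j) : cubicBlock hK x c i j k p v w = 0 := by
  -- Two vanishing criteria from the shape of `compTensor`: the flat component vanishes when all
  -- weights do, the component `γ` when its three summands do.
  have hw : ∀ v w : CompTangent r n, (∀ a, ell r n a v.1 * ell r n a w.1 = 0) →
      (∀ α, v.2 α = 0 ∨ w.2 α = 0) → (compCubic hK x c p v w).1 = 0 := by
    intro v w h1 h2
    rw [compCubic_eq hK hn hx hc, compTensor]
    have : compWeights (fun α => inChart (𝓡 (n α)) (x α) (p.2 α))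
        (fun α => inChart (𝓡 (n α)) (η α) (p.2 α)) L (extChartAt (compModel r n) p p) v w
        = fun _ => 0 := by
      funext a
      rw [compWeights, h1, zero_add]
      refine Fin.addCases (fun a => ?_) (fun β => ?_) a
      · rw [Fin.addCases_left]
      · rw [Fin.addCases_right]
        rcases h2 β with h | h
        · rw [h, affMetric_zero_left, zero_mul]
        · rw [h, affMetric_zero_right, zero_mul]
    rw [this, zeta_zero]
  have hT : ∀ (v w : CompTangent r n) (γ : Fin s),
      ell r n (Fin.natAdd r γ) v.1 • w.2 γ = 0 → ell r n (Fin.natAdd r γ) w.1 • v.2 γ = 0 →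
      (v.2 γ = 0 ∨ w.2 γ = 0) → (compCubic hK x c p v w).2 γ = 0 := by
    intro v w γ h1 h2 h3
    rw [compCubic_eq hK hn hx hc, compTensor]
    simp only [h1, h2, zero_add]
    rcases h3 with h | h
    · rw [h]
      exact cubicVec_zero_left _ _ _ _ _
    · rw [h]
      exact cubicVec_zero_right _ _ _ _ _
  have hs : ∀ {α γ : Fin s} (v : EuclideanSpace ℝ (Fin (n α))), γ ≠ α →
      (Pi.single α v : ∀ α, EuclideanSpace ℝ (Fin (n α))) γ = 0 :=
    fun v h => Pi.single_eq_of_ne (M := fun α => EuclideanSpace ℝ (Fin (n α))) h v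
  rcases i with _ | α <;> rcases j with _ | β <;> rcases k with _ | γ
  · exact absurd rfl h0
  · exact hT (v, 0) (w, 0) γ (by simp) (by simp) (by simp)
  · exact hw (v, 0) (0, Pi.single β w) (by simp) (by simp)
  · have hγ : γ ≠ β := fun h1 => (h γ).2.2.1 (by rw [h1])
    exact hT (v, 0) (0, Pi.single β w) γ (by simp [hs w hγ]) (by simp) (by simp)
  · exact hw (0, Pi.single α v) (w, 0) (by simp) (by simp)
  · have hγ : γ ≠ α := fun h1 => (h γ).2.1 (by rw [h1])
    exact hT (0, Pi.single α v) (w, 0) γ (by simp) (by simp [hs v hγ]) (by simp)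
  · have hαβ : α ≠ β := fun h1 => (h α).1 (by rw [h1])
    refine hw (0, Pi.single α v) (0, Pi.single β w) (by simp) fun γ => ?_
    by_cases hγ : γ = α
    · exact Or.inr (hs w (hγ ▸ hαβ))
    · exact Or.inl (hs v hγ)
  · refine hT (0, Pi.single α v) (0, Pi.single β w) γ (by simp) (by simp) ?_
    by_cases hγ : γ = α
    · refine Or.inr (hs w fun h1 => (h γ).2.2.2 ?_)
      rw [← hγ, ← h1]
    · exact Or.inl (hs v hγ)

theorem traceVec_eq (α : Fin s) (p : (Fin (r + s - 1) → ℝ) × (∀ α, M α)) :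
    traceVec hK x η L c α p = meanVec r n L c α := by
  have hm := (isTensorial_factorMetric hn hx hc α).isMetricNear (p.2 α)
  have hn' : (n α : ℝ) ≠ 0 := by exact_mod_cast (hn α).ne'
  have h1 : ∀ i, ∑ j, (gram (stdFrame (n α)).source (factorMetricNear x η L c α (p.2 α))
      (extChartAt (𝓡 (n α)) (p.2 α) (p.2 α)))⁻¹ i j * factorMetric x η L c α (p.2 α)
      ((stdFrame (n α)).source i) ((stdFrame (n α)).source j) = 1 := fun i => by
    have := sum_inv_gram_mul (stdFrame (n α)).source hm.det_ne i i
    rw [if_pos rfl] at this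
    rw [← this]
    refine Finset.sum_congr rfl fun j _ => ?_
    rw [(symmBilin_factorMetric hn hx α (p.2 α)).symm]
    rfl
  have h2 : ∀ i j, (cubicBlock hK x c (some α) (some α) none p
      ((stdFrame (n α)).source i) ((stdFrame (n α)).source j) : Fin (r + s - 1) → ℝ)
      = factorMetric x η L c α (p.2 α) ((stdFrame (n α)).source i) ((stdFrame (n α)).source j) •
        meanVec r n L c α := fun i j => cubicBlock_none hK hn hx hc α p _ _
  rw [traceVec]
  simp only [h2, smul_smul, ← Finset.sum_smul, h1]
  simp [hn']

theorem compMetric_traceVec (α β : Fin s) (p : (Fin (r + s - 1) → ℝ) × (∀ α, M α)) :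
    compMetric hK x c p (incl r n none (traceVec hK x η L c α p))
      (incl r n none (traceVec hK x η L c β p))
      = (compC r n L c)⁻¹ * ((if α = β then 1 / ((n α : ℝ) + 1) else 0)
        - 1 / ((compDim r n : ℝ) + 1)) := by
  have hC := compC_pos (n := n) c (fun α => (hx α).neg) hc
  rw [compMetric_eq hK hn hx hc, traceVec_eq hK hn hx hc, traceVec_eq hK hn hx hc,
    ← sum_ell_meanVec r n L c hK hC.ne']
  simp [incl, (symmBilin_factorMetric hn hx _ _).zero_left]

theorem exists_euclidean_factor : ∃ Φ : (Fin (r + s - 1) → ℝ) ≃ₗ[ℝ] EuclideanSpace ℝ (Fin (r + s - 1)),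
    ∀ (p : (Fin (r + s - 1) → ℝ) × (∀ α, M α)) (v w : CompTangent r n),
      compMetric hK x c p v w = inner ℝ (Φ v.1) (Φ w.1)
        + ∑ α, factorMetric x η L c α (p.2 α) (v.2 α) (w.2 α) := by
  have hC := compC_pos (n := n) c (fun α => (hx α).neg) hc
  have hpos : ∀ l : Fin (r + s - 1), 0 < compC r n L c * expNorm (wt r n) l :=
    fun l => mul_pos hC (expNorm_pos (wt_pos r n) l)
  -- The metric on `ℝ^(K-1)` is already diagonal in `t`, so it suffices to stretch each coordinate
  -- by the square root of its entry.
  refine ⟨(LinearEquiv.piCongrRight fun l : Fin (r + s - 1) => LinearEquiv.smulOfNeZero ℝ ℝ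
    (Real.sqrt (compC r n L c * expNorm (wt r n) l)) (Real.sqrt_pos.2 (hpos l)).ne').trans
    (WithLp.linearEquiv 2 ℝ (Fin (r + s - 1) → ℝ)).symm, fun p v w => ?_⟩
  rw [compMetric_eq hK hn hx hc, sum_wt_mul_ell_mul_ell, PiLp.inner_apply, Finset.mul_sum]
  congr 1
  refine Finset.sum_congr rfl fun l _ => ?_
  have h1 := Real.mul_self_sqrt (hpos l).le
  simp
  linear_combination (-(v.1 l * w.1 l)) * h1

end Product

end Calabi

end

/-! ### The theorem. -/

open Calabi in
theorem mainTheorem8 {r s : ℕ} (hK : 2 ≤ r + s) (n : Fin s → ℕ) (hn : ∀ α, 0 < n α)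
    (M : Fin s → Type*) [∀ α, TopologicalSpace (M α)] [∀ α, T2Space (M α)]
    [∀ α, SecondCountableTopology (M α)]
    [∀ α, ChartedSpace (EuclideanSpace ℝ (Fin (n α))) (M α)]
    [∀ α, IsManifold (𝓡 (n α)) ∞ (M α)]
    (x η : ∀ α, M α → Fin (n α + 1) → ℝ) (L : Fin s → ℝ)
    (hx : ∀ α, IsHyperbolicAffineSphere (stdFrame (n α)) (𝓡 (n α)) (x α) (η α) (L α))
    (c : Fin (r + s) → ℝ) (hc : ∀ a, 0 < c a) :
    ∃ L₁ : ℝ,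
      -- `x` is a hyperbolic affine hypersphere with affine mean curvature `L₁ = -1/((n+1)C)`
      IsHyperbolicAffineSphere (compFrame r n hK) (compModel r n)
        (composition x c) (composition x c) L₁ ∧
      L₁ = -1 / (((compDim r n : ℝ) + 1) * compC r n L c) ∧
      -- the affine metric is positive definite if those of the factors are
      ((∀ α (p : M α) (v : EuclideanSpace ℝ (Fin (n α))), v ≠ 0 →
          0 < metricAt (stdFrame (n α)) (𝓡 (n α)) (x α) (η α) p v v) →
        ∀ (p : (Fin (r + s - 1) → ℝ) × (∀ α, M α)) (v : CompTangent r n), v ≠ 0 →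
          0 < compMetric hK x c p v v) ∧
      -- (1), (2), (3)
      (∃ q : ℕ, (q : ℤ) = r + s - 1 ∧ (¬ (r = 2 ∧ s = 0) → 2 ≤ q + s) ∧ 0 < q ∧
        (s : ℤ) - 1 ≤ q ∧ ((q : ℤ) = s - 1 ↔ r = 0) ∧
        ∃ Φ : (Fin (r + s - 1) → ℝ) ≃ₗ[ℝ] EuclideanSpace ℝ (Fin q),
          ∀ (p : (Fin (r + s - 1) → ℝ) × (∀ α, M α)) (v w : CompTangent r n),
            compMetric hK x c p v w = inner ℝ (Φ v.1) (Φ w.1)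
              + ∑ α, factorMetric x η L c α (p.2 α) (v.2 α) (w.2 α)) ∧
      ∀ p : (Fin (r + s - 1) → ℝ) × (∀ α, M α),
        -- (4)
        (∀ i j k : Option (Fin s), (i, j, k) ≠ (none, none, none) →
          (∀ α, (i, j, k) ≠ (some α, some α, none) ∧ (i, j, k) ≠ (some α, none, some α) ∧
            (i, j, k) ≠ (none, some α, some α) ∧ (i, j, k) ≠ (some α, some α, some α)) →
          ∀ (v : Block r n i) (w : Block r n j), cubicBlock hK x c i j k p v w = 0) ∧
        -- (5)
        (∀ α (v w y z : EuclideanSpace ℝ (Fin (n α))),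
          cubicBlock hK x c (some α) (some α) none p
              (curvatureAt (stdFrame (n α)).source (𝓡 (n α)) (factorMetricNear x η L c α)
                (p.2 α) v w y) z
            + cubicBlock hK x c (some α) (some α) none p
              y (curvatureAt (stdFrame (n α)).source (𝓡 (n α)) (factorMetricNear x η L c α)
                (p.2 α) v w z) = 0) ∧
        (∀ α, ∀ T ∈ holonomyAlgebra (stdFrame (n α)).source (𝓡 (n α))
            (factorMetricNear x η L c α) (p.2 α),
          ∀ y z : EuclideanSpace ℝ (Fin (n α)),
            cubicBlock hK x c (some α) (some α) none p (T y) z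
              + cubicBlock hK x c (some α) (some α) none p y (T z) = 0) ∧
        -- (6)
        (∀ α, traceVec hK x η L c α p =
          -((f r n (r + α) : ℝ) / (f r n (r + α + 1) * compC r n L c)) • dt r s (r + α)
            + (1 / compC r n L c) • ∑ β : Fin s,
              if α < β then (((n β : ℝ) + 1) / f r n (r + β + 1)) • dt r s (r + β) else 0) ∧
        (∀ α, compMetric hK x c p (incl r n none (traceVec hK x η L c α p))
              (incl r n none (traceVec hK x η L c α p))
            = (compC r n L c)⁻¹ * (1 / ((n α : ℝ) + 1) - 1 / f r n (r + s)) ∧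
          compMetric hK x c p (incl r n none (traceVec hK x η L c α p))
              (incl r n none (traceVec hK x η L c α p))
            = ((compDim r n : ℝ) - n α) / ((n α : ℝ) + 1) * (-L₁)) ∧
        (∀ α β, α ≠ β →
          compMetric hK x c p (incl r n none (traceVec hK x η L c α p))
            (incl r n none (traceVec hK x η L c β p)) = L₁) ∧
        -- (7)
        (∀ α (v w : EuclideanSpace ℝ (Fin (n α))),
          cubicBlock hK x c (some α) (some α) (some α) p v w
            = cubicAt (stdFrame (n α)) (𝓡 (n α)) (x α) (η α) (p.2 α) v w) := by
  have hC := compC_pos (n := n) c (fun α => (hx α).neg) hc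
  have hN : (0 : ℝ) < (compDim r n : ℝ) + 1 := by positivity
  have hf : (f r n (r + s) : ℝ) = (compDim r n : ℝ) + 1 := by
    rw [f_eq r n le_rfl, sum_wt r n hK]
  obtain ⟨Φ, hΦ⟩ := exists_euclidean_factor hK hn hx hc
  refine ⟨_, isHyperbolicAffineSphere_composition hK hn hx hc, rfl, fun hpos p v hv => ?_,
    ⟨r + s - 1, by omega, by omega, by omega, by omega, by omega, Φ, hΦ⟩, fun p =>
    ⟨cubicBlock_eq_zero hK hn hx hc p, fun α v w y z => ?_, fun α T hT y z => ?_, fun α => ?_,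
      fun α => ?_, fun α β hαβ => ?_, fun α => cubicBlock_some hK hn hx hc α p⟩⟩
  · have hfac : ∀ α (v : EuclideanSpace ℝ (Fin (n α))), v ≠ 0 →
        0 < factorMetric x η L c α (p.2 α) v v := fun α v hv =>
      mul_pos (mul_pos (mul_pos (by positivity) (neg_pos.2 (hx α).neg)) hC) (hpos α (p.2 α) v hv)
    have hfac' : ∀ α, 0 ≤ factorMetric x η L c α (p.2 α) (v.2 α) (v.2 α) := fun α => by
      by_cases h : v.2 α = 0
      · rw [h, (symmBilin_factorMetric hn hx α (p.2 α)).zero_left]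
      · exact (hfac α _ h).le
    rw [hΦ]
    -- Both summands are nonnegative, and a nonzero `v` has a nonzero component in the flat factor
    -- or in some `M_α`.
    by_cases h1 : v.1 = 0
    · obtain ⟨α, hα⟩ : ∃ α, v.2 α ≠ 0 := by
        by_contra! h2
        exact hv (Prod.ext h1 (funext h2))
      exact add_pos_of_nonneg_of_pos real_inner_self_nonneg
        (Finset.sum_pos' (fun α _ => hfac' α) ⟨α, Finset.mem_univ α, hfac α _ hα⟩)
    · exact add_pos_of_pos_of_nonneg (real_inner_self_pos.2 (by simpa using h1))
        (Finset.sum_nonneg fun α _ => hfac' α)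
  · have h := ((isTensorial_factorMetric hn hx hc α).isMetricNear (p.2 α)).curvature_skew v w y z
    -- Both terms are multiples of the same vector `H_α`, and skew-symmetry for `g_α` makes the
    -- coefficients cancel.
    rw [cubicBlock_none hK hn hx hc, cubicBlock_none hK hn hx hc]
    refine (add_smul _ _ _).symm.trans ?_
    exact (congrArg (· • meanVec r n L c α) h).trans (zero_smul _ _)
  · have h := (isTensorial_factorMetric hn hx hc α).holonomy_skew hT y z
    rw [cubicBlock_none hK hn hx hc, cubicBlock_none hK hn hx hc]
    refine (add_smul _ _ _).symm.trans ?_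
    exact (congrArg (· • meanVec r n L c α) h).trans (zero_smul _ _)
  · rw [traceVec_eq hK hn hx hc, meanVec_eq]
  · have hα : (n α : ℝ) + 1 ≠ 0 := by positivity
    rw [compMetric_traceVec hK hn hx hc, if_pos rfl, hf]
    refine ⟨rfl, ?_⟩
    field_simp
    ring
  · rw [compMetric_traceVec hK hn hx hc, if_neg hαβ]
    field_simp
    ring
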